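/- Let $M=\mathbb R^n$ with Lebesgue measure, let $\mathcal H_{\rm f}$ be a separable complex Hilbert space and $\mathcal H=L^2(M,dx;\mathcal H_{\rm f})$. For a Banach space $\mathcal E$ let $C^k_{\rm b}(M,\mathcal E)$ be the space of $C^k$ functions $M\to\mathcal E$ whose partial derivatives of order $\le k$ are bounded. A bounded continuous family $A(x)\in\mathcal L(\mathcal H_{\rm f})$ acts on $\mathcal H$ by $(A\psi)(x)=A(x)\psi(x)$. Write $R_\lambda(T)=(T-\lambda)^{-1}$ and let $m\ge 2$. **Assumption $\mathbf H_0^m$.** $H_0(x)$, $x\in M$, are self-adjoint operators on a common dense domain $\mathcal D\subset\mathcal H_{\rm f}$. With $\|\psi\|_{H_0(x)}=\|H_0(x)\psi\|+\|\psi\|$, there are $x_0\in M$ and constants $C_1>0$, $C_2<\infty$ with $C_1\|\psi\|_{H_0(x_0)}\le\|\psi\|_{H_0(x)}\le C_2\|\psi\|_{H_0(x_0)}$ for all $x\in M$, $\psi\in\mathcal D$, and $H_0(\cdot)\in C^m_{\rm b}(M,\mathcal L(\mathcal D,\mathcal H_{\rm f}))$, where $\mathcal D$ carries the norm $\|\cdot\|_{H_0(x_0)}$.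 For every $x$, $P_*(x)$ is an orthogonal projection with $H_0(x)P_*(x)=E(x)P_*(x)$, where $P_*(\cdot)\in C^{m+1}_{\rm b}(M,\mathcal L(\mathcal H_{\rm f}))$ and $E(\cdot)\in C^m_{\rm b}(M,\mathbb R)$. Put $H_0=\int_M^\oplus dx\,H_0(x)$ and $G_{\delta,j}(x)=R_{E(x)-i\delta}(H_0(x))\,(\partial_{x_j}P_*)(x)\,P_*(x)$. Consider the conditions (i) $\lim_{\delta\downarrow 0}\operatorname{ess\,sup}_{x\in M}\|\delta\,G_{\delta,j}(x)\|=0$ for $1\le j\le n$; (ii) for some $\delta_0>0$, some function $\eta:[0,\delta_0]\to[0,\delta_0]$ with $\eta(\delta)\ge\delta$, and some constant $C<\infty$: $\operatorname{ess\,sup}_{x\in M}\|G_{\delta,j}(x)\|\le C\delta^{-1}\eta(\delta)$ for all $\delta\in(0,\delta_0]$, $1\le j\le n$; (iii) in addition to (ii), also $\operatorname{ess\,sup}_{x\in M}\|\partial_{x_k}G_{\delta,j}(x)\|\le C\delta^{-1}\eta(\delta)$ for all $\delta\in(0,\delta_0]$, $1\le k,j\le n$. **Assumption $\mathbf h^m$.**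 For $\varepsilon\in(0,1]$, $h^\varepsilon$ is a self-adjoint operator on $\mathcal H$ with domain $D(h)$ independent of $\varepsilon$, such that $H_0+h^\varepsilon$ is essentially self-adjoint on $D(h)\cap D(H_0)$. There are $n$-tuples $(Dh)^\varepsilon$ of bounded self-adjoint operators on $\mathcal H$, bounded uniformly in $\varepsilon\in(0,1]$, and a constant $C<\infty$ such that for all $\varepsilon\in(0,1]$: for each $A\in C^m_{\rm b}(M,\mathcal L(\mathcal H_{\rm f}))$ $$\big\|[h^\varepsilon,A]+i\varepsilon\,\nabla_xA\cdot(Dh)^\varepsilon\big\|_{\mathcal L(\mathcal H)}\le C\sum_{j=2}^m\varepsilon^j\sup_{x\in M,\,|\alpha|=j}\|\partial_x^\alpha A(x)\|,$$ and $$\big\|[(Dh)^\varepsilon,H_0]\big\|_{\mathcal L(D(H_0),\mathcal H)}+\big\|[(Dh)^\varepsilon,h^\varepsilon]\big\|_{\mathcal L(\mathcal H)}\le C\varepsilon .$$ (Here $D(H_0)$ carries the graph norm, operators with $n$ components are measured with the Euclidean norm, and boundedness of a commutator with an unbounded operator includes that the bounded operator preserves its domain.) Let $H^\varepsilon$ be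 the closure of $H_0+h^\varepsilon$ and $H^\varepsilon_{\rm diag}$ the closure of $H_0+P_*h^\varepsilon P_*+P_*^\perp h^\varepsilon P_*^\perp$, and let $U^\varepsilon(t)=e^{-iH^\varepsilon t/\varepsilon}$, $U^\varepsilon_{\rm diag}(t)=e^{-iH^\varepsilon_{\rm diag}t/\varepsilon}$. **Theorem.** Assume $\mathbf H^m_0$ and $\mathbf h^m$ for some $m\ge2$. Then $H^\varepsilon_{\rm diag}$ is self-adjoint on $D(H^\varepsilon)$ for all $\varepsilon\in(0,1]$, and - (i) implies $\lim_{\varepsilon\downarrow0}\|U^\varepsilon(t)-U^\varepsilon_{\rm diag}(t)\|_{\mathcal L(\mathcal H)}=0$ for every $t\in\mathbb R$; - (ii) implies that for some constant $C<\infty$, all $\varepsilon\in(0,1]$ with $\varepsilon^{1/2}\le\delta_0$ and all $t\in\mathbb R$: $\|U^\varepsilon(t)-U^\varepsilon_{\rm diag}(t)\|_{\mathcal L(\mathcal H)}\le C\,\eta(\varepsilon^{1/2})(1+|t|)$; - (iii) implies that for some constant $C<\infty$, all $\varepsilon\in(0,1]$ with $\varepsilon\le\delta_0$ and all $t\in\mathbb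 R$: $\|U^\varepsilon(t)-U^\varepsilon_{\rm diag}(t)\|_{\mathcal L(\mathcal H)}\le C\,\eta(\varepsilon)(1+|t|)$. -/

import Mathlib

open MeasureTheory Filter Topology
open scoped ENNReal

noncomputable section

namespace SpaceAdiabatic

section AbstractOperators

variable {K : Type*} [NormedAddCommGroup K] [InnerProductSpace ℂ K]

/-- The domain of the unbounded operator `T`, as a type of its own that carries the graph norm
`‖ψ‖_T = ‖T ψ‖ + ‖ψ‖`. -/
def GraphDomain (T : K →ₗ.[ℂ] K) : Type _ := T.domain

instance (T : K →ₗ.[ℂ] K) : AddCommGroup (GraphDomain T) :=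
  inferInstanceAs (AddCommGroup T.domain)

instance (T : K →ₗ.[ℂ] K) : Module ℂ (GraphDomain T) :=
  inferInstanceAs (Module ℂ T.domain)

/-- The embedding `ψ ↦ (T ψ, ψ)` of the domain of `T` into the `ℓ¹`-sum of two copies of the
space, which induces the graph norm. -/
def graphEmbedding (T : K →ₗ.[ℂ] K) : GraphDomain T →ₗ[ℂ] WithLp 1 (K × K) :=
  (WithLp.linearEquiv 1 ℂ (K × K)).symm.toLinearMap ∘ₗ
    LinearMap.prod (T.toFun : T.domain →ₗ[ℂ] K) T.domain.subtype

theorem graphEmbedding_injective (T : K →ₗ.[ℂ] K) :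
    Function.Injective (graphEmbedding T) := by
  intro a b hab
  have h := congrArg (fun v : WithLp 1 (K × K) => v.snd) hab
  exact Subtype.ext h

instance (T : K →ₗ.[ℂ] K) : NormedAddCommGroup (GraphDomain T) :=
  NormedAddCommGroup.induced _ _ (graphEmbedding T) (graphEmbedding_injective T)

instance (T : K →ₗ.[ℂ] K) : NormedSpace ℂ (GraphDomain T) :=
  NormedSpace.induced ℂ (GraphDomain T) (WithLp 1 (K × K)) (graphEmbedding T)

theorem graphDomain_norm (T : K →ₗ.[ℂ] K) (ψ : T.domain) :
    ‖(show GraphDomain T from ψ)‖ = ‖T ψ‖ + ‖(ψ : K)‖ := by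
  change ‖graphEmbedding T ψ‖ = _
  rw [WithLp.prod_norm_eq_of_L1]
  rfl

/-- `R` is a bounded two-sided inverse of `T - z`: it maps into the domain of `T`,
`(T - z) R = 1`, and `R (T - z) = 1` on the domain of `T`. -/
def IsResolventAt (T : K →ₗ.[ℂ] K) (z : ℂ) (R : K →L[ℂ] K) : Prop :=
  (∀ ψ : K, ∃ hψ : R ψ ∈ T.domain, T ⟨R ψ, hψ⟩ - z • R ψ = ψ) ∧
    ∀ ψ : T.domain, R (T ψ - z • (ψ : K)) = (ψ : K)

theorem IsResolventAt.unique {T : K →ₗ.[ℂ] K} {z : ℂ} {R S : K →L[ℂ] K}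
    (hR : IsResolventAt T z R) (hS : IsResolventAt T z S) : R = S := by
  ext ψ
  obtain ⟨hψ, h⟩ := hS.1 ψ
  have := hR.2 ⟨S ψ, hψ⟩
  rwa [h] at this

open Classical in
/-- The resolvent `R_z(T) = (T - z)⁻¹` as a bounded operator (zero if `z` is in the spectrum). -/
def resolvent (T : K →ₗ.[ℂ] K) (z : ℂ) : K →L[ℂ] K :=
  if h : ∃ R, IsResolventAt T z R then h.choose else 0

/-- `U` is a strongly continuous one-parameter unitary group whose generator is exactly `-i T`,
that is, `U t = e^{-i T t}`: a vector `ψ` is in the domain of `T` with `T ψ = φ` if and only if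
`t ↦ U t ψ` is differentiable at `0` with derivative `-i φ`. -/
structure IsUnitaryGroup [CompleteSpace K] (T : K →ₗ.[ℂ] K) (U : ℝ → K →L[ℂ] K) : Prop where
  unitary : ∀ t, U t ∈ unitary (K →L[ℂ] K)
  zero : U 0 = 1
  add : ∀ s t, U (s + t) = U s * U t
  continuous : ∀ ψ, Continuous fun t => U t ψ
  generator : ∀ ψ φ : K, (ψ, φ) ∈ T.graph ↔
    HasDerivAt (fun t : ℝ => U t ψ) (-(Complex.I • φ)) 0

open Classical in
/-- The unitary group `t ↦ e^{-i T t}` of the self-adjoint operator `T`. -/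
def unitaryGroup [CompleteSpace K] (T : K →ₗ.[ℂ] K) : ℝ → K →L[ℂ] K :=
  if h : ∃ U, IsUnitaryGroup T U then h.choose else fun _ => 0

/-- The operator `Q T Q`, for bounded `Q`, on its natural domain `{ψ | Q ψ ∈ D(T)}`. -/
def sandwich (Q : K →L[ℂ] K) (T : K →ₗ.[ℂ] K) : K →ₗ.[ℂ] K where
  domain := T.domain.comap (Q : K →ₗ[ℂ] K)
  toFun := (Q : K →ₗ[ℂ] K) ∘ₗ T.toFun ∘ₗ
    ((Q : K →ₗ[ℂ] K).restrict (p := T.domain.comap (Q : K →ₗ[ℂ] K)) (q := T.domain)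
      fun _ hψ => hψ)

end AbstractOperators

section Fibered

/-- The base space `M = ℝⁿ`. -/
abbrev Base (n : ℕ) : Type := EuclideanSpace ℝ (Fin n)

/-- The `j`-th standard basis vector of `ℝⁿ`. -/
def basisVec {n : ℕ} (j : Fin n) : Base n := EuclideanSpace.single j 1

/-- The partial derivative `∂_{x_{a 0}} ⋯ ∂_{x_{a (k-1)}} f` of order `k` at the point `x`. -/
def partialDeriv {n k : ℕ} {V : Type*} [NormedAddCommGroup V] [NormedSpace ℝ V]
    (f : Base n → V) (a : Fin k → Fin n) (x : Base n) : V :=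
  iteratedFDeriv ℝ k f x fun i => basisVec (a i)

/-- The first-order partial derivative `∂_{x_j} f`. -/
def partialFst {n : ℕ} {V : Type*} [NormedAddCommGroup V] [NormedSpace ℝ V]
    (f : Base n → V) (j : Fin n) (x : Base n) : V :=
  fderiv ℝ f x (basisVec j)

/-- `f ∈ C_b^k(ℝⁿ, V)`: `f` is `k` times continuously differentiable and its partial derivatives
of all orders up to `k` are bounded. -/
def IsCb {n : ℕ} {V : Type*} [NormedAddCommGroup V] [NormedSpace ℝ V]
    (k : ℕ) (f : Base n → V) : Prop :=
  ContDiff ℝ k f ∧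
    ∀ j ≤ k, ∀ a : Fin j → Fin n, ∃ C : ℝ, ∀ x, ‖partialDeriv f a x‖ ≤ C

/-- `sup_{x, |α| = j} ‖∂^α f(x)‖`. -/
def supPartial {n : ℕ} {V : Type*} [NormedAddCommGroup V] [NormedSpace ℝ V]
    (j : ℕ) (f : Base n → V) : ℝ :=
  ⨆ p : (Fin j → Fin n) × Base n, ‖partialDeriv f p.1 p.2‖

variable {F : Type*} [NormedAddCommGroup F] [InnerProductSpace ℂ F]

/-- The Hilbert space `L²(ℝⁿ, dx; F)`. -/
abbrev L2 (n : ℕ) (F : Type*) [NormedAddCommGroup F] : Type _ :=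
  Lp F 2 (volume : Measure (Base n))

/-- Pairs `(ψ, φ)` in `L²(ℝⁿ; F)` with `ψ(x) ∈ D(T(x))` and `φ(x) = T(x) ψ(x)` for a.e. `x`. -/
def directIntegralGraph {n : ℕ} (T : Base n → F →ₗ.[ℂ] F) : Submodule ℂ (L2 n F × L2 n F) where
  carrier := {p | ∀ᵐ x, ((p.1 : Base n → F) x, (p.2 : Base n → F) x) ∈ (T x).graph}
  zero_mem' := by
    filter_upwards [Lp.coeFn_zero F 2 (volume : Measure (Base n))] with x hx
    simp only [Prod.fst_zero, Prod.snd_zero, hx]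
    exact (T x).graph.zero_mem
  add_mem' := by
    intro a b ha hb
    filter_upwards [ha, hb, Lp.coeFn_add a.1 b.1, Lp.coeFn_add a.2 b.2] with x h1 h2 h3 h4
    simp only [Prod.fst_add, Prod.snd_add, h3, h4]
    exact (T x).graph.add_mem h1 h2
  smul_mem' := by
    intro c a ha
    filter_upwards [ha, Lp.coeFn_smul c a.1, Lp.coeFn_smul c a.2] with x h1 h3 h4
    simp only [Prod.smul_fst, Prod.smul_snd, h3, h4]
    exact (T x).graph.smul_mem c h1

/-- The fibered operator `∫^⊕ dx T(x)` on `L²(ℝⁿ; F)`: its domain consists of the `ψ` with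
`ψ(x) ∈ D(T(x))` for a.e. `x` and `x ↦ T(x) ψ(x)` in `L²`. -/
def directIntegral {n : ℕ} (T : Base n → F →ₗ.[ℂ] F) : L2 n F →ₗ.[ℂ] L2 n F :=
  (directIntegralGraph T).toLinearPMap

theorem directIntegral_graph {n : ℕ} (T : Base n → F →ₗ.[ℂ] F) :
    (directIntegral T).graph = directIntegralGraph T := by
  apply Submodule.toLinearPMap_graph_eq
  rintro ⟨a, b⟩ h h0
  simp only at h0
  subst h0
  change ∀ᵐ x, _ at h
  rw [Lp.eq_zero_iff_ae_eq_zero]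
  filter_upwards [h, Lp.coeFn_zero F 2 (volume : Measure (Base n))] with x h1 h2
  simp only [h2] at h1
  exact (T x).graph_fst_eq_zero_snd h1 rfl

open Classical in
/-- The bounded fibered operator `(A ψ)(x) = A(x) ψ(x)` on `L²(ℝⁿ; F)`, for an essentially bounded
measurable family `A`. -/
def fibered {n : ℕ} (A : Base n → F →L[ℂ] F) : L2 n F →L[ℂ] L2 n F :=
  if h : MemLp A ∞ (volume : Measure (Base n)) then
    (ContinuousLinearMap.id ℂ (F →L[ℂ] F)).holderL volume ∞ 2 2 h.toLp
  else 0

theorem fibered_apply {n : ℕ} {A : Base n → F →L[ℂ] F}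
    (hA : MemLp A ∞ (volume : Measure (Base n))) (ψ : L2 n F) :
    ∀ᵐ x, (fibered A ψ : Base n → F) x = A x ((ψ : Base n → F) x) := by
  rw [fibered, dif_pos hA]
  filter_upwards [(ContinuousLinearMap.id ℂ (F →L[ℂ] F)).coeFn_holder (r := 2) hA.toLp ψ,
    hA.coeFn_toLp] with x h1 h2
  rw [ContinuousLinearMap.holderL_apply_apply, h1, h2]
  rfl

theorem IsCb.memLp {n k : ℕ} {A : Base n → F →L[ℂ] F} (hA : IsCb k A) :
    MemLp A ∞ (volume : Measure (Base n)) := by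
  obtain ⟨C, hC⟩ := hA.2 0 (Nat.zero_le _) Fin.elim0
  refine memLp_top_of_bound hA.1.continuous.aestronglyMeasurable C (.of_forall fun x => ?_)
  simpa [partialDeriv] using hC x

/-- The operator `H₀(x)` with domain `D`, as an unbounded operator. -/
def fiberOp {n : ℕ} (D : Submodule ℂ F) (H₀ : Base n → D →ₗ[ℂ] F) (x : Base n) : F →ₗ.[ℂ] F :=
  ⟨D, H₀ x⟩

/-- The operator `H₀ = ∫^⊕ dx H₀(x)`. -/
def totalH₀ {n : ℕ} (D : Submodule ℂ F) (H₀ : Base n → D →ₗ[ℂ] F) : L2 n F →ₗ.[ℂ] L2 n F :=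
  directIntegral (fiberOp D H₀)

/-- The operator `R_{E(x) - iδ}(H₀(x)) (∂_{x_j} P)(x) P(x)`. -/
def resolventDeriv {n : ℕ} (D : Submodule ℂ F) (H₀ : Base n → D →ₗ[ℂ] F)
    (P : Base n → F →L[ℂ] F) (E : Base n → ℝ) (δ : ℝ) (j : Fin n) (x : Base n) : F →L[ℂ] F :=
  resolvent (fiberOp D H₀ x) ((E x : ℂ) - Complex.I * (δ : ℂ)) * partialFst P j x * P x

variable [CompleteSpace F]

/-- The standing assumptions on the fibers `H₀(x)`, the projections `P(x)` and the eigenvalues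
`E(x)`. -/
structure FiberAssumption {n : ℕ} (m : ℕ) (D : Submodule ℂ F) (H₀ : Base n → D →ₗ[ℂ] F)
    (P : Base n → F →L[ℂ] F) (E : Base n → ℝ) : Prop where
  dense : Dense (D : Set F)
  selfAdjoint : ∀ x, IsSelfAdjoint (fiberOp D H₀ x)
  /-- All graph norms are equivalent to that of `H₀(x₀)`, uniformly in `x`, and `H₀(·)` is
  `C_b^m` with values in `L(D, F)`, where `D` carries the graph norm of `H₀(x₀)`. -/
  regular : ∃ x₀ : Base n,
    (∃ C₁ C₂ : ℝ, 0 < C₁ ∧ ∀ x, ∀ ψ : D,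
      C₁ * (‖H₀ x₀ ψ‖ + ‖(ψ : F)‖) ≤ ‖H₀ x ψ‖ + ‖(ψ : F)‖ ∧
      ‖H₀ x ψ‖ + ‖(ψ : F)‖ ≤ C₂ * (‖H₀ x₀ ψ‖ + ‖(ψ : F)‖)) ∧
    ∃ G : Base n → GraphDomain (fiberOp D H₀ x₀) →L[ℂ] F,
      (∀ x, ∀ ψ : D, G x (show GraphDomain (fiberOp D H₀ x₀) from ψ) = H₀ x ψ) ∧ IsCb m G
  proj : ∀ x, IsStarProjection (P x)
  proj_regular : IsCb (m + 1) P
  eigen : ∀ x, ∀ ψ : F, ∃ h : P x ψ ∈ D, H₀ x ⟨P x ψ, h⟩ = (E x : ℂ) • P x ψ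
  eigen_regular : IsCb m E

/-- `lim_{δ → 0} ess sup_x ‖δ R_{E(x) - iδ}(H₀(x)) (∂_{x_j} P)(x) P(x)‖ = 0` for all `j`. -/
def ConditionI {n : ℕ} (D : Submodule ℂ F) (H₀ : Base n → D →ₗ[ℂ] F)
    (P : Base n → F →L[ℂ] F) (E : Base n → ℝ) : Prop :=
  ∀ j : Fin n, Tendsto
    (fun δ : ℝ => essSup (fun x => ‖(δ : ℂ) • resolventDeriv D H₀ P E δ j x‖ₑ) volume)
    (𝓝[>] 0) (𝓝 0)

/-- A constant `δ₀ > 0` and a function `η : [0, δ₀] → [0, δ₀]` with `η(δ) ≥ δ`. -/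
structure IsRate (δ₀ : ℝ) (η : ℝ → ℝ) : Prop where
  pos : 0 < δ₀
  mapsTo : Set.MapsTo η (Set.Icc 0 δ₀) (Set.Icc 0 δ₀)
  le : ∀ δ ∈ Set.Icc 0 δ₀, δ ≤ η δ

/-- `ess sup_x ‖R_{E(x) - iδ}(H₀(x)) (∂_{x_j} P)(x) P(x)‖ ≤ C δ⁻¹ η(δ)`. -/
def ConditionII {n : ℕ} (D : Submodule ℂ F) (H₀ : Base n → D →ₗ[ℂ] F)
    (P : Base n → F →L[ℂ] F) (E : Base n → ℝ) (δ₀ : ℝ) (η : ℝ → ℝ) : Prop :=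
  ∃ C : ℝ, ∀ δ ∈ Set.Ioc 0 δ₀, ∀ j : Fin n,
    essSup (fun x => ‖resolventDeriv D H₀ P E δ j x‖ₑ) volume ≤ ENNReal.ofReal (C * δ⁻¹ * η δ)

/-- The bound of `ConditionII` together with
`ess sup_x ‖∂_{x_k} (R_{E(x) - iδ}(H₀(x)) (∂_{x_j} P)(x) P(x))‖ ≤ C δ⁻¹ η(δ)`. -/
def ConditionIII {n : ℕ} (D : Submodule ℂ F) (H₀ : Base n → D →ₗ[ℂ] F)
    (P : Base n → F →L[ℂ] F) (E : Base n → ℝ) (δ₀ : ℝ) (η : ℝ → ℝ) : Prop :=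
  ConditionII D H₀ P E δ₀ η ∧
  ∃ C : ℝ, ∀ δ ∈ Set.Ioc 0 δ₀, ∀ k j : Fin n,
    essSup (fun x => ‖partialFst (resolventDeriv D H₀ P E δ j) k x‖ₑ) volume
      ≤ ENNReal.ofReal (C * δ⁻¹ * η δ)

/-- The assumptions on the perturbation `h^ε`, `ε ∈ (0, 1]`. The norm of an operator with `n`
components is taken with the Euclidean norm on `ℂⁿ`. Boundedness of a commutator with an unbounded
operator means that the bounded operator preserves the domain and that the commutator, defined
on this domain, is bounded. -/
structure PerturbationAssumption {n : ℕ} (m : ℕ) (D : Submodule ℂ F) (H₀ : Base n → D →ₗ[ℂ] F)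
    (h : ℝ → L2 n F →ₗ.[ℂ] L2 n F) : Prop where
  selfAdjoint : ∀ ε ∈ Set.Ioc (0 : ℝ) 1, IsSelfAdjoint (h ε)
  domain_eq : ∃ Dh : Submodule ℂ (L2 n F), ∀ ε ∈ Set.Ioc (0 : ℝ) 1, (h ε).domain = Dh
  essSelfAdjoint : ∀ ε ∈ Set.Ioc (0 : ℝ) 1, IsSelfAdjoint (totalH₀ D H₀ + h ε).closure
  deriv : ∃ Dh : ℝ → Fin n → L2 n F →L[ℂ] L2 n F,
    (∀ ε ∈ Set.Ioc (0 : ℝ) 1, ∀ j, IsSelfAdjoint (Dh ε j)) ∧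
    (∃ C : ℝ, ∀ ε ∈ Set.Ioc (0 : ℝ) 1, ∀ ψ, √(∑ j, ‖Dh ε j ψ‖ ^ 2) ≤ C * ‖ψ‖) ∧
    (∃ C : ℝ, ∀ A : Base n → F →L[ℂ] F, IsCb m A → ∀ ε ∈ Set.Ioc (0 : ℝ) 1,
      ∀ ψ : (h ε).domain, ∃ hA : fibered A ψ ∈ (h ε).domain,
        ‖h ε ⟨fibered A ψ, hA⟩ - fibered A (h ε ψ)
            + (Complex.I * (ε : ℂ)) • ∑ j, fibered (partialFst A j) (Dh ε j ψ)‖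
          ≤ C * (∑ j ∈ Finset.Icc 2 m, ε ^ j * supPartial j A) * ‖ψ‖) ∧
    (∃ C : ℝ, ∀ ε ∈ Set.Ioc (0 : ℝ) 1, ∀ ψ : (totalH₀ D H₀).domain,
      ∃ hD : ∀ j, Dh ε j ψ ∈ (totalH₀ D H₀).domain,
        √(∑ j, ‖Dh ε j (totalH₀ D H₀ ψ) - totalH₀ D H₀ ⟨Dh ε j ψ, hD j⟩‖ ^ 2)
          ≤ ε * C * (‖totalH₀ D H₀ ψ‖ + ‖(ψ : L2 n F)‖)) ∧
    (∃ C : ℝ, ∀ ε ∈ Set.Ioc (0 : ℝ) 1, ∀ ψ : (h ε).domain,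
      ∃ hD : ∀ j, Dh ε j ψ ∈ (h ε).domain,
        √(∑ j, ‖Dh ε j (h ε ψ) - h ε ⟨Dh ε j ψ, hD j⟩‖ ^ 2) ≤ ε * C * ‖(ψ : L2 n F)‖)

/-- The full Hamiltonian `H^ε`: the closure of `H₀ + h^ε` on `D(h) ∩ D(H₀)`. -/
def fullH {n : ℕ} (D : Submodule ℂ F) (H₀ : Base n → D →ₗ[ℂ] F)
    (h : ℝ → L2 n F →ₗ.[ℂ] L2 n F) (ε : ℝ) : L2 n F →ₗ.[ℂ] L2 n F :=
  (totalH₀ D H₀ + h ε).closure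

/-- The block-diagonal Hamiltonian: the closure of `H₀ + P h^ε P + P^⊥ h^ε P^⊥` on its natural
domain. -/
def diagH {n : ℕ} (D : Submodule ℂ F) (H₀ : Base n → D →ₗ[ℂ] F)
    (P : Base n → F →L[ℂ] F) (h : ℝ → L2 n F →ₗ.[ℂ] L2 n F) (ε : ℝ) : L2 n F →ₗ.[ℂ] L2 n F :=
  (totalH₀ D H₀ + sandwich (fibered P) (h ε) + sandwich (1 - fibered P) (h ε)).closure

/-- The propagator `U^ε(t) = e^{-i H^ε t / ε}`. -/
def fullU {n : ℕ} (D : Submodule ℂ F) (H₀ : Base n → D →ₗ[ℂ] F)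
    (h : ℝ → L2 n F →ₗ.[ℂ] L2 n F) (ε t : ℝ) : L2 n F →L[ℂ] L2 n F :=
  unitaryGroup (fullH D H₀ h ε) (t / ε)

/-- The propagator `U^ε_diag(t) = e^{-i H^ε_diag t / ε}`. -/
def diagU {n : ℕ} (D : Submodule ℂ F) (H₀ : Base n → D →ₗ[ℂ] F)
    (P : Base n → F →L[ℂ] F) (h : ℝ → L2 n F →ₗ.[ℂ] L2 n F) (ε t : ℝ) : L2 n F →L[ℂ] L2 n F :=
  unitaryGroup (diagH D H₀ P h ε) (t / ε)

end Fibered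

end SpaceAdiabatic

end

/-!
The argument compares `H = H₀ + h` with its block-diagonal part `H - V`, where
`V = P⊥ h P + P h P⊥` is the off-diagonal part of `h` with respect to `P = P_*`. Since `[h, P]` is
`-i ε ∇P · Dh` up to `O(ε²)`, the operator `V` is bounded, of order `ε`, and `V = A + A*` with
`A = -i ε ∑ ∂_j P P Dh_j P + O(ε²)` (`exists_offDiagonal_family`); this uses that `∂_j P` is
off-diagonal, `P⊥ ∂_j P = ∂_j P P`. Hence `H_diag` is a bounded symmetric perturbation of `H`,
which gives its self-adjointness and its domain. On the time scale `t / ε` a perturbation of order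
`ε` is not negligible by itself; it is so because it oscillates.

The family `G = R_{E - iδ}(H₀) ∂_j P P` solves the commutator equation `[H₀, G] = ∂_j P P - i δ G`,
because `H₀ P = E P`. With `K = ∑ G_j Dh_j P`, the operator `A` is therefore `-i ε [H, K]` up to
an error of order `ε (δ ‖G‖ + ε (1 + ‖G‖ + ‖∂G‖))` (`exists_commutator_approx`). The projection on
the right of `K` turns `[Dh, H₀]`, which is bounded only relative to `H₀`, into a bounded operator,
and `[h, G]` is controlled by the hypothesis on `h`. In Duhamel's formula a commutator
`ε [H, K + K*]` integrates to boundary terms of size `ε ‖K‖` (`norm_unitaryGroup_sub_le`); all of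
this is done for sesquilinear forms on a core, so that no statement on the domains of `G` and `K` in
the closure of `H` is needed. The outcome is `exists_adiabatic_estimate`:
`‖U(t) - U_diag(t)‖ ≤ C (δ ‖G‖ + ε (1 + ‖∂G‖)) (1 + |t|)` for `ε ≤ δ ≤ 1`.

The hypothesis on `h` involves derivatives of `G` up to order `m`. Differentiating
`(H₀ - E + i δ) G = ∂_j P P` in the norm of the common domain shows that the first derivative costs
at most a factor `δ⁻¹` with respect to `G`, and each further one at most a factor `δ⁻¹` with respect
to the first (`exists_solution_deriv_bounds`); the `j`-th one comes with `ε^j`, and `ε ≤ δ`. Under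
the conditions on `G` alone the choice is `δ = √ε`, under the condition on `∂G` it is
`δ = ε`.

The existence of the unitary groups, Stone's theorem, is proved along the way
(`exists_isUnitaryGroup`), by approximation with bounded functions of the resolvent.
-/

namespace SpaceAdiabatic

open scoped InnerProductSpace

/-! ### Graphs and resolvents of self-adjoint operators -/

section SelfAdjoint

variable {K : Type*} [NormedAddCommGroup K] [InnerProductSpace ℂ K] [CompleteSpace K]
  {T : K →ₗ.[ℂ] K}

theorem isSelfAdjoint_iff_graph (hd : Dense (T.domain : Set K)) :
    IsSelfAdjoint T ↔ ∀ ψ φ : K, (ψ, φ) ∈ T.graph ↔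
      ∀ χ ω, (χ, ω) ∈ T.graph → ⟪ω, ψ⟫_ℂ = ⟪χ, φ⟫_ℂ := by
  rw [LinearPMap.isSelfAdjoint_def]
  constructor
  · intro h ψ φ
    conv_lhs => rw [← h, LinearPMap.adjoint_graph_eq_graph_adjoint hd, Submodule.mem_adjoint_iff]
    simp only [sub_eq_zero]
  · intro h
    apply LinearPMap.eq_of_eq_graph
    ext ⟨ψ, φ⟩
    rw [LinearPMap.adjoint_graph_eq_graph_adjoint hd, Submodule.mem_adjoint_iff, h ψ φ]
    simp only [sub_eq_zero]

theorem inner_graph (hT : IsSelfAdjoint T) {ψ φ χ ω : K} (h₁ : (ψ, φ) ∈ T.graph)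
    (h₂ : (χ, ω) ∈ T.graph) : ⟪ω, ψ⟫_ℂ = ⟪χ, φ⟫_ℂ :=
  ((isSelfAdjoint_iff_graph hT.dense_domain).1 hT ψ φ).1 h₁ χ ω h₂

theorem mem_graph_of_inner (hT : IsSelfAdjoint T) {ψ φ : K}
    (h : ∀ χ ω, (χ, ω) ∈ T.graph → ⟪ω, ψ⟫_ℂ = ⟪χ, φ⟫_ℂ) : (ψ, φ) ∈ T.graph :=
  ((isSelfAdjoint_iff_graph hT.dense_domain).1 hT ψ φ).2 h

/-- The basic lower bound for `T - z`: since `T` is symmetric, the imaginary part of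
`⟪ψ, (T - z) ψ⟫` is `-Im z ‖ψ‖²`. -/
theorem abs_im_mul_norm_le (hT : IsSelfAdjoint T) (z : ℂ) {ψ φ : K} (h : (ψ, φ) ∈ T.graph) :
    |z.im| * ‖ψ‖ ≤ ‖φ - z • ψ‖ := by
  have hreal : (⟪ψ, φ⟫_ℂ).im = 0 := by
    have h1 := inner_graph hT h h
    have h2 := inner_conj_symm (𝕜 := ℂ) φ ψ
    rw [h1] at h2
    exact Complex.conj_eq_iff_im.1 h2
  have him : (⟪ψ, φ - z • ψ⟫_ℂ).im = -(z.im * ‖ψ‖ ^ 2) := by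
    rw [inner_sub_right, inner_smul_right, inner_self_eq_norm_sq_to_K, Complex.sub_im, hreal]
    have : ((‖ψ‖ : ℂ) ^ 2) = ((‖ψ‖ ^ 2 : ℝ) : ℂ) := by push_cast; rfl
    simp only [Complex.coe_algebraMap, this, Complex.mul_im, Complex.ofReal_re, Complex.ofReal_im]
    ring
  have hle : |z.im| * ‖ψ‖ ^ 2 ≤ ‖ψ‖ * ‖φ - z • ψ‖ := by
    calc |z.im| * ‖ψ‖ ^ 2 = |(⟪ψ, φ - z • ψ⟫_ℂ).im| := by
          rw [him, abs_neg, abs_mul, abs_of_nonneg (sq_nonneg ‖ψ‖)]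
      _ ≤ ‖⟪ψ, φ - z • ψ⟫_ℂ‖ := Complex.abs_im_le_norm _
      _ ≤ _ := norm_inner_le_norm _ _
  rcases (norm_nonneg ψ).eq_or_lt with h0 | h0
  · rw [← h0, mul_zero]; exact norm_nonneg _
  · refine le_of_mul_le_mul_left ?_ h0
    linarith [hle, sq ‖ψ‖, show ‖ψ‖ * (|z.im| * ‖ψ‖) = |z.im| * ‖ψ‖ ^ 2 by ring]

/-- Non-real numbers belong to the resolvent set of a self-adjoint operator: the range of `T - z`
is closed by the lower bound, and its orthogonal complement is the kernel of `T - conj z`. -/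
theorem exists_isResolventAt (hT : IsSelfAdjoint T) {z : ℂ} (hz : z.im ≠ 0) :
    ∃ R, IsResolventAt T z R := by
  have : CompleteSpace T.graph :=
    (show IsClosed (T.graph : Set (K × K)) from hT.isClosed).completeSpace_coe
  let L : T.graph →L[ℂ] K :=
    (ContinuousLinearMap.snd ℂ K K - z • ContinuousLinearMap.fst ℂ K K).comp T.graph.subtypeL
  have hL : ∀ p : T.graph, L p = p.1.2 - z • p.1.1 := fun p => rfl
  have hz' : 0 < |z.im| := abs_pos.2 hz
  have hbound : ∀ p : T.graph, ‖p‖ ≤ (1 + |z.im|⁻¹ * (1 + ‖z‖)) * ‖L p‖ := by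
    rintro ⟨⟨ψ, φ⟩, hp⟩
    have h1 : ‖ψ‖ ≤ |z.im|⁻¹ * ‖φ - z • ψ‖ := by
      rw [le_inv_mul_iff₀ hz']
      exact abs_im_mul_norm_le hT z hp
    have h2 : ‖φ‖ ≤ ‖φ - z • ψ‖ + ‖z‖ * ‖ψ‖ := by
      calc ‖φ‖ = ‖(φ - z • ψ) + z • ψ‖ := by rw [sub_add_cancel]
        _ ≤ _ := (norm_add_le _ _).trans (by rw [norm_smul])
    change max ‖ψ‖ ‖φ‖ ≤ (1 + |z.im|⁻¹ * (1 + ‖z‖)) * ‖φ - z • ψ‖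
    have h3 := mul_le_mul_of_nonneg_left h1 (norm_nonneg z)
    have h4 : 0 ≤ |z.im|⁻¹ * ‖φ - z • ψ‖ := (norm_nonneg _).trans h1
    have h5 := mul_nonneg (norm_nonneg z) h4
    have h6 := norm_nonneg (φ - z • ψ)
    apply max_le <;> nlinarith
  have hanti : AntilipschitzWith (1 + |z.im|⁻¹ * (1 + ‖z‖)).toNNReal L := by
    refine L.antilipschitz_of_bound fun p => ?_
    rw [Real.coe_toNNReal _ (by positivity)]
    exact hbound p
  have hclosed : IsClosed (Set.range L) := hanti.isClosed_range L.uniformContinuous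
  have hsurj : LinearMap.range (L : T.graph →ₗ[ℂ] K) = ⊤ := by
    have : CompleteSpace (LinearMap.range (L : T.graph →ₗ[ℂ] K)) :=
      (show IsClosed ((LinearMap.range (L : T.graph →ₗ[ℂ] K) : Submodule ℂ K) : Set K) by
        rwa [LinearMap.coe_range]).completeSpace_coe
    rw [← Submodule.orthogonal_eq_bot_iff, Submodule.eq_bot_iff]
    intro χ hχ
    have hmem : (χ, (starRingEnd ℂ) z • χ) ∈ T.graph := by
      refine mem_graph_of_inner hT fun ψ φ hp => ?_
      have := (Submodule.mem_orthogonal _ _).1 hχ (L ⟨(ψ, φ), hp⟩) ⟨_, rfl⟩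
      rw [hL, inner_sub_left, inner_smul_left, sub_eq_zero] at this
      rw [this, inner_smul_right]
    have := abs_im_mul_norm_le hT ((starRingEnd ℂ) z) hmem
    rw [sub_self, norm_zero, Complex.conj_im, abs_neg] at this
    exact norm_le_zero_iff.1 (nonpos_of_mul_nonpos_right this hz')
  let e := ContinuousLinearEquiv.ofBijective L (LinearMap.ker_eq_bot.2 hanti.injective) hsurj
  have he : ∀ p, e p = L p := fun p => rfl
  refine ⟨(ContinuousLinearMap.fst ℂ K K).comp (T.graph.subtypeL.comp
    (e.symm : K →L[ℂ] T.graph)), fun ψ => ?_, fun ψ => ?_⟩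
  · have hmem : ((e.symm ψ : T.graph).1.1, (e.symm ψ : T.graph).1.2) ∈ T.graph := (e.symm ψ).2
    have h1 : e (e.symm ψ) = ψ := e.apply_symm_apply ψ
    obtain ⟨y, hy1, hy2⟩ := (LinearPMap.mem_graph_iff T).1 hmem
    have hd : (e.symm ψ : T.graph).1.1 ∈ T.domain := LinearPMap.mem_domain_of_mem_graph hmem
    refine ⟨hd, ?_⟩
    have h2 := LinearPMap.mem_graph_snd_inj T hmem (T.mem_graph ⟨_, hd⟩) rfl
    rw [he, hL, h2] at h1
    exact h1
  · have h1 : e.symm (e ⟨_, T.mem_graph ψ⟩) = ⟨_, T.mem_graph ψ⟩ := e.symm_apply_apply _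
    change (e.symm (T ψ - z • (ψ : K)) : T.graph).1.1 = ψ
    have h2 : T ψ - z • (ψ : K) = e ⟨_, T.mem_graph ψ⟩ := rfl
    rw [h2, h1]

theorem isResolventAt_resolvent (hT : IsSelfAdjoint T) {z : ℂ} (hz : z.im ≠ 0) :
    IsResolventAt T z (resolvent T z) := by
  have h := exists_isResolventAt hT hz
  rw [resolvent, dif_pos h]
  exact h.choose_spec

theorem resolvent_mem_graph (hT : IsSelfAdjoint T) {z : ℂ} (hz : z.im ≠ 0) (ψ : K) :
    (resolvent T z ψ, ψ + z • resolvent T z ψ) ∈ T.graph := by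
  obtain ⟨hd, h⟩ := (isResolventAt_resolvent hT hz).1 ψ
  have := T.mem_graph ⟨_, hd⟩
  have h' : T ⟨_, hd⟩ = ψ + z • resolvent T z ψ := by rw [← sub_eq_iff_eq_add, h]
  rwa [h'] at this

theorem resolvent_sub_smul (hT : IsSelfAdjoint T) {z : ℂ} (hz : z.im ≠ 0) {ψ φ : K}
    (h : (ψ, φ) ∈ T.graph) : resolvent T z (φ - z • ψ) = ψ := by
  obtain ⟨y, rfl, rfl⟩ := (LinearPMap.mem_graph_iff T).1 h
  exact (isResolventAt_resolvent hT hz).2 y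

theorem norm_resolvent_apply_le (hT : IsSelfAdjoint T) {z : ℂ} (hz : z.im ≠ 0) (ψ : K) :
    ‖resolvent T z ψ‖ ≤ |z.im|⁻¹ * ‖ψ‖ := by
  rw [le_inv_mul_iff₀ (abs_pos.2 hz)]
  simpa using abs_im_mul_norm_le hT z (resolvent_mem_graph hT hz ψ)

theorem resolvent_sub_resolvent (hT : IsSelfAdjoint T) {z w : ℂ} (hz : z.im ≠ 0)
    (hw : w.im ≠ 0) :
    resolvent T w - resolvent T z = (w - z) • (resolvent T z * resolvent T w) := by
  ext ψ
  have h := resolvent_sub_smul hT hz (resolvent_mem_graph hT hw ψ)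
  rw [add_sub_assoc, ← sub_smul, map_add, map_smul] at h
  change resolvent T w ψ - resolvent T z ψ = (w - z) • resolvent T z (resolvent T w ψ)
  rw [sub_eq_iff_eq_add', h]

theorem commute_resolvent (hT : IsSelfAdjoint T) {z w : ℂ} (hz : z.im ≠ 0) (hw : w.im ≠ 0) :
    Commute (resolvent T z) (resolvent T w) := by
  rcases eq_or_ne z w with rfl | hne
  · exact Commute.refl _
  · have h1 := resolvent_sub_resolvent hT hz hw
    have h2 := resolvent_sub_resolvent hT hw hz
    have h3 : (w - z) • (resolvent T z * resolvent T w)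
        = (w - z) • (resolvent T w * resolvent T z) := by
      rw [← h1, ← neg_sub z w, neg_smul, ← h2, neg_sub]
    exact smul_right_injective _ (sub_ne_zero.2 hne.symm) h3

theorem inner_resolvent_left (hT : IsSelfAdjoint T) {z : ℂ} (hz : z.im ≠ 0) (ψ φ : K) :
    ⟪resolvent T z ψ, φ⟫_ℂ = ⟪ψ, resolvent T ((starRingEnd ℂ) z) φ⟫_ℂ := by
  have hz' : ((starRingEnd ℂ) z).im ≠ 0 := by simpa using hz
  have h := inner_graph hT (resolvent_mem_graph hT hz' φ) (resolvent_mem_graph hT hz ψ)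
  rw [inner_add_left, inner_add_right, inner_smul_left, inner_smul_right] at h
  exact (add_right_cancel h).symm

end SelfAdjoint

/-! ### Unitary groups with bounded generators -/

theorem norm_sub_le_of_hasDerivAt {V : Type*} [NormedAddCommGroup V] [NormedSpace ℝ V]
    {f f' : ℝ → V} (hf : ∀ s, HasDerivAt f (f' s) s) {t C : ℝ}
    (hC : ∀ s, |s| ≤ |t| → ‖f' s‖ ≤ C) : ‖f t - f 0‖ ≤ C * |t| := by
  have h := (convex_Icc (-|t|) |t|).norm_image_sub_le_of_norm_hasDerivWithin_le
    (f := f) (f' := f') (C := C) (x := 0) (y := t)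
    (fun x _ => (hf x).hasDerivWithinAt) (fun x hx => hC x (abs_le.2 hx))
    (Set.mem_Icc.2 ⟨by simp, abs_nonneg t⟩) (Set.mem_Icc.2 (abs_le.1 le_rfl))
  simpa using h

section BoundedGenerator

variable {K : Type*} [NormedAddCommGroup K] [InnerProductSpace ℂ K] [CompleteSpace K]
  {b : K →L[ℂ] K}

theorem exp_smul_mem_unitary (hb : b ∈ skewAdjoint (K →L[ℂ] K)) (t : ℝ) :
    NormedSpace.exp (t • b) ∈ unitary (K →L[ℂ] K) := by
  let _ : NormedAlgebra ℚ (K →L[ℂ] K) := .restrictScalars ℚ ℂ _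
  refine NormedSpace.exp_mem_unitary_of_mem_skewAdjoint ?_
  rw [skewAdjoint.mem_iff] at hb ⊢
  rw [star_smul, hb, star_trivial, smul_neg]

theorem norm_exp_smul_apply (hb : b ∈ skewAdjoint (K →L[ℂ] K)) (t : ℝ) (ψ : K) :
    ‖NormedSpace.exp (t • b) ψ‖ = ‖ψ‖ :=
  ContinuousLinearMap.norm_map_of_mem_unitary (exp_smul_mem_unitary hb t) ψ

theorem hasDerivAt_exp_smul_apply (b : K →L[ℂ] K) (ψ : K) (t : ℝ) :
    HasDerivAt (fun s : ℝ => NormedSpace.exp (s • b) ψ) (NormedSpace.exp (t • b) (b ψ)) t := by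
  have h := hasDerivAt_exp_smul_const (𝕂 := ℝ) b t
  have h2 := (((ContinuousLinearMap.apply ℂ K ψ).restrictScalars ℝ).hasFDerivAt
    (x := NormedSpace.exp (t • b))).comp_hasDerivAt t h
  exact h2

theorem norm_exp_smul_sub_le (hb : b ∈ skewAdjoint (K →L[ℂ] K)) (t : ℝ) (ψ : K) :
    ‖NormedSpace.exp (t • b) ψ - ψ‖ ≤ ‖b ψ‖ * |t| := by
  simpa using norm_sub_le_of_hasDerivAt (hasDerivAt_exp_smul_apply b ψ) (t := t)
    (fun s _ => (norm_exp_smul_apply hb s (b ψ)).le)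

/-- A first-order Taylor estimate in which the regularity of `b ψ` enters only through its
distance from some vector `χ` with small `b χ`; it survives a strong limit of generators. -/
theorem norm_exp_smul_sub_sub_le (hb : b ∈ skewAdjoint (K →L[ℂ] K)) (t : ℝ) (ψ χ : K) :
    ‖NormedSpace.exp (t • b) ψ - ψ - t • b ψ‖ ≤ (2 * ‖b ψ - χ‖ + ‖b χ‖ * |t|) * |t| := by
  have hd : ∀ s : ℝ, HasDerivAt (fun s : ℝ => NormedSpace.exp (s • b) ψ - s • b ψ)
      (NormedSpace.exp (s • b) (b ψ) - b ψ) s := fun s => by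
    have h := (hasDerivAt_exp_smul_apply b ψ s).sub ((hasDerivAt_id s).smul_const (b ψ))
    rw [one_smul] at h
    exact h
  have h := norm_sub_le_of_hasDerivAt hd (t := t) (C := 2 * ‖b ψ - χ‖ + ‖b χ‖ * |t|) fun s hs => by
    have e : NormedSpace.exp (s • b) (b ψ) - b ψ
        = NormedSpace.exp (s • b) (b ψ - χ) - (b ψ - χ) + (NormedSpace.exp (s • b) χ - χ) := by
      rw [map_sub]; abel
    rw [e]
    refine (norm_add_le _ _).trans (add_le_add ?_ ?_)
    · refine (norm_sub_le _ _).trans ?_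
      rw [norm_exp_smul_apply hb, two_mul]
    · exact (norm_exp_smul_sub_le hb s χ).trans (by gcongr)
  have e : NormedSpace.exp (t • b) ψ - ψ - t • b ψ
      = NormedSpace.exp (t • b) ψ - t • b ψ
        - (NormedSpace.exp ((0 : ℝ) • b) ψ - (0 : ℝ) • b ψ) := by
    simp; abel
  rw [e]
  exact h

theorem norm_exp_smul_sub_exp_smul_le {a b : K →L[ℂ] K} (ha : a ∈ skewAdjoint (K →L[ℂ] K))
    (hb : b ∈ skewAdjoint (K →L[ℂ] K)) (hab : Commute a b) (t : ℝ) (ψ : K) :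
    ‖NormedSpace.exp (t • a) ψ - NormedSpace.exp (t • b) ψ‖ ≤ ‖a ψ - b ψ‖ * |t| := by
  let _ : NormedAlgebra ℚ (K →L[ℂ] K) := .restrictScalars ℚ ℂ _
  have hc : Commute (t • b) (t • (a - b)) :=
    ((hab.symm.sub_right (Commute.refl b)).smul_left t).smul_right t
  have e : NormedSpace.exp (t • a) = NormedSpace.exp (t • b) * NormedSpace.exp (t • (a - b)) := by
    rw [← NormedSpace.exp_add_of_commute hc, ← smul_add, add_sub_cancel]
  have e2 : NormedSpace.exp (t • a) ψ - NormedSpace.exp (t • b) ψ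
      = NormedSpace.exp (t • b) (NormedSpace.exp (t • (a - b)) ψ - ψ) := by
    rw [e, map_sub]; rfl
  rw [e2, norm_exp_smul_apply hb]
  exact norm_exp_smul_sub_le (sub_mem ha hb) t ψ

end BoundedGenerator

/-! ### Stone's theorem -/

section Stone

variable {K : Type*} [NormedAddCommGroup K] [InnerProductSpace ℂ K] [CompleteSpace K]
  {T : K →ₗ.[ℂ] K}

/-- The unitary group of a self-adjoint operator is the strong limit of the groups generated by
commuting bounded skew-adjoint operators that converge to `-i T` on the domain of `T`. -/
theorem exists_isUnitaryGroup_of_tendsto (hT : IsSelfAdjoint T) (b : ℕ → K →L[ℂ] K)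
    (hb : ∀ k, b k ∈ skewAdjoint (K →L[ℂ] K)) (hcomm : ∀ k l, Commute (b k) (b l))
    (hlim : ∀ ψ φ, (ψ, φ) ∈ T.graph → Tendsto (fun k => b k ψ) atTop (𝓝 (-(Complex.I • φ)))) :
    ∃ U, IsUnitaryGroup T U := by
  have hdense : ∀ (ψ : K) (τ : ℝ), 0 < τ → ∃ χ ω, (χ, ω) ∈ T.graph ∧ ‖ψ - χ‖ < τ := by
    intro ψ τ hτ
    obtain ⟨χ, hχ, hd⟩ := Metric.mem_closure_iff.1 (hT.dense_domain ψ) τ hτ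
    exact ⟨χ, _, T.mem_graph ⟨χ, hχ⟩, by rwa [← dist_eq_norm]⟩
  -- The exponentials are isometries, so it is enough to compare them on the dense domain of `T`.
  have hcauchy : ∀ (t : ℝ) (ψ : K), CauchySeq fun k => NormedSpace.exp (t • b k) ψ := by
    intro t ψ
    rw [Metric.cauchySeq_iff]
    intro τ hτ
    obtain ⟨χ, ω, hχ, hψχ⟩ := hdense ψ (τ / 4) (by positivity)
    have hc := (hlim χ ω hχ).cauchySeq
    rw [Metric.cauchySeq_iff] at hc
    obtain ⟨N, hN⟩ := hc (τ / (4 * (|t| + 1))) (by positivity)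
    refine ⟨N, fun k hk l hl => ?_⟩
    have h1 := norm_exp_smul_sub_exp_smul_le (hb k) (hb l) (hcomm k l) t χ
    have h2 := hN k hk l hl
    rw [dist_eq_norm, lt_div_iff₀ (by positivity)] at h2
    have e : NormedSpace.exp (t • b k) ψ - NormedSpace.exp (t • b l) ψ
        = NormedSpace.exp (t • b k) (ψ - χ) - NormedSpace.exp (t • b l) (ψ - χ)
          + (NormedSpace.exp (t • b k) χ - NormedSpace.exp (t • b l) χ) := by
      rw [map_sub, map_sub]; abel
    rw [dist_eq_norm, e]
    have h3 := norm_add_le (NormedSpace.exp (t • b k) (ψ - χ) - NormedSpace.exp (t • b l) (ψ - χ))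
      (NormedSpace.exp (t • b k) χ - NormedSpace.exp (t • b l) χ)
    have h4 := norm_sub_le (NormedSpace.exp (t • b k) (ψ - χ)) (NormedSpace.exp (t • b l) (ψ - χ))
    rw [norm_exp_smul_apply (hb k), norm_exp_smul_apply (hb l)] at h4
    nlinarith [norm_nonneg (b k χ - b l χ)]
  let _ : NormedAlgebra ℚ (K →L[ℂ] K) := .restrictScalars ℚ ℂ _
  choose u hu using fun t ψ => cauchySeq_tendsto_of_complete (hcauchy t ψ)
  let U : ℝ → K →L[ℂ] K := fun t =>
    continuousLinearMapOfTendsto (fun k => NormedSpace.exp (t • b k)) (f := u t)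
      (tendsto_pi_nhds.2 (hu t))
  have hU : ∀ t ψ, Tendsto (fun k => NormedSpace.exp (t • b k) ψ) atTop (𝓝 (U t ψ)) := hu
  have hnorm : ∀ t ψ, ‖U t ψ‖ = ‖ψ‖ := fun t ψ => by
    refine tendsto_nhds_unique (hU t ψ).norm ?_
    simp only [norm_exp_smul_apply (hb _)]
    exact tendsto_const_nhds
  have hzero : U 0 = 1 := by
    ext ψ
    refine tendsto_nhds_unique (hU 0 ψ) ?_
    simp
  have hadd : ∀ s t, U (s + t) = U s * U t := by
    intro s t
    ext ψ
    refine tendsto_nhds_unique (hU (s + t) ψ) ?_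
    have h1 : Tendsto (fun k => NormedSpace.exp (s • b k)
        (NormedSpace.exp (t • b k) ψ - U t ψ)) atTop (𝓝 0) := by
      rw [tendsto_zero_iff_norm_tendsto_zero]
      simp only [norm_exp_smul_apply (hb _)]
      rw [← tendsto_zero_iff_norm_tendsto_zero]
      simpa using (hU t ψ).sub_const (U t ψ)
    have h2 := h1.add (hU s (U t ψ))
    rw [zero_add] at h2
    refine h2.congr fun k => ?_
    have hc : Commute (s • b k) (t • b k) := ((Commute.refl (b k)).smul_left s).smul_right t
    rw [add_smul, NormedSpace.exp_add_of_commute hc, map_sub, sub_add_cancel]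
    rfl
  have hinv : ∀ t, U t * U (-t) = 1 := fun t => by rw [← hadd, add_neg_cancel, hzero]
  have hunit : ∀ t, U t ∈ unitary (K →L[ℂ] K) := fun t => by
    have h1 : star (U t) * U t = 1 :=
      (ContinuousLinearMap.norm_map_iff_adjoint_comp_self (U t)).1 (hnorm t)
    have h2 : star (U t) = U (-t) := by
      calc star (U t) = star (U t) * (U t * U (-t)) := by rw [hinv, mul_one]
        _ = U (-t) := by rw [← mul_assoc, h1, one_mul]
    exact Unitary.mem_iff.2 ⟨h1, by rw [h2, hinv]⟩
  have hlip : ∀ t ψ φ, (ψ, φ) ∈ T.graph → ‖U t ψ - ψ‖ ≤ ‖φ‖ * |t| := fun t ψ φ h => by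
    have h1 := ((hU t ψ).sub_const ψ).norm
    have h2 := ((hlim ψ φ h).norm).mul_const |t|
    rw [norm_neg, norm_smul, Complex.norm_I, one_mul] at h2
    exact le_of_tendsto_of_tendsto' h1 h2 fun k => norm_exp_smul_sub_le (hb k) t ψ
  have hcont0 : ∀ ψ, Tendsto (fun t => U t ψ) (𝓝 0) (𝓝 ψ) := by
    intro ψ
    rw [Metric.tendsto_nhds]
    intro τ hτ
    obtain ⟨χ, ω, hχ, hψχ⟩ := hdense ψ (τ / 3) (by positivity)
    have : ∀ᶠ t : ℝ in 𝓝 0, ‖ω‖ * |t| < τ / 3 := by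
      have hc : Continuous fun t : ℝ => ‖ω‖ * |t| := by fun_prop
      exact hc.continuousAt.eventually_lt continuousAt_const (by simpa using by positivity)
    filter_upwards [this] with t ht
    have e : U t ψ - ψ = U t (ψ - χ) - (ψ - χ) + (U t χ - χ) := by rw [map_sub]; abel
    rw [dist_eq_norm, e]
    have h1 := norm_add_le (U t (ψ - χ) - (ψ - χ)) (U t χ - χ)
    have h2 := norm_sub_le (U t (ψ - χ)) (ψ - χ)
    rw [hnorm] at h2
    linarith [hlip t χ ω hχ]
  have hderiv : ∀ ψ φ, (ψ, φ) ∈ T.graph → HasDerivAt (fun t : ℝ => U t ψ) (-(Complex.I • φ)) 0 := by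
    intro ψ φ h
    rw [hasDerivAt_iff_isLittleO, Asymptotics.isLittleO_iff]
    intro τ hτ
    obtain ⟨χ, ω, hχ, hψχ⟩ := hdense (-(Complex.I • φ)) (τ / 4) (by positivity)
    have hev : ∀ᶠ t : ℝ in 𝓝 0, ‖ω‖ * |t| < τ / 2 := by
      have hc : Continuous fun t : ℝ => ‖ω‖ * |t| := by fun_prop
      exact hc.continuousAt.eventually_lt continuousAt_const (by simpa using by positivity)
    filter_upwards [hev] with t ht
    have h1 := (((hU t ψ).sub_const ψ).sub ((hlim ψ φ h).const_smul t)).norm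
    have h2 := (((((hlim ψ φ h).sub_const χ).norm.const_mul 2).add
      ((hlim χ ω hχ).norm.mul_const |t|)).mul_const |t|)
    rw [norm_neg (Complex.I • ω), norm_smul, Complex.norm_I, one_mul] at h2
    have h3 := le_of_tendsto_of_tendsto' h1 h2 fun k => norm_exp_smul_sub_sub_le (hb k) t ψ χ
    rw [hzero, sub_zero, Real.norm_eq_abs]
    refine h3.trans (mul_le_mul_of_nonneg_right ?_ (abs_nonneg t))
    linarith
  refine ⟨U, hunit, hzero, hadd, fun ψ => ?_, fun ψ φ => ⟨hderiv ψ φ, fun h => ?_⟩⟩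
  · rw [continuous_iff_continuousAt]
    intro t
    have h1 : Tendsto (fun s => s - t) (𝓝 t) (𝓝 0) := by
      have : Continuous fun s : ℝ => s - t := by fun_prop
      simpa using this.tendsto t
    have h2 := ((U t).continuous.tendsto ψ).comp ((hcont0 ψ).comp h1)
    refine h2.congr fun s => ?_
    change (U t * U (s - t)) ψ = U s ψ
    rw [← hadd, add_sub_cancel]
  · -- A vector at which the group is differentiable pairs with `T` like an element of `D(T*)`.
    refine mem_graph_of_inner hT fun χ ω hχ => ?_
    have hneg : HasDerivAt (fun t : ℝ => U (-t) χ) (Complex.I • ω) 0 := by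
      have h0 : HasDerivAt (fun t : ℝ => U t χ) (-(Complex.I • ω)) (-0 : ℝ) := by
        rw [neg_zero]; exact hderiv χ ω hχ
      have h1 := h0.scomp (0 : ℝ) (hasDerivAt_neg (0 : ℝ))
      rw [neg_one_smul, neg_neg] at h1
      exact h1
    have h1 : HasDerivAt (fun t : ℝ => ⟪U (-t) χ, ψ⟫_ℂ) ⟪Complex.I • ω, ψ⟫_ℂ 0 := by
      have h2 := hneg.inner ℂ (hasDerivAt_const (0 : ℝ) ψ)
      rw [inner_zero_right, zero_add] at h2
      exact h2
    have h2 : HasDerivAt (fun t : ℝ => ⟪χ, U t ψ⟫_ℂ) ⟪χ, -(Complex.I • φ)⟫_ℂ 0 := by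
      simpa using (hasDerivAt_const (0 : ℝ) χ).inner ℂ h
    have h3 : (fun t : ℝ => ⟪U (-t) χ, ψ⟫_ℂ) = fun t : ℝ => ⟪χ, U t ψ⟫_ℂ := by
      funext t
      rw [← ContinuousLinearMap.inner_map_map_of_mem_unitary (hunit t) (U (-t) χ) ψ,
        ← mul_apply_eq_comp, hinv]
      rfl
    rw [h3] at h1
    have h4 := h1.unique h2
    rw [inner_smul_left, inner_neg_right, inner_smul_right, Complex.conj_I, neg_mul] at h4
    exact mul_left_cancel₀ Complex.I_ne_zero (neg_injective h4)

/-- Stone's theorem: a self-adjoint operator generates a unitary group. The approximants are the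
Yosida regularizations `T s² (T² + s²)⁻¹ = (s²/2) ((T - i s)⁻¹ + (T + i s)⁻¹)`, `s → ∞`. -/
theorem exists_isUnitaryGroup (hT : IsSelfAdjoint T) : ∃ U, IsUnitaryGroup T U := by
  -- `J z = -z (T - z)⁻¹` tends strongly to `1` as `z → ∞` along the imaginary axis.
  have hJ : ∀ z : ℕ → ℂ, (∀ k, |(z k).im| = k + 1) → (∀ k, ‖z k‖ = k + 1) → ∀ ψ : K,
      Tendsto (fun k => -(z k • resolvent T (z k) ψ)) atTop (𝓝 ψ) := by
    intro z hz hz' ψ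
    have hne : ∀ k, (z k).im ≠ 0 := fun k => abs_pos.1 (by rw [hz]; positivity)
    rw [Metric.tendsto_nhds]
    intro τ hτ
    obtain ⟨χ, hχ, hd⟩ := Metric.mem_closure_iff.1 (hT.dense_domain ψ) (τ / 3) (by positivity)
    rw [dist_eq_norm] at hd
    have hev : ∀ᶠ k : ℕ in atTop, ((k : ℝ) + 1)⁻¹ * ‖T ⟨χ, hχ⟩‖ < τ / 3 := by
      have h1 : Tendsto (fun k : ℕ => ((k : ℝ) + 1)⁻¹ * ‖T ⟨χ, hχ⟩‖) atTop (𝓝 (0 * ‖T ⟨χ, hχ⟩‖)) :=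
        (tendsto_inv_atTop_zero.comp
          (tendsto_atTop_add_const_right _ _ tendsto_natCast_atTop_atTop)).mul_const _
      rw [zero_mul] at h1
      exact h1.eventually_lt_const (by positivity)
    filter_upwards [hev] with k hk
    have h1 := resolvent_sub_smul hT (hne k) (T.mem_graph ⟨χ, hχ⟩)
    rw [map_sub, map_smul, sub_eq_iff_eq_add] at h1
    have h2 := norm_resolvent_apply_le hT (hne k) (T ⟨χ, hχ⟩)
    have h3 := norm_resolvent_apply_le hT (hne k) (ψ - χ)
    rw [hz] at h2 h3
    have h4 : ‖z k • resolvent T (z k) (ψ - χ)‖ ≤ ‖ψ - χ‖ := by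
      rw [norm_smul, hz']
      calc ((k : ℝ) + 1) * ‖resolvent T (z k) (ψ - χ)‖
          ≤ ((k : ℝ) + 1) * (((k : ℝ) + 1)⁻¹ * ‖ψ - χ‖) := by gcongr
        _ = ‖ψ - χ‖ := by field_simp
    have e : -(z k • resolvent T (z k) ψ) - ψ
        = -(z k • resolvent T (z k) (ψ - χ)) - (ψ - χ) - resolvent T (z k) (T ⟨χ, hχ⟩) := by
      rw [h1, map_sub, smul_sub]
      abel
    rw [dist_eq_norm, e]
    have h5 := norm_sub_le (-(z k • resolvent T (z k) (ψ - χ)) - (ψ - χ))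
      (resolvent T (z k) (T ⟨χ, hχ⟩))
    have h6 := norm_sub_le (-(z k • resolvent T (z k) (ψ - χ))) (ψ - χ)
    rw [norm_neg] at h6
    linarith
  let z : ℕ → ℂ := fun k => Complex.I * ((k + 1 : ℝ) : ℂ)
  have hconj : ∀ k, (starRingEnd ℂ) (z k) = -z k := fun k => by
    simp only [z, map_mul, Complex.conj_I, Complex.conj_ofReal, neg_mul]
  have him : ∀ k, (z k).im = k + 1 := fun k => by simp [z]
  have hzn : ∀ k, ‖z k‖ = k + 1 := fun k => by
    simp only [z, norm_mul, Complex.norm_I, one_mul, Complex.norm_real]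
    exact abs_of_pos (by positivity)
  have hne : ∀ k, (z k).im ≠ 0 := fun k => by rw [him]; positivity
  have hne' : ∀ k, (-z k).im ≠ 0 := fun k => by
    rw [Complex.neg_im]; exact neg_ne_zero.2 (hne k)
  -- With `z = i s`, `c S = -i (s²/2) ((T - z)⁻¹ + (T + z)⁻¹)`, which is `-i` times the Yosida
  -- regularization; on the domain of `T` it is `-(i/2) (J z + J (-z)) T`.
  let S : ℕ → K →L[ℂ] K := fun k => resolvent T (z k) + resolvent T (-z k)
  let c : ℕ → ℂ := fun k => Complex.I * (z k * z k / 2)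
  have hcconj : ∀ k, (starRingEnd ℂ) (c k) = -c k := fun k => by
    simp only [c, map_mul, Complex.conj_I, map_div₀, hconj, Complex.conj_ofNat]
    ring
  have hstar : ∀ k, star (resolvent T (z k)) = resolvent T (-z k) := fun k => by
    rw [ContinuousLinearMap.star_eq_adjoint]
    symm
    rw [ContinuousLinearMap.eq_adjoint_iff]
    intro ψ φ
    rw [inner_resolvent_left hT (hne' k), map_neg, hconj, neg_neg]
  have hstar' : ∀ k, star (S k) = S k := fun k => by
    simp only [S, star_add, ← hstar, star_star]
    exact add_comm _ _
  refine exists_isUnitaryGroup_of_tendsto hT (fun k => c k • S k) (fun k => ?_) (fun k l => ?_) ?_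
  · rw [skewAdjoint.mem_iff, star_smul, hstar' k]
    change (starRingEnd ℂ) (c k) • S k = _
    rw [hcconj, neg_smul]
  · have h1 := commute_resolvent hT (hne k) (hne l)
    have h2 := commute_resolvent hT (hne k) (hne' l)
    have h3 := commute_resolvent hT (hne' k) (hne l)
    have h4 := commute_resolvent hT (hne' k) (hne' l)
    exact (((h1.add_right h2).add_left (h3.add_right h4)).smul_left (c k)).smul_right (c l)
  · intro ψ φ h
    have h1 := hJ z (fun k => by rw [him]; exact abs_of_pos (by positivity)) hzn φ
    have h2 := hJ (fun k => -z k)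
      (fun k => by rw [Complex.neg_im, abs_neg, him]; exact abs_of_pos (by positivity))
      (fun k => by rw [norm_neg, hzn]) φ
    have h3 := ((h1.add h2).const_smul (-(Complex.I / 2)))
    have e : -(Complex.I / 2) • (φ + φ) = -(Complex.I • φ) := by
      rw [← two_smul ℂ φ, smul_smul, neg_mul, div_mul_cancel₀ _ (two_ne_zero), neg_smul]
    rw [e] at h3
    refine h3.congr fun k => ?_
    have h4 := resolvent_sub_smul hT (hne k) h
    have h5 := resolvent_sub_smul hT (hne' k) h
    rw [map_sub, map_smul, sub_eq_iff_eq_add] at h4 h5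
    rw [h4, h5]
    change _ = c k • (resolvent T (z k) ψ + resolvent T (-z k) ψ)
    simp only [c]
    module

end Stone

/-! ### Bounded perturbations of self-adjoint operators -/

section Perturbation

variable {K : Type*} [NormedAddCommGroup K] [InnerProductSpace ℂ K]

/-- The homeomorphism `(ψ, φ) ↦ (ψ, φ + V ψ)` of `K × K`, which carries the graph of `T - V` to
the graph of `T`. -/
def shear (V : K →L[ℂ] K) : (K × K) ≃L[ℂ] (K × K) :=
  ContinuousLinearEquiv.equivOfInverse
    ((ContinuousLinearMap.fst ℂ K K).prod
      (ContinuousLinearMap.snd ℂ K K + V.comp (ContinuousLinearMap.fst ℂ K K)))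
    ((ContinuousLinearMap.fst ℂ K K).prod
      (ContinuousLinearMap.snd ℂ K K - V.comp (ContinuousLinearMap.fst ℂ K K)))
    (fun p => by simp) (fun p => by simp)

theorem domain_eq_of_shear {T S : K →ₗ.[ℂ] K} (V : K →L[ℂ] K)
    (hS : ∀ ψ φ, (ψ, φ) ∈ S.graph ↔ (ψ, φ + V ψ) ∈ T.graph) : S.domain = T.domain := by
  ext ψ
  rw [LinearPMap.mem_domain_iff, LinearPMap.mem_domain_iff]
  constructor
  · rintro ⟨φ, h⟩
    exact ⟨_, (hS ψ φ).1 h⟩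
  · rintro ⟨φ, h⟩
    exact ⟨φ - V ψ, (hS ψ _).2 (by rwa [sub_add_cancel])⟩

variable [CompleteSpace K]

/-- An operator whose closure is self-adjoint is closable, since the value of `closure` at an
operator that is not closable is that operator itself. -/
theorem isClosable_of_isSelfAdjoint_closure {T₀ : K →ₗ.[ℂ] K} (hT : IsSelfAdjoint T₀.closure) :
    T₀.IsClosable := by
  by_contra hn
  rw [LinearPMap.closure_def' hn] at hT
  exact hn hT.isClosed.isClosable

theorem mem_graph_closure_of_shear {T₀ S₀ : K →ₗ.[ℂ] K} (hT : IsSelfAdjoint T₀.closure)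
    (V : K →L[ℂ] K) (hS : ∀ ψ φ, (ψ, φ) ∈ S₀.graph ↔ (ψ, φ + V ψ) ∈ T₀.graph) (ψ φ : K) :
    (ψ, φ) ∈ S₀.closure.graph ↔ (ψ, φ + V ψ) ∈ T₀.closure.graph := by
  have hTc := isClosable_of_isSelfAdjoint_closure hT
  let g : Submodule ℂ (K × K) :=
    T₀.closure.graph.comap ((shear V : (K × K) →L[ℂ] (K × K)) : (K × K) →ₗ[ℂ] (K × K))
  have hg : ∀ ψ φ, (ψ, φ) ∈ g ↔ (ψ, φ + V ψ) ∈ T₀.closure.graph := fun _ _ => Iff.rfl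
  have hgraph : g.toLinearPMap.graph = g := by
    refine Submodule.toLinearPMap_graph_eq g ?_
    rintro ⟨a, b⟩ hx h0
    simp only at h0
    subst h0
    rw [hg, map_zero, add_zero] at hx
    exact LinearPMap.graph_fst_eq_zero_snd _ hx rfl
  have hcl : S₀.graph.topologicalClosure = g := by
    have h1 : (S₀.graph : Set (K × K)) = shear V ⁻¹' (T₀.graph : Set (K × K)) := by
      ext ⟨a, b⟩
      exact hS a b
    have h2 : closure (S₀.graph : Set (K × K))
        = shear V ⁻¹' closure (T₀.graph : Set (K × K)) := by
      rw [h1]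
      exact ((shear V).toHomeomorph.preimage_closure _).symm
    apply SetLike.coe_injective
    rw [Submodule.topologicalClosure_coe, h2, ← Submodule.topologicalClosure_coe,
      hTc.graph_closure_eq_closure_graph]
    rfl
  have hSc : S₀.IsClosable := ⟨g.toLinearPMap, by rw [hgraph, hcl]⟩
  rw [← hSc.graph_closure_eq_closure_graph, hcl, hg]

/-- A bounded symmetric perturbation of a self-adjoint operator is self-adjoint. -/
theorem isSelfAdjoint_of_shear {T S : K →ₗ.[ℂ] K} (hT : IsSelfAdjoint T) (V : K →L[ℂ] K)
    (hV : ∀ ψ φ, ⟪V ψ, φ⟫_ℂ = ⟪ψ, V φ⟫_ℂ)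
    (hS : ∀ ψ φ, (ψ, φ) ∈ S.graph ↔ (ψ, φ + V ψ) ∈ T.graph) : IsSelfAdjoint S := by
  have hd : Dense (S.domain : Set K) := by
    rw [domain_eq_of_shear V hS]; exact hT.dense_domain
  rw [isSelfAdjoint_iff_graph hd]
  intro ψ φ
  rw [hS, (isSelfAdjoint_iff_graph hT.dense_domain).1 hT]
  constructor
  · intro h χ ω hχ
    have := h _ _ ((hS χ ω).1 hχ)
    rw [inner_add_left, inner_add_right, hV] at this
    exact add_right_cancel this
  · intro h χ ω hχ
    have := h χ (ω - V χ) ((hS χ _).2 (by rwa [sub_add_cancel]))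
    rw [inner_sub_left, hV, sub_eq_iff_eq_add] at this
    rw [this, inner_add_right]

end Perturbation

/-! ### Comparison of unitary groups -/

section Group

variable {K : Type*} [NormedAddCommGroup K] [InnerProductSpace ℂ K] [CompleteSpace K]
  {T : K →ₗ.[ℂ] K} {U : ℝ → K →L[ℂ] K}

theorem isUnitaryGroup_unitaryGroup (hT : IsSelfAdjoint T) :
    IsUnitaryGroup T (unitaryGroup T) := by
  have h := exists_isUnitaryGroup hT
  rw [unitaryGroup, dif_pos h]
  exact h.choose_spec

namespace IsUnitaryGroup

theorem norm_apply (hU : IsUnitaryGroup T U) (t : ℝ) (ψ : K) : ‖U t ψ‖ = ‖ψ‖ :=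
  ContinuousLinearMap.norm_map_of_mem_unitary (hU.unitary t) ψ

theorem hasDerivAt (hU : IsUnitaryGroup T U) {ψ φ : K} (h : (ψ, φ) ∈ T.graph) (t : ℝ) :
    HasDerivAt (fun s => U s ψ) (-(Complex.I • U t φ)) t := by
  have h0 : HasDerivAt (fun s => U s ψ) (-(Complex.I • φ)) (t - t) := by
    rw [sub_self]; exact (hU.generator ψ φ).1 h
  have h1 := h0.scomp (h := fun s => s - t) t ((hasDerivAt_id t).sub_const t)
  rw [one_smul] at h1
  have h2 := (((U t).restrictScalars ℝ).hasFDerivAt (x := U (t - t) ψ)).comp_hasDerivAt t h1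
  have h3 : (U t).restrictScalars ℝ (-(Complex.I • φ)) = -(Complex.I • U t φ) := by
    change U t (-(Complex.I • φ)) = _
    rw [map_neg, map_smul]
  rw [h3] at h2
  refine h2.congr_of_eventuallyEq (Eventually.of_forall fun s => ?_)
  change U s ψ = (U t * U (s - t)) ψ
  rw [← hU.add, add_sub_cancel]

theorem mem_graph (hU : IsUnitaryGroup T U) {ψ φ : K} (h : (ψ, φ) ∈ T.graph) (t : ℝ) :
    (U t ψ, U t φ) ∈ T.graph := by
  rw [hU.generator]
  have h2 := (((U t).restrictScalars ℝ).hasFDerivAt (x := U 0 ψ)).comp_hasDerivAt 0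
    ((hU.generator ψ φ).1 h)
  have h3 : (U t).restrictScalars ℝ (-(Complex.I • φ)) = -(Complex.I • U t φ) := by
    change U t (-(Complex.I • φ)) = _
    rw [map_neg, map_smul]
  rw [h3] at h2
  refine h2.congr_of_eventuallyEq (Eventually.of_forall fun s => ?_)
  change (U s * U t) ψ = (U t * U s) ψ
  rw [← hU.add, ← hU.add, add_comm]

end IsUnitaryGroup

/-- Two unitary groups are close if the form of the difference of their generators on the domain
is close to that of a commutator `-i ε [T, J]`: the commutator integrates to boundary terms. -/
theorem norm_unitaryGroup_sub_le {S : K →ₗ.[ℂ] K} {U' : ℝ → K →L[ℂ] K} {V J : K →L[ℂ] K}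
    (hT : IsSelfAdjoint T) (hU : IsUnitaryGroup T U) (hU' : IsUnitaryGroup S U')
    (hS : ∀ ψ φ, (ψ, φ) ∈ S.graph ↔ (ψ, φ + V ψ) ∈ T.graph) {ε r : ℝ} (hε : 0 ≤ ε)
    (hr : 0 ≤ r)
    (hJ : ∀ ψ φ χ ω, (ψ, φ) ∈ T.graph → (χ, ω) ∈ T.graph →
      ‖⟪χ, V ψ⟫_ℂ + Complex.I * ε * (⟪ω, J ψ⟫_ℂ - ⟪χ, J φ⟫_ℂ)‖ ≤ r * ‖χ‖ * ‖ψ‖) (t : ℝ) :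
    ‖U t - U' t‖ ≤ 2 * ε * ‖J‖ + |t| * (r + ε * ‖J‖ * ‖V‖) := by
  have key : ∀ ψ φ χ ω, (ψ, φ) ∈ T.graph → (χ, ω) ∈ T.graph →
      ‖⟪U t χ, U' t ψ⟫_ℂ - ⟪χ, ψ⟫_ℂ‖
        ≤ (2 * ε * ‖J‖ + |t| * (r + ε * ‖J‖ * ‖V‖)) * ‖χ‖ * ‖ψ‖ := by
    intro ψ φ χ ω hψ hχ
    have hψ' : (ψ, φ - V ψ) ∈ S.graph := (hS _ _).2 (by rwa [sub_add_cancel])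
    -- The derivative of `⟪U s χ, U' s ψ⟫` is the form of `i V` along the two orbits. The second term
    -- is the boundary term whose derivative removes the commutator part of it; what is left is `r`
    -- and the error `ε J V`, which comes from `U'` having the generator `T - V` in place of `T`.
    let f : ℝ → ℂ := fun s => ⟪U s χ, U' s ψ⟫_ℂ + Complex.I * ε * ⟪U s χ, J (U' s ψ)⟫_ℂ
    let f' : ℝ → ℂ := fun s =>
      (⟪U s χ, -(Complex.I • U' s (φ - V ψ))⟫_ℂ + ⟪-(Complex.I • U s ω), U' s ψ⟫_ℂ) +
      Complex.I * ε * (⟪U s χ, J (-(Complex.I • U' s (φ - V ψ)))⟫_ℂ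
        + ⟪-(Complex.I • U s ω), J (U' s ψ)⟫_ℂ)
    have hf : ∀ s, HasDerivAt f (f' s) s := by
      intro s
      have h1 := hU.hasDerivAt hχ s
      have h2 := hU'.hasDerivAt hψ' s
      have h3 := ((J.restrictScalars ℝ).hasFDerivAt (x := U' s ψ)).comp_hasDerivAt s h2
      exact (h1.inner ℂ h2).add ((h1.inner ℂ h3).const_mul _)
    have hbd : ∀ s, ‖f' s‖ ≤ (r + ε * ‖J‖ * ‖V‖) * ‖χ‖ * ‖ψ‖ := by
      intro s
      have hm1 := hU.mem_graph hχ s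
      have hm2 := (hS _ _).1 (hU'.mem_graph hψ' s)
      have h1 := hJ _ _ _ _ hm2 hm1
      set c := U s χ
      set u := U' s ψ
      set v := U' s (φ - V ψ)
      have e : f' s = Complex.I * (⟪c, V u⟫_ℂ
          + Complex.I * ε * (⟪U s ω, J u⟫_ℂ - ⟪c, J (v + V u)⟫_ℂ))
          - ε * ⟪c, J (V u)⟫_ℂ := by
        have h2 := inner_graph hT hm2 hm1
        rw [inner_add_right] at h2
        have hI : Complex.I * Complex.I = -1 := Complex.I_mul_I
        simp only [f', map_add, map_neg, map_smul, inner_neg_left, inner_neg_right, inner_smul_left,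
          inner_smul_right, inner_add_right, Complex.conj_I]
        rw [h2]
        linear_combination (ε * ⟪c, J (V u)⟫_ℂ) * hI
      rw [e]
      have hc : ‖c‖ = ‖χ‖ := hU.norm_apply s χ
      have hu : ‖u‖ = ‖ψ‖ := hU'.norm_apply s ψ
      have h3 : ‖⟪c, J (V u)⟫_ℂ‖ ≤ ‖χ‖ * (‖J‖ * (‖V‖ * ‖ψ‖)) := by
        refine (norm_inner_le_norm _ _).trans ?_
        rw [hc]
        gcongr
        refine (J.le_opNorm _).trans ?_
        gcongr
        rw [← hu]
        exact V.le_opNorm _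
      rw [hc, hu] at h1
      refine (norm_sub_le _ _).trans ?_
      rw [norm_mul, Complex.norm_I, one_mul, norm_mul, Complex.norm_real, Real.norm_eq_abs,
        abs_of_nonneg hε]
      have h4 := mul_le_mul_of_nonneg_left h3 hε
      linarith
    have h1 := norm_sub_le_of_hasDerivAt hf (t := t) fun s _ => hbd s
    have e : ⟪U t χ, U' t ψ⟫_ℂ - ⟪χ, ψ⟫_ℂ
        = (f t - f 0) - Complex.I * ε * (⟪U t χ, J (U' t ψ)⟫_ℂ - ⟪χ, J ψ⟫_ℂ) := by
      simp only [f, hU.zero, hU'.zero, one_apply_eq_self]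
      ring
    have hb : ∀ s, ‖⟪U s χ, J (U' s ψ)⟫_ℂ‖ ≤ ‖χ‖ * (‖J‖ * ‖ψ‖) := fun s => by
      refine (norm_inner_le_norm _ _).trans ?_
      rw [hU.norm_apply]
      gcongr
      exact (J.le_opNorm _).trans (by rw [hU'.norm_apply])
    have hb0 := hb 0
    simp only [hU.zero, hU'.zero, one_apply_eq_self] at hb0
    rw [e]
    refine (norm_sub_le _ _).trans ?_
    rw [norm_mul, norm_mul, Complex.norm_I, one_mul, Complex.norm_real, Real.norm_eq_abs,
      abs_of_nonneg hε]
    have h5 := mul_le_mul_of_nonneg_left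
      ((norm_sub_le (⟪U t χ, J (U' t ψ)⟫_ℂ) (⟪χ, J ψ⟫_ℂ)).trans (add_le_add (hb t) hb0)) hε
    linarith
  set B := 2 * ε * ‖J‖ + |t| * (r + ε * ‖J‖ * ‖V‖)
  have hprod : ∀ p : K × K, ‖⟪U t p.1, U' t p.2⟫_ℂ - ⟪p.1, p.2⟫_ℂ‖ ≤ B * ‖p.1‖ * ‖p.2‖ := by
    have hcl : IsClosed {p : K × K |
        ‖⟪U t p.1, U' t p.2⟫_ℂ - ⟪p.1, p.2⟫_ℂ‖ ≤ B * ‖p.1‖ * ‖p.2‖} :=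
      isClosed_le (by fun_prop) (by fun_prop)
    have hd : Dense ((T.domain : Set K) ×ˢ (T.domain : Set K)) :=
      hT.dense_domain.prod hT.dense_domain
    intro p
    refine hcl.closure_subset_iff.2 ?_ (hd p)
    rintro ⟨χ, ψ⟩ ⟨hχ, hψ⟩
    exact key _ _ _ _ (T.mem_graph ⟨ψ, hψ⟩) (T.mem_graph ⟨χ, hχ⟩)
  have hB : 0 ≤ B := by positivity
  rw [norm_sub_rev]
  refine ContinuousLinearMap.opNorm_le_bound _ hB fun ψ => ?_
  change ‖U' t ψ - U t ψ‖ ≤ B * ‖ψ‖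
  set v := U' t ψ - U t ψ
  have hinv : U t (U (-t) v) = v := by
    change (U t * U (-t)) v = v
    rw [← hU.add, add_neg_cancel, hU.zero]; rfl
  -- With `χ = U (-t) v`, the form in `hprod` is `⟪v, U' t ψ⟫ - ⟪v, U t ψ⟫ = ‖v‖²`.
  have h1 := hprod (U (-t) v, ψ)
  have h2 : ⟪U (-t) v, ψ⟫_ℂ = ⟪v, U t ψ⟫_ℂ := by
    rw [← ContinuousLinearMap.inner_map_map_of_mem_unitary (hU.unitary t) (U (-t) v) ψ, hinv]
  simp only [hinv, h2, hU.norm_apply, ← inner_sub_right] at h1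
  rw [show U' t ψ - U t ψ = v from rfl, inner_self_eq_norm_sq_to_K, norm_pow] at h1
  simp only [Complex.coe_algebraMap, Complex.norm_real, norm_norm] at h1
  rcases (norm_nonneg v).eq_or_lt with h0 | h0
  · rw [← h0]; positivity
  · refine le_of_mul_le_mul_left ?_ h0
    linarith [sq ‖v‖]

/-- The comparison of the groups generated by the closures of `T₀` and `T₀ - A - A*`, when `A` is
close to `-i ε [T₀, B]` on the domain of `T₀`. The commutator with `B*` takes care of `A*`. -/
theorem norm_unitaryGroup_closure_sub_le {T₀ S₀ : K →ₗ.[ℂ] K} (hT : IsSelfAdjoint T₀.closure)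
    {A B : K →L[ℂ] K}
    (hS₀ : ∀ ψ φ, (ψ, φ) ∈ S₀.graph ↔
      (ψ, φ + (A + ContinuousLinearMap.adjoint A) ψ) ∈ T₀.graph)
    {ε r : ℝ} (hε : 0 ≤ ε) (hr : 0 ≤ r)
    (hB : ∀ ψ φ, (ψ, φ) ∈ T₀.graph → ∃ ξ, (B ψ, ξ) ∈ T₀.graph ∧
      ‖A ψ + (Complex.I * ε) • (ξ - B φ)‖ ≤ r * ‖ψ‖) (t : ℝ) :
    ‖unitaryGroup T₀.closure t - unitaryGroup S₀.closure t‖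
      ≤ 4 * ε * ‖B‖ + |t| * (2 * r + 4 * ε * ‖B‖ * ‖A‖) := by
  set V := A + ContinuousLinearMap.adjoint A
  set J := B + ContinuousLinearMap.adjoint B
  have hVs : ∀ ψ φ, ⟪V ψ, φ⟫_ℂ = ⟪ψ, V φ⟫_ℂ := fun ψ φ => by
    simp only [V, add_apply, inner_add_left, inner_add_right,
      ContinuousLinearMap.adjoint_inner_left, ContinuousLinearMap.adjoint_inner_right]
    exact add_comm _ _
  have hS := mem_graph_closure_of_shear hT V hS₀
  have hSs := isSelfAdjoint_of_shear hT V hVs hS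
  have hTc := isClosable_of_isSelfAdjoint_closure hT
  have hcore : ∀ p ∈ (T₀.graph : Set (K × K)) ×ˢ (T₀.graph : Set (K × K)),
      ‖⟪p.2.1, A p.1.1⟫_ℂ + Complex.I * ε * (⟪p.2.2, B p.1.1⟫_ℂ - ⟪p.2.1, B p.1.2⟫_ℂ)‖
        ≤ r * ‖p.2.1‖ * ‖p.1.1‖ := by
    rintro ⟨⟨ψ, φ⟩, ⟨χ, ω⟩⟩ ⟨h1, h2⟩
    obtain ⟨ξ, hξ, hle⟩ := hB ψ φ h1
    have h3 := inner_graph hT (LinearPMap.le_graph_of_le T₀.le_closure hξ)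
      (LinearPMap.le_graph_of_le T₀.le_closure h2)
    simp only
    rw [h3, ← inner_sub_right, ← inner_smul_right, ← inner_add_right]
    refine (norm_inner_le_norm _ _).trans ?_
    have := mul_le_mul_of_nonneg_left hle (norm_nonneg χ)
    linarith
  have hform : ∀ ψ φ χ ω, (ψ, φ) ∈ T₀.closure.graph → (χ, ω) ∈ T₀.closure.graph →
      ‖⟪χ, A ψ⟫_ℂ + Complex.I * ε * (⟪ω, B ψ⟫_ℂ - ⟪χ, B φ⟫_ℂ)‖ ≤ r * ‖χ‖ * ‖ψ‖ := by
    intro ψ φ χ ω h1 h2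
    rw [← hTc.graph_closure_eq_closure_graph] at h1 h2
    have hcl : IsClosed {p : (K × K) × (K × K) |
        ‖⟪p.2.1, A p.1.1⟫_ℂ + Complex.I * ε * (⟪p.2.2, B p.1.1⟫_ℂ - ⟪p.2.1, B p.1.2⟫_ℂ)‖
          ≤ r * ‖p.2.1‖ * ‖p.1.1‖} := isClosed_le (by fun_prop) (by fun_prop)
    have hmem : ((ψ, φ), (χ, ω)) ∈
        closure ((T₀.graph : Set (K × K)) ×ˢ (T₀.graph : Set (K × K))) := by
      rw [closure_prod_eq]; exact ⟨h1, h2⟩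
    exact hcl.closure_subset_iff.2 hcore hmem
  have hmain := norm_unitaryGroup_sub_le hT (isUnitaryGroup_unitaryGroup hT)
    (isUnitaryGroup_unitaryGroup hSs) hS (J := J) (r := 2 * r) hε (by positivity)
    (fun ψ φ χ ω h1 h2 => by
      have e : ⟪χ, V ψ⟫_ℂ + Complex.I * ε * (⟪ω, J ψ⟫_ℂ - ⟪χ, J φ⟫_ℂ)
          = (⟪χ, A ψ⟫_ℂ + Complex.I * ε * (⟪ω, B ψ⟫_ℂ - ⟪χ, B φ⟫_ℂ))
            + (starRingEnd ℂ) (⟪ψ, A χ⟫_ℂ + Complex.I * ε * (⟪φ, B χ⟫_ℂ - ⟪ψ, B ω⟫_ℂ)) := by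
        simp only [V, J, add_apply, inner_add_right, ContinuousLinearMap.adjoint_inner_right,
          map_add, map_mul, map_sub, inner_conj_symm, Complex.conj_I, Complex.conj_ofReal]
        ring
      rw [e]
      refine (norm_add_le _ _).trans ?_
      rw [RCLike.norm_conj]
      have h3 := hform ψ φ χ ω h1 h2
      have h4 := hform χ ω ψ φ h2 h1
      linarith) t
  have hVn : ‖V‖ ≤ 2 * ‖A‖ := (norm_add_le _ _).trans_eq (by
    rw [LinearIsometryEquiv.norm_map, two_mul])
  have hJn : ‖J‖ ≤ 2 * ‖B‖ := (norm_add_le _ _).trans_eq (by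
    rw [LinearIsometryEquiv.norm_map, two_mul])
  calc _ ≤ _ := hmain
    _ ≤ 2 * ε * (2 * ‖B‖) + |t| * (2 * r + ε * (2 * ‖B‖) * (2 * ‖A‖)) := by gcongr
    _ = _ := by ring

end Group

/-! ### The off-diagonal part of an operator -/

section OffDiagonal

variable {K : Type*} [NormedAddCommGroup K] [InnerProductSpace ℂ K]

theorem mem_graph_add {T S : K →ₗ.[ℂ] K} {ψ φ : K} :
    (ψ, φ) ∈ (T + S).graph ↔ ∃ φ₁ φ₂, (ψ, φ₁) ∈ T.graph ∧ (ψ, φ₂) ∈ S.graph ∧ φ = φ₁ + φ₂ := by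
  constructor
  · intro h
    obtain ⟨y, rfl, rfl⟩ := (LinearPMap.mem_graph_iff _).1 h
    exact ⟨T ⟨y, y.2.1⟩, S ⟨y, y.2.2⟩, T.mem_graph ⟨y, y.2.1⟩, S.mem_graph ⟨y, y.2.2⟩, rfl⟩
  · rintro ⟨φ₁, φ₂, h₁, h₂, rfl⟩
    obtain ⟨y, hy, rfl⟩ := (LinearPMap.mem_graph_iff _).1 h₁
    obtain ⟨z, hz, rfl⟩ := (LinearPMap.mem_graph_iff _).1 h₂
    simp only at hy hz
    subst hy
    have : z = ⟨(y : K), hz ▸ z.2⟩ := Subtype.ext hz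
    rw [this]
    exact (T + S).mem_graph ⟨y, y.2, hz ▸ z.2⟩

theorem mem_graph_sandwich {T : K →ₗ.[ℂ] K} {Q : K →L[ℂ] K} {ψ φ : K} :
    (ψ, φ) ∈ (sandwich Q T).graph ↔ ∃ ω, (Q ψ, ω) ∈ T.graph ∧ φ = Q ω := by
  constructor
  · intro h
    obtain ⟨y, rfl, rfl⟩ := (LinearPMap.mem_graph_iff _).1 h
    exact ⟨T ⟨Q y, y.2⟩, T.mem_graph ⟨Q y, y.2⟩, rfl⟩
  · rintro ⟨ω, h, rfl⟩
    obtain ⟨y, hy, rfl⟩ := (LinearPMap.mem_graph_iff _).1 h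
    simp only at hy
    have hm : Q ψ ∈ T.domain := hy ▸ y.2
    have : y = ⟨Q ψ, hm⟩ := Subtype.ext hy
    rw [this]
    exact (sandwich Q T).mem_graph ⟨ψ, hm⟩

/-- Removing the off-diagonal part `A + A*` of `h` from `H₀ + h` leaves the block-diagonal
operator `H₀ + P h P + P⊥ h P⊥` with the same domain, because `P` preserves the domain of `h`. -/
theorem mem_graph_blockDiagonal {H h : K →ₗ.[ℂ] K} {P V : K →L[ℂ] K}
    (hmem : ∀ ψ φ, (ψ, φ) ∈ h.graph → ∃ φ', (P ψ, φ') ∈ h.graph)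
    (hV : ∀ ψ φ φ', (ψ, φ) ∈ h.graph → (P ψ, φ') ∈ h.graph → V ψ = φ' + P φ - 2 • P φ')
    (ψ φ : K) :
    (ψ, φ) ∈ (H + sandwich P h + sandwich (1 - P) h).graph ↔ (ψ, φ + V ψ) ∈ (H + h).graph := by
  simp only [mem_graph_add, mem_graph_sandwich]
  constructor
  · rintro ⟨_, _, ⟨φ₀, _, h0, ⟨ω, hω, rfl⟩, rfl⟩, ⟨ω', hω', rfl⟩, rfl⟩
    have h1 : (ψ, ω + ω') ∈ h.graph := by
      have := h.graph.add_mem hω hω'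
      rw [Prod.mk_add_mk] at this
      have e : P ψ + (1 - P) ψ = ψ := by
        rw [sub_apply, one_apply_eq_self, add_sub_cancel]
      rwa [e] at this
    refine ⟨φ₀, ω + ω', h0, h1, ?_⟩
    rw [hV _ _ _ h1 hω, sub_apply, one_apply_eq_self, map_add, two_smul]
    abel
  · rintro ⟨φ₀, φ₁, h0, h1, he⟩
    obtain ⟨ω, hω⟩ := hmem _ _ h1
    have hω' : ((1 - P) ψ, φ₁ - ω) ∈ h.graph := h.graph.sub_mem h1 hω
    refine ⟨_, _, ⟨φ₀, _, h0, ⟨ω, hω, rfl⟩, rfl⟩, ⟨_, hω', rfl⟩, ?_⟩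
    rw [hV _ _ _ h1 hω] at he
    rw [eq_sub_of_add_eq he, sub_apply, one_apply_eq_self, map_sub, two_smul]
    abel

variable [CompleteSpace K]

/-- A bounded linear map on the dense domain of `T` extends to the whole space. -/
theorem exists_extension_of_graph {T : K →ₗ.[ℂ] K} (hd : Dense (T.domain : Set K))
    (f : T.domain →ₗ[ℂ] K) {c : ℝ} (hc : 0 ≤ c) (hf : ∀ ψ, ‖f ψ‖ ≤ c * ‖(ψ : K)‖) :
    ∃ R : K →L[ℂ] K, ‖R‖ ≤ c ∧ ∀ ψ : T.domain, R ψ = f ψ :=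
  ⟨f.extendOfNorm T.domain.subtype, LinearMap.opNorm_extendOfNorm_le hd.denseRange_val hc hf,
    fun ψ => LinearMap.extendOfNorm_eq hd.denseRange_val ⟨c, hf⟩ ψ⟩

/-- If `[h, P] = -L` up to a bounded error of size `c`, then the off-diagonal part of `h` with
respect to the projection `P` is bounded, of the form `A + A*` with `A = P⊥ h P`, and `A` is
`-P⊥ L P` up to an error of size `c`. -/
theorem exists_offDiagonal {h : K →ₗ.[ℂ] K} (hh : IsSelfAdjoint h) {P L : K →L[ℂ] K}
    (hP : IsStarProjection P) {c : ℝ} (hc : 0 ≤ c)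
    (hcomm : ∀ ψ φ, (ψ, φ) ∈ h.graph → ∃ φ', (P ψ, φ') ∈ h.graph ∧
      ‖φ' - P φ + L ψ‖ ≤ c * ‖ψ‖) :
    ∃ A : K →L[ℂ] K, ‖A + (1 - P) * L * P‖ ≤ c ∧
      (∀ ψ φ φ', (ψ, φ) ∈ h.graph → (P ψ, φ') ∈ h.graph →
        (A + ContinuousLinearMap.adjoint A) ψ = φ' + P φ - 2 • P φ') := by
  have hmem : ∀ ψ : h.domain, P ψ ∈ h.domain := fun ψ => by
    obtain ⟨φ', h1, -⟩ := hcomm _ _ (h.mem_graph ψ)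
    exact LinearPMap.mem_domain_of_mem_graph h1
  have hPP : ∀ ψ, P (P ψ) = P ψ := fun ψ => by
    rw [← mul_apply_eq_comp, hP.isIdempotentElem]
  have hPs : ∀ ψ φ, ⟪P ψ, φ⟫_ℂ = ⟪ψ, P φ⟫_ℂ := fun ψ φ => by
    rw [← ContinuousLinearMap.adjoint_inner_right, ← ContinuousLinearMap.star_eq_adjoint,
      hP.isSelfAdjoint.star_eq]
  have hPn : ‖P‖ ≤ 1 := hP.norm_le
  have hQn : ‖1 - P‖ ≤ 1 := hP.one_sub.norm_le
  let f : h.domain →ₗ[ℂ] K :=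
    h.toFun ∘ₗ ((P : K →ₗ[ℂ] K).restrict (p := h.domain) (q := h.domain) fun ψ hψ => hmem ⟨ψ, hψ⟩)
      - (P : K →ₗ[ℂ] K) ∘ₗ h.toFun + (L : K →ₗ[ℂ] K) ∘ₗ h.domain.subtype
  have hf : ∀ ψ : h.domain, f ψ = h ⟨P ψ, hmem ψ⟩ - P (h ψ) + L ψ := fun ψ => rfl
  obtain ⟨R, hRn, hR⟩ := exists_extension_of_graph hh.dense_domain f hc fun ψ => by
    obtain ⟨φ', h1, h2⟩ := hcomm _ _ (h.mem_graph ψ)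
    have h3 := LinearPMap.mem_graph_snd_inj h h1 (h.mem_graph ⟨P ψ, hmem ψ⟩) rfl
    rw [hf, ← h3]
    exact h2
  have hRg : ∀ ψ φ φ', (ψ, φ) ∈ h.graph → (P ψ, φ') ∈ h.graph → R ψ - L ψ = φ' - P φ := by
    intro ψ φ φ' h1 h2
    obtain ⟨y, rfl, rfl⟩ := (LinearPMap.mem_graph_iff _).1 h1
    have h3 := LinearPMap.mem_graph_snd_inj h h2 (h.mem_graph ⟨P y, hmem y⟩) rfl
    rw [hR, hf, h3]
    abel
  let A : K →L[ℂ] K := (1 - P) * (R - L) * P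
  have hA : ∀ ψ φ', (P ψ, φ') ∈ h.graph → A ψ = φ' - P φ' := by
    intro ψ φ' h1
    have h2 := hRg _ _ φ' h1 (by rwa [hPP])
    change (R (P ψ) - L (P ψ)) - P (R (P ψ) - L (P ψ)) = _
    rw [h2, map_sub, hPP, sub_self, sub_zero]
  refine ⟨A, ?_, fun ψ φ φ' h1 h2 => ?_⟩
  · have e : A + (1 - P) * L * P = (1 - P) * R * P := by simp only [A]; noncomm_ring
    rw [e]
    calc ‖(1 - P) * R * P‖ ≤ ‖1 - P‖ * ‖R‖ * ‖P‖ :=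
          (norm_mul_le _ _).trans (by gcongr; exact norm_mul_le _ _)
      _ ≤ 1 * c * 1 := by gcongr
      _ = c := by ring
  · have h3 : ContinuousLinearMap.adjoint A ψ = P φ - P φ' := by
      refine hh.dense_domain.eq_of_inner_left ℂ fun χ hχ => ?_
      rw [ContinuousLinearMap.adjoint_inner_left, hA χ _ (h.mem_graph ⟨P χ, hmem ⟨χ, hχ⟩⟩),
        inner_sub_right, ← hPs, inner_sub_left, hPs φ, hPs φ']
      have g1 := inner_graph hh (h.mem_graph ⟨P χ, hmem ⟨χ, hχ⟩⟩) h1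
      have g2 := inner_graph hh (h.mem_graph ⟨P χ, hmem ⟨χ, hχ⟩⟩) h2
      rw [← g1, ← g2]
    rw [add_apply, h3, hA ψ φ' h2]
    abel

end OffDiagonal

/-! ### Approximate solution of the commutator equation -/

section Commutator

variable {K : Type*} [NormedAddCommGroup K] [InnerProductSpace ℂ K]

/-- The commutator of `H + h` with `∑ G_j D_j P`, where `G_j` solves the commutator equation
`[H, G_j] = B_j - i δ G_j`, is `∑ B_j D_j P` up to small errors. The projection `P` on the right
makes the commutator of `D_j` with `H`, which is only bounded relative to `H`, a bounded
operator. -/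
theorem exists_commutator_approx {ι : Type*} [Fintype ι] {H h : K →ₗ.[ℂ] K} {P EP : K →L[ℂ] K}
    {B D G EG : ι → K →L[ℂ] K} {ε δ a c d e g p : ℝ} (hε : 0 ≤ ε) (hδ : 0 ≤ δ) (ha : 0 ≤ a)
    (hc : 0 ≤ c) (hd : 0 ≤ d) (hg : 0 ≤ g)
    (hPn : ‖P‖ ≤ 1) (hEPn : ‖EP‖ ≤ e) (hDn : ∀ j, ‖D j‖ ≤ d) (hGn : ∀ j, ‖G j‖ ≤ a)
    (hHP : ∀ ψ, (P ψ, EP ψ) ∈ H.graph) (hPH : ∀ ψ φ, (ψ, φ) ∈ H.graph → P φ = EP ψ)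
    (hHG : ∀ j ψ, (G j ψ, EG j ψ + B j ψ - (Complex.I * δ) • G j ψ) ∈ H.graph)
    (hGH : ∀ j ψ φ, (ψ, φ) ∈ H.graph → G j φ = EG j ψ)
    (hHD : ∀ j ψ φ, (ψ, φ) ∈ H.graph → ∃ φ', (D j ψ, φ') ∈ H.graph ∧
      ‖D j φ - φ'‖ ≤ ε * c * (‖φ‖ + ‖ψ‖))
    (hhD : ∀ j ψ φ, (ψ, φ) ∈ h.graph → ∃ φ', (D j ψ, φ') ∈ h.graph ∧
      ‖D j φ - φ'‖ ≤ ε * c * ‖ψ‖)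
    (hhP : ∀ ψ φ, (ψ, φ) ∈ h.graph → ∃ φ', (P ψ, φ') ∈ h.graph ∧ ‖φ' - P φ‖ ≤ ε * p * ‖ψ‖)
    (hhG : ∀ j ψ φ, (ψ, φ) ∈ h.graph → ∃ φ', (G j ψ, φ') ∈ h.graph ∧ ‖φ' - G j φ‖ ≤ g * ‖ψ‖)
    {ψ φ : K} (hψ : (ψ, φ) ∈ (H + h).graph) :
    ∃ ξ, ((∑ j, G j * D j * P) ψ, ξ) ∈ (H + h).graph ∧
      ‖ξ - (∑ j, G j * D j * P) φ - (∑ j, B j * D j * P) ψ‖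
        ≤ Fintype.card ι * (δ * a * d + a * (ε * c * (e + 1)) + g * d + a * (ε * c)
          + a * d * (ε * p)) * ‖ψ‖ := by
  obtain ⟨φ₀, φ₁, h0, h1, rfl⟩ := mem_graph_add.1 hψ
  have hPψ : ‖P ψ‖ ≤ ‖ψ‖ := (P.le_of_opNorm_le hPn ψ).trans_eq (one_mul _)
  choose ω hω hωn using fun j => hHD j _ _ (hHP ψ)
  obtain ⟨q, hq, hqn⟩ := hhP _ _ h1
  choose u hu hun using fun j => hhD j _ _ hq
  choose s hs hsn using fun j => hhG j _ _ (hu j)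
  have hterm : ∀ j, (G j (D j (P ψ)),
      (EG j (D j (P ψ)) + B j (D j (P ψ)) - (Complex.I * δ) • G j (D j (P ψ))) + s j)
      ∈ (H + h).graph := fun j => mem_graph_add.2 ⟨_, _, hHG j _, hs j, rfl⟩
  refine ⟨∑ j, ((EG j (D j (P ψ)) + B j (D j (P ψ))
    - (Complex.I * δ) • G j (D j (P ψ))) + s j), ?_, ?_⟩
  · have := (H + h).graph.sum_mem (t := Finset.univ) fun j _ => hterm j
    convert this using 1
    rw [Prod.ext_iff, Prod.fst_sum, Prod.snd_sum]
    exact ⟨by simp only [sum_apply]; rfl, rfl⟩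
  · have hbound : ∀ j, ‖-((Complex.I * δ) • G j (D j (P ψ))) + G j (ω j - D j (EP ψ))
        + (s j - G j (u j)) + G j (u j - D j q) + G j (D j (q - P φ₁))‖
        ≤ (δ * a * d + a * (ε * c * (e + 1)) + g * d + a * (ε * c) + a * d * (ε * p)) * ‖ψ‖ := by
      intro j
      have hDP : ‖D j (P ψ)‖ ≤ d * ‖ψ‖ :=
        ((D j).le_of_opNorm_le (hDn j) _).trans (by gcongr)
      have hEP : ‖EP ψ‖ ≤ e * ‖ψ‖ := EP.le_of_opNorm_le hEPn ψ
      have b1 : ‖-((Complex.I * δ) • G j (D j (P ψ)))‖ ≤ δ * (a * (d * ‖ψ‖)) := by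
        rw [norm_neg, norm_smul, norm_mul, Complex.norm_I, one_mul, Complex.norm_real,
          Real.norm_eq_abs, abs_of_nonneg hδ]
        gcongr
        exact ((G j).le_of_opNorm_le (hGn j) _).trans (by gcongr)
      have b2 : ‖G j (ω j - D j (EP ψ))‖ ≤ a * (ε * c * (e * ‖ψ‖ + ‖ψ‖)) := by
        refine ((G j).le_of_opNorm_le (hGn j) _).trans ?_
        rw [norm_sub_rev]
        gcongr
        exact (hωn j).trans (by gcongr)
      have b3 : ‖s j - G j (u j)‖ ≤ g * (d * ‖ψ‖) := (hsn j).trans (by gcongr)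
      have b4 : ‖G j (u j - D j q)‖ ≤ a * (ε * c * ‖ψ‖) := by
        refine ((G j).le_of_opNorm_le (hGn j) _).trans ?_
        rw [norm_sub_rev]
        gcongr
        exact (hun j).trans (by gcongr)
      have b5 : ‖G j (D j (q - P φ₁))‖ ≤ a * (d * (ε * p * ‖ψ‖)) := by
        refine ((G j).le_of_opNorm_le (hGn j) _).trans ?_
        gcongr
        exact ((D j).le_of_opNorm_le (hDn j) _).trans (by gcongr)
      refine (norm_add_le _ _).trans ?_
      refine (add_le_add_left ((norm_add_le _ _).trans (add_le_add_left ((norm_add_le _ _).trans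
        (add_le_add_left (norm_add_le _ _) _)) _)) _).trans ?_
      linarith
    have e1 : ∑ j, ((EG j (D j (P ψ)) + B j (D j (P ψ)) - (Complex.I * δ) • G j (D j (P ψ))) + s j)
        - (∑ j, G j * D j * P) (φ₀ + φ₁) - (∑ j, B j * D j * P) ψ
        = ∑ j, (-((Complex.I * δ) • G j (D j (P ψ))) + G j (ω j - D j (EP ψ))
        + (s j - G j (u j)) + G j (u j - D j q) + G j (D j (q - P φ₁))) := by
      simp only [sum_apply, mul_apply_eq_comp, ← Finset.sum_sub_distrib]
      refine Finset.sum_congr rfl fun j _ => ?_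
      rw [← hGH j _ _ (hω j)]
      simp only [map_add, map_sub, hPH _ _ h0]
      abel
    rw [e1]
    refine (norm_sum_le_of_le _ fun j _ => hbound j).trans_eq ?_
    rw [Finset.sum_const, Finset.card_univ, nsmul_eq_mul]
    ring

end Commutator

/-! ### A form of the Leibniz rule -/

section Leibniz

variable {X V W Z : Type*} [NormedAddCommGroup X] [NormedSpace ℝ X] [NormedAddCommGroup V]
  [NormedSpace ℝ V] [NormedAddCommGroup W] [NormedSpace ℝ W] [NormedAddCommGroup Z]
  [NormedSpace ℝ Z]

/-- Leibniz' rule for `B (f, g)`, solved for the term in which all derivatives fall on `g`. It is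
the usual bound for the derivatives of a product, applied to `B (f - f x, g)`: at the point `x`
the term without a derivative on `f - f x` vanishes. -/
theorem norm_bilinear_iteratedFDeriv_le (B : V →L[ℝ] W →L[ℝ] Z) (hB : ‖B‖ ≤ 1) {f : X → V}
    {g : X → W} {m j : ℕ} (hf : ContDiff ℝ m f) (hg : ContDiff ℝ m g) (hj : j ≤ m) (x : X)
    {β κ γ : ℝ} (hβ : ‖iteratedFDeriv ℝ j (fun y => B (f y) (g y)) x‖ ≤ β)
    (hκ : ∀ i, 1 ≤ i → i ≤ j → ‖iteratedFDeriv ℝ i f x‖ ≤ κ) (hκ0 : 0 ≤ κ) (hγ0 : 0 ≤ γ)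
    (hγ : ∀ i < j, ‖iteratedFDeriv ℝ i g x‖ ≤ γ) (v : Fin j → X) :
    ‖B (f x) (iteratedFDeriv ℝ j g x v)‖ ≤ (β + 2 ^ j * (κ * γ)) * ∏ i, ‖v i‖ := by
  have hjm : (j : WithTop ℕ∞) ≤ (m : WithTop ℕ∞) := by exact_mod_cast hj
  have hf' : ContDiff ℝ m fun y => f y - f x := hf.sub contDiff_const
  have hBf : ContDiff ℝ m fun y => B (f y) (g y) :=
    B.isBoundedBilinearMap.contDiff.comp (hf.prodMk hg)
  have hBf' : ContDiff ℝ m fun y => B (f y - f x) (g y) :=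
    B.isBoundedBilinearMap.contDiff.comp (hf'.prodMk hg)
  have e1 : (B (f x)).compContinuousMultilinearMap (iteratedFDeriv ℝ j g x)
      = iteratedFDeriv ℝ j (fun y => B (f y) (g y)) x
        - iteratedFDeriv ℝ j (fun y => B (f y - f x) (g y)) x := by
    rw [← (B (f x)).iteratedFDeriv_comp_left hg.contDiffAt hjm,
      ← iteratedFDeriv_sub_apply (hBf.of_le hjm).contDiffAt (hBf'.of_le hjm).contDiffAt]
    congr 1
    funext y
    simp
  have e2 := B.norm_iteratedFDeriv_le_of_bilinear_of_le_one hf' hg x hjm hB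
  have e3 : ∑ i ∈ Finset.range (j + 1), (j.choose i : ℝ)
      * ‖iteratedFDeriv ℝ i (fun y => f y - f x) x‖ * ‖iteratedFDeriv ℝ (j - i) g x‖
      ≤ ∑ i ∈ Finset.range (j + 1), (j.choose i : ℝ) * (κ * γ) := by
    refine Finset.sum_le_sum fun i hi => ?_
    rw [mul_assoc]
    refine mul_le_mul_of_nonneg_left ?_ (by positivity)
    rcases Nat.eq_zero_or_pos i with rfl | hi0
    · rw [norm_iteratedFDeriv_zero, sub_self, norm_zero, zero_mul]
      positivity
    · have hij : i ≤ j := Nat.lt_succ_iff.1 (Finset.mem_range.1 hi)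
      have him : (i : WithTop ℕ∞) ≤ (m : WithTop ℕ∞) := by exact_mod_cast hij.trans hj
      have e4 : iteratedFDeriv ℝ i (fun y => f y - f x) x = iteratedFDeriv ℝ i f x := by
        have := iteratedFDeriv_sub_apply (hf.of_le him).contDiffAt
          (contDiff_const (c := f x) (n := i) (𝕜 := ℝ) (E := X)).contDiffAt (x := x)
        rw [iteratedFDeriv_const_of_ne (by omega), Pi.zero_apply, sub_zero] at this
        exact this
      rw [e4]
      exact mul_le_mul (hκ i hi0 hij) (hγ _ (by omega)) (norm_nonneg _) hκ0
  have e5 : ∑ i ∈ Finset.range (j + 1), (j.choose i : ℝ) * (κ * γ) = 2 ^ j * (κ * γ) := by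
    rw [← Finset.sum_mul]
    congr 1
    exact_mod_cast Nat.sum_range_choose j
  have e6 : ‖(B (f x)).compContinuousMultilinearMap (iteratedFDeriv ℝ j g x)‖
      ≤ β + 2 ^ j * (κ * γ) := by
    rw [e1]
    exact (norm_sub_le _ _).trans (add_le_add hβ (e2.trans (e3.trans_eq e5)))
  exact ContinuousMultilinearMap.le_of_opNorm_le e6 v

end Leibniz

/-! ### Derivatives of solutions of a linear equation -/

section Resolvent

variable {X 𝒟 F : Type*} [NormedAddCommGroup X] [NormedSpace ℝ X] [NormedAddCommGroup 𝒟]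
  [NormedSpace ℂ 𝒟] [NormedAddCommGroup F] [NormedSpace ℂ F]

/-- One differentiation step for the solution `g` of `(f₀ + i δ) g = b`: the `j`-th derivative is
controlled by the lower ones, in the weak norm with a loss of `δ⁻¹`, in the strong norm without
further loss. -/
theorem norm_iteratedFDeriv_solution_le {ι : 𝒟 →L[ℂ] F} {f₀ : X → 𝒟 →L[ℂ] F}
    {b : X → F →L[ℂ] F} {g : X → F →L[ℂ] 𝒟} {m j : ℕ} {δ β κ c γ : ℝ} (hδ : 0 < δ) (hδ1 : δ ≤ 1)
    (hf₀ : ContDiff ℝ m f₀) (hκ : ∀ i ≤ m, 1 ≤ i → ∀ x, ‖iteratedFDeriv ℝ i f₀ x‖ ≤ κ)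
    (hκ0 : 0 ≤ κ) (hβ0 : 0 ≤ β) (hc : 0 ≤ c)
    (hgraph : ∀ x w, ‖w‖ ≤ c * (‖f₀ x w‖ + ‖ι w‖))
    (hlow : ∀ x w, δ * ‖ι w‖ ≤ ‖f₀ x w + (Complex.I * δ) • ι w‖)
    (hβ : ∀ i ≤ m, ∀ x, ‖iteratedFDeriv ℝ i b x‖ ≤ β)
    (hg : ContDiff ℝ m g) (heq : ∀ x, (f₀ x + (Complex.I * δ) • ι) ∘L g x = b x)
    (hj : j ≤ m) (x : X) (hγ0 : 0 ≤ γ) (hγ : ∀ i < j, ‖iteratedFDeriv ℝ i g x‖ ≤ γ) :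
    ‖iteratedFDeriv ℝ j (fun y => ι ∘L g y) x‖ ≤ δ⁻¹ * (β + 2 ^ j * (κ * γ)) ∧
    ‖iteratedFDeriv ℝ j g x‖ ≤
      c * ((β + 2 ^ j * (κ * γ)) + 2 * ‖iteratedFDeriv ℝ j (fun y => ι ∘L g y) x‖) := by
  have hjm : (j : WithTop ℕ∞) ≤ (m : WithTop ℕ∞) := by exact_mod_cast hj
  set N := β + 2 ^ j * (κ * γ)
  have hN : 0 ≤ N := by positivity
  let B : (𝒟 →L[ℂ] F) →L[ℝ] (F →L[ℂ] 𝒟) →L[ℝ] (F →L[ℂ] F) :=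
    (ContinuousLinearMap.compL ℂ F 𝒟 F).bilinearRestrictScalars ℝ
  let f : X → 𝒟 →L[ℂ] F := fun x => f₀ x + (Complex.I * δ) • ι
  have hf : ContDiff ℝ m f := hf₀.add contDiff_const
  have hfκ : ∀ i, 1 ≤ i → i ≤ j → ‖iteratedFDeriv ℝ i f x‖ ≤ κ := by
    intro i h1 h2
    have him : (i : WithTop ℕ∞) ≤ (m : WithTop ℕ∞) := by exact_mod_cast h2.trans hj
    have e4 : iteratedFDeriv ℝ i f x = iteratedFDeriv ℝ i f₀ x := by
      have := iteratedFDeriv_add_apply (hf₀.of_le him).contDiffAt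
        (contDiff_const (c := (Complex.I * δ) • ι) (n := i) (𝕜 := ℝ) (E := X)).contDiffAt (x := x)
      rw [iteratedFDeriv_const_of_ne (by omega), Pi.zero_apply, add_zero] at this
      exact this
    rw [e4]
    exact hκ i (h2.trans hj) h1 x
  have hstep : ∀ v : Fin j → X, ‖f x ∘L iteratedFDeriv ℝ j g x v‖ ≤ N * ∏ i, ‖v i‖ := by
    have hfun : (fun y => B (f y) (g y)) = b := funext fun y => heq y
    exact norm_bilinear_iteratedFDeriv_le B
      ((ContinuousLinearMap.norm_bilinearRestrictScalars ..).trans_le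
        (ContinuousLinearMap.norm_compL_le ..)) hf hg hj x (by rw [hfun]; exact hβ j hj x) hfκ
      hκ0 hγ0 hγ
  let L : (F →L[ℂ] 𝒟) →L[ℝ] (F →L[ℂ] F) := B ι
  have hι : iteratedFDeriv ℝ j (fun y => ι ∘L g y) x
      = L.compContinuousMultilinearMap (iteratedFDeriv ℝ j g x) :=
    L.iteratedFDeriv_comp_left hg.contDiffAt hjm
  have hιv : ∀ v, iteratedFDeriv ℝ j (fun y => ι ∘L g y) x v = ι ∘L iteratedFDeriv ℝ j g x v :=
    fun v => by rw [hι]; rfl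
  refine ⟨ContinuousMultilinearMap.opNorm_le_bound (by positivity) fun v => ?_,
    ContinuousMultilinearMap.opNorm_le_bound (by positivity) fun v => ?_⟩
  · rw [hιv]
    refine ContinuousLinearMap.opNorm_le_bound _ (by positivity) fun ψ => ?_
    set w := iteratedFDeriv ℝ j g x v ψ
    have h1 := hlow x w
    have h2 := (f x ∘L iteratedFDeriv ℝ j g x v).le_of_opNorm_le (hstep v) ψ
    change ‖f₀ x w + (Complex.I * δ) • ι w‖ ≤ _ at h2
    change ‖ι w‖ ≤ _
    rw [mul_assoc, mul_assoc, le_inv_mul_iff₀ hδ, ← mul_assoc]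
    exact h1.trans h2
  · refine ContinuousLinearMap.opNorm_le_bound _ (by positivity) fun ψ => ?_
    set w := iteratedFDeriv ℝ j g x v ψ
    have h2 := (f x ∘L iteratedFDeriv ℝ j g x v).le_of_opNorm_le (hstep v) ψ
    change ‖f₀ x w + (Complex.I * δ) • ι w‖ ≤ _ at h2
    have h3 : ‖ι w‖ ≤ ‖iteratedFDeriv ℝ j (fun y => ι ∘L g y) x‖ * (∏ i, ‖v i‖) * ‖ψ‖ := by
      have := (iteratedFDeriv ℝ j (fun y => ι ∘L g y) x v).le_of_opNorm_le
        ((iteratedFDeriv ℝ j (fun y => ι ∘L g y) x).le_opNorm v) ψ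
      rw [hιv] at this
      exact this
    have h4 : ‖f₀ x w‖ ≤ ‖f₀ x w + (Complex.I * δ) • ι w‖ + ‖ι w‖ := by
      have e : f₀ x w = (f₀ x w + (Complex.I * δ) • ι w) - (Complex.I * δ) • ι w := by abel
      have e2 : ‖(Complex.I * (δ : ℂ)) • ι w‖ ≤ ‖ι w‖ := by
        rw [norm_smul, norm_mul, Complex.norm_I, one_mul, Complex.norm_real, Real.norm_eq_abs,
          abs_of_pos hδ]
        exact mul_le_of_le_one_left (norm_nonneg _) hδ1
      calc ‖f₀ x w‖ = _ := by rw [← e]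
        _ ≤ _ := (norm_sub_le _ _).trans (by gcongr)
    refine (hgraph x w).trans ?_
    rw [mul_assoc, mul_assoc]
    gcongr
    linarith

/-- Bounds for the derivatives of the solution `g` of `(f₀ + i δ) g = b`, uniformly in `δ`. Each
derivative beyond the first costs one factor `δ⁻¹`; the bounds `a` on `g` and `a'` on its first
derivative are data. -/
theorem exists_solution_deriv_bounds {ι : 𝒟 →L[ℂ] F} {f₀ : X → 𝒟 →L[ℂ] F} {m : ℕ} {β κ c : ℝ}
    (hf₀ : ContDiff ℝ m f₀) (hκ : ∀ i ≤ m, 1 ≤ i → ∀ x, ‖iteratedFDeriv ℝ i f₀ x‖ ≤ κ)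
    (hκ0 : 0 ≤ κ) (hβ0 : 0 ≤ β) (hc : 0 ≤ c)
    (hgraph : ∀ x w, ‖w‖ ≤ c * (‖f₀ x w‖ + ‖ι w‖))
    (hlow : ∀ δ : ℝ, 0 < δ → ∀ x w, δ * ‖ι w‖ ≤ ‖f₀ x w + (Complex.I * δ) • ι w‖) (hm : 1 ≤ m) :
    ∃ C : ℝ, 0 ≤ C ∧ ∀ (b : X → F →L[ℂ] F) (g : X → F →L[ℂ] 𝒟) (δ a : ℝ), 0 < δ → δ ≤ 1 → 0 ≤ a →
      (∀ i ≤ m, ∀ x, ‖iteratedFDeriv ℝ i b x‖ ≤ β) → ContDiff ℝ m g →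
      (∀ x, (f₀ x + (Complex.I * δ) • ι) ∘L g x = b x) → (∀ x, ‖ι ∘L g x‖ ≤ a) →
      (∀ x, ‖iteratedFDeriv ℝ 1 (fun y => ι ∘L g y) x‖ ≤ C * δ⁻¹ * (1 + a)) ∧
      ∀ a' : ℝ, (∀ x, ‖iteratedFDeriv ℝ 1 (fun y => ι ∘L g y) x‖ ≤ a') →
        ∀ j ≤ m, ∀ x, ‖iteratedFDeriv ℝ j g x‖ ≤ C * δ⁻¹ ^ (j - 1) * (1 + a + a') := by
  have hzero : ∀ (b : X → F →L[ℂ] F) (g : X → F →L[ℂ] 𝒟) (δ a : ℝ), 0 < δ → δ ≤ 1 → 0 ≤ a →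
      (∀ i ≤ m, ∀ x, ‖iteratedFDeriv ℝ i b x‖ ≤ β) → ContDiff ℝ m g →
      (∀ x, (f₀ x + (Complex.I * δ) • ι) ∘L g x = b x) → (∀ x, ‖ι ∘L g x‖ ≤ a) →
      ∀ x, ‖iteratedFDeriv ℝ 0 g x‖ ≤ c * (β + 2) * (1 + a) := by
    intro b g δ a hδ hδ1 ha hb hg heq hga x
    have h := (norm_iteratedFDeriv_solution_le (γ := 0) hδ hδ1 hf₀ hκ hκ0 hβ0 hc hgraph (hlow δ hδ)
      hb hg heq (Nat.zero_le m) x le_rfl (fun i hi => absurd hi (Nat.not_lt_zero i))).2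
    rw [norm_iteratedFDeriv_zero (f := fun y => ι ∘L g y)] at h
    refine h.trans ?_
    rw [mul_assoc]
    refine mul_le_mul_of_nonneg_left ?_ hc
    nlinarith [hga x, mul_nonneg hβ0 ha]
  have hall : ∀ j ≤ m, ∃ C : ℝ, 0 ≤ C ∧ ∀ (b : X → F →L[ℂ] F) (g : X → F →L[ℂ] 𝒟) (δ a : ℝ),
      0 < δ → δ ≤ 1 → 0 ≤ a →
      (∀ i ≤ m, ∀ x, ‖iteratedFDeriv ℝ i b x‖ ≤ β) → ContDiff ℝ m g →
      (∀ x, (f₀ x + (Complex.I * δ) • ι) ∘L g x = b x) → (∀ x, ‖ι ∘L g x‖ ≤ a) →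
      ∀ a' : ℝ, (∀ x, ‖iteratedFDeriv ℝ 1 (fun y => ι ∘L g y) x‖ ≤ a') →
        ∀ x, ‖iteratedFDeriv ℝ j g x‖ ≤ C * δ⁻¹ ^ (j - 1) * (1 + a + a') := by
    intro j
    induction j using Nat.strong_induction_on with
    | _ j ih =>
      intro hj
      choose! C hC0 hC using fun i (hi : i < j) => ih i hi (hi.le.trans hj)
      rcases Nat.eq_zero_or_pos j with rfl | hj0
      · refine ⟨c * (β + 2), by positivity, fun b g δ a hδ hδ1 ha hb hg heq hga a' ha' x => ?_⟩
        have h1 : 0 ≤ a' := (norm_nonneg _).trans (ha' x)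
        refine (hzero b g δ a hδ hδ1 ha hb hg heq hga x).trans ?_
        simp only [Nat.zero_sub, pow_zero, mul_one]
        exact mul_le_mul_of_nonneg_left (by linarith) (by positivity)
      · set S := ∑ i ∈ Finset.range j, C i
        have hS0 : 0 ≤ S := Finset.sum_nonneg fun i hi => hC0 i (Finset.mem_range.1 hi)
        have hSi : ∀ i < j, C i ≤ S := fun i hi =>
          Finset.single_le_sum (f := C) (fun i hi => hC0 i (Finset.mem_range.1 hi))
            (Finset.mem_range.2 hi)
        refine ⟨3 * c * (β + 2 ^ j * (κ * S)) + 2 * c, by positivity,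
          fun b g δ a hδ hδ1 ha hb hg heq hga a' ha' x => ?_⟩
        have hδi : 1 ≤ δ⁻¹ := (one_le_inv₀ hδ).2 hδ1
        have h1 : 0 ≤ a' := (norm_nonneg _).trans (ha' x)
        have hA : 1 ≤ 1 + a + a' := by linarith
        have hγ : ∀ i < j, ‖iteratedFDeriv ℝ i g x‖ ≤ S * δ⁻¹ ^ (j - 1 - 1) * (1 + a + a') := by
          intro i hi
          refine (hC i hi b g δ a hδ hδ1 ha hb hg heq hga a' ha' x).trans ?_
          gcongr
          · exact hSi i hi
          · omega
        obtain ⟨k1, k2⟩ := norm_iteratedFDeriv_solution_le hδ hδ1 hf₀ hκ hκ0 hβ0 hc hgraph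
          (hlow δ hδ) hb hg heq hj x (by positivity) hγ
        set M := 1 + a + a'
        set p := δ⁻¹ ^ (j - 1 - 1)
        have hp1 : 1 ≤ p := one_le_pow₀ hδi
        have hN : β + 2 ^ j * (κ * (S * p * M)) ≤ (β + 2 ^ j * (κ * S)) * p * M := by
          have hpM : 1 ≤ p * M := one_le_mul_of_one_le_of_one_le hp1 hA
          have := mul_le_mul_of_nonneg_left hpM hβ0
          linarith
        -- For `j = 1` the weak norm is bounded by `a'`, for `j ≥ 2` by the equation.
        have hweak : ‖iteratedFDeriv ℝ j (fun y => ι ∘L g y) x‖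
            ≤ (β + 2 ^ j * (κ * S) + 1) * δ⁻¹ ^ (j - 1) * M := by
          rcases Nat.lt_or_ge j 2 with hj2 | hj2
          · obtain rfl : j = 1 := by omega
            refine (ha' x).trans ?_
            simp only [Nat.sub_self, pow_zero, mul_one]
            have h2 : 1 * M ≤ (β + 2 ^ 1 * (κ * S) + 1) * M := by
              gcongr
              have : 0 ≤ 2 ^ 1 * (κ * S) := by positivity
              linarith
            linarith
          · have hpow : δ⁻¹ ^ (j - 1) = δ⁻¹ * p := by
              rw [← pow_succ']; congr 1; omega
            refine k1.trans ?_
            rw [hpow]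
            calc δ⁻¹ * (β + 2 ^ j * (κ * (S * p * M)))
                ≤ δ⁻¹ * ((β + 2 ^ j * (κ * S)) * p * M) := by gcongr
              _ = (β + 2 ^ j * (κ * S)) * (δ⁻¹ * p) * M := by ring
              _ ≤ (β + 2 ^ j * (κ * S) + 1) * (δ⁻¹ * p) * M := by
                have : 0 ≤ δ⁻¹ * p * M := by positivity
                linarith
        have hp2 : p ≤ δ⁻¹ ^ (j - 1) := pow_le_pow_right₀ hδi (by omega)
        refine k2.trans ?_
        calc c * ((β + 2 ^ j * (κ * (S * p * M)))
              + 2 * ‖iteratedFDeriv ℝ j (fun y => ι ∘L g y) x‖)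
            ≤ c * ((β + 2 ^ j * (κ * S)) * δ⁻¹ ^ (j - 1) * M
              + 2 * ((β + 2 ^ j * (κ * S) + 1) * δ⁻¹ ^ (j - 1) * M)) := by
              gcongr
              exact hN.trans (by gcongr)
          _ = _ := by ring
  choose! C hC0 hC using hall
  have hS0 : 0 ≤ ∑ i ∈ Finset.range (m + 1), C i :=
    Finset.sum_nonneg fun i hi => hC0 i (Nat.lt_succ_iff.1 (Finset.mem_range.1 hi))
  refine ⟨(∑ i ∈ Finset.range (m + 1), C i) + (β + 2 * (κ * (c * (β + 2)))), by positivity,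
    fun b g δ a hδ hδ1 ha hb hg heq hga => ⟨fun x => ?_, fun a' ha' j hj x => ?_⟩⟩
  · have h0 := hzero b g δ a hδ hδ1 ha hb hg heq hga x
    have h1 := (norm_iteratedFDeriv_solution_le (j := 1) (γ := c * (β + 2) * (1 + a)) hδ hδ1 hf₀ hκ
      hκ0 hβ0 hc hgraph (hlow δ hδ) hb hg heq hm x (by positivity) (fun i hi => by
        obtain rfl : i = 0 := by omega
        exact h0)).1
    refine h1.trans ?_
    have hd : 0 < δ⁻¹ := inv_pos.2 hδ
    rw [mul_comm _ δ⁻¹, mul_assoc δ⁻¹]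
    refine mul_le_mul_of_nonneg_left ?_ hd.le
    have h2 := mul_nonneg hS0 (by linarith : 0 ≤ 1 + a)
    have h3 := mul_nonneg hβ0 ha
    rw [pow_one]
    linarith
  · have hδi : 0 < δ⁻¹ := inv_pos.2 hδ
    have h1 : 0 ≤ a' := (norm_nonneg _).trans (ha' x)
    refine (hC j hj b g δ a hδ hδ1 ha hb hg heq hga a' ha' x).trans ?_
    gcongr
    have h2 := Finset.single_le_sum (f := C)
      (fun i hi => hC0 i (Nat.lt_succ_iff.1 (Finset.mem_range.1 hi)))
      (Finset.mem_range.2 (Nat.lt_succ_of_le hj))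
    have h3 : 0 ≤ β + 2 * (κ * (c * (β + 2))) := by positivity
    linarith

end Resolvent

/-! ### Functions with bounded derivatives -/

section BoundedDerivatives

variable {n : ℕ} {V W Z : Type*} [NormedAddCommGroup V] [NormedSpace ℝ V] [NormedAddCommGroup W]
  [NormedSpace ℝ W] [NormedAddCommGroup Z] [NormedSpace ℝ Z]

theorem norm_basisVec (j : Fin n) : ‖basisVec j‖ = 1 := by
  simp [basisVec]

theorem sum_smul_basisVec (v : Base n) : ∑ i, v i • basisVec i = v := by
  have h := (EuclideanSpace.basisFun (Fin n) ℝ).sum_repr v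
  simpa [basisVec, EuclideanSpace.basisFun_apply] using h

theorem norm_iteratedFDeriv_le_of_partialDeriv {k : ℕ} (f : Base n → V) (x : Base n) {C : ℝ}
    (hC0 : 0 ≤ C) (hC : ∀ a : Fin k → Fin n, ‖partialDeriv f a x‖ ≤ C) :
    ‖iteratedFDeriv ℝ k f x‖ ≤ (n : ℝ) ^ k * C := by
  refine ContinuousMultilinearMap.opNorm_le_bound (by positivity) fun v => ?_
  have hv : v = fun i => ∑ j, v i j • basisVec j := funext fun i => (sum_smul_basisVec (v i)).symm
  conv_lhs => rw [hv]
  rw [ContinuousMultilinearMap.map_sum]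
  have hterm : ∀ a : Fin k → Fin n,
      ‖iteratedFDeriv ℝ k f x fun i => v i (a i) • basisVec (a i)‖ ≤ C * ∏ i, ‖v i‖ := by
    intro a
    rw [ContinuousMultilinearMap.map_smul_univ, norm_smul, norm_prod, mul_comm]
    refine mul_le_mul (hC a) (Finset.prod_le_prod (fun _ _ => norm_nonneg _) fun i _ => ?_)
      (Finset.prod_nonneg fun _ _ => norm_nonneg _) hC0
    exact PiLp.norm_apply_le (v i) (a i)
  refine (norm_sum_le_of_le _ fun a _ => hterm a).trans_eq ?_
  rw [Finset.sum_const, Finset.card_univ, Fintype.card_fun, Fintype.card_fin, Fintype.card_fin,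
    nsmul_eq_mul, Nat.cast_pow, mul_assoc]

theorem norm_iteratedFDeriv_one_le_of_partialFst (f : Base n → V) (x : Base n) {C : ℝ}
    (hC0 : 0 ≤ C) (hC : ∀ j, ‖partialFst f j x‖ ≤ C) : ‖iteratedFDeriv ℝ 1 f x‖ ≤ n * C := by
  have h := norm_iteratedFDeriv_le_of_partialDeriv (k := 1) f x hC0 fun a => by
    rw [partialDeriv, iteratedFDeriv_one_apply]
    exact hC (a 0)
  rwa [pow_one] at h

theorem norm_partialDeriv_le {k : ℕ} (f : Base n → V) (a : Fin k → Fin n) (x : Base n) :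
    ‖partialDeriv f a x‖ ≤ ‖iteratedFDeriv ℝ k f x‖ := by
  have h := (iteratedFDeriv ℝ k f x).le_opNorm fun i => basisVec (a i)
  simp only [norm_basisVec, Finset.prod_const_one, mul_one] at h
  exact h

theorem norm_partialFst_le (f : Base n → V) (j : Fin n) (x : Base n) :
    ‖partialFst f j x‖ ≤ ‖iteratedFDeriv ℝ 1 f x‖ := by
  have h := (fderiv ℝ f x).le_opNorm (basisVec j)
  rwa [norm_basisVec, mul_one, ← norm_iteratedFDeriv_one] at h

theorem supPartial_le {k : ℕ} {f : Base n → V} {C : ℝ} (hC0 : 0 ≤ C)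
    (hC : ∀ x, ‖iteratedFDeriv ℝ k f x‖ ≤ C) : supPartial k f ≤ C :=
  Real.iSup_le (fun p => (norm_partialDeriv_le f p.1 p.2).trans (hC p.2)) hC0

theorem IsCb.exists_bound {k : ℕ} {f : Base n → V} (hf : IsCb k f) :
    ∃ C : ℝ, 0 ≤ C ∧ ∀ j ≤ k, ∀ x, ‖iteratedFDeriv ℝ j f x‖ ≤ C := by
  have h1 : ∀ j ≤ k, ∃ C : ℝ, 0 ≤ C ∧ ∀ x, ‖iteratedFDeriv ℝ j f x‖ ≤ C := by
    intro j hj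
    choose C hC using hf.2 j hj
    have hS : 0 ≤ ∑ a, |C a| := Finset.sum_nonneg fun a _ => abs_nonneg _
    refine ⟨(n : ℝ) ^ j * ∑ a, |C a|, by positivity, fun x => ?_⟩
    refine norm_iteratedFDeriv_le_of_partialDeriv f x hS fun a => ?_
    exact (hC a x).trans ((le_abs_self _).trans
      (Finset.single_le_sum (f := fun a => |C a|) (fun a _ => abs_nonneg _) (Finset.mem_univ a)))
  choose! C hC0 hC using h1
  refine ⟨∑ j ∈ Finset.range (k + 1), C j,
    Finset.sum_nonneg fun j hj => hC0 j (Nat.lt_succ_iff.1 (Finset.mem_range.1 hj)),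
    fun j hj x => (hC j hj x).trans ?_⟩
  exact Finset.single_le_sum (f := C)
    (fun j hj => hC0 j (Nat.lt_succ_iff.1 (Finset.mem_range.1 hj)))
    (Finset.mem_range.2 (Nat.lt_succ_of_le hj))

theorem isCb_of_bound {k : ℕ} {f : Base n → V} (hf : ContDiff ℝ k f)
    (h : ∀ j ≤ k, ∃ C : ℝ, ∀ x, ‖iteratedFDeriv ℝ j f x‖ ≤ C) : IsCb k f := by
  refine ⟨hf, fun j hj a => ?_⟩
  obtain ⟨C, hC⟩ := h j hj
  exact ⟨C, fun x => (norm_partialDeriv_le f a x).trans (hC x)⟩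

theorem IsCb.of_le {k l : ℕ} {f : Base n → V} (hf : IsCb l f) (h : k ≤ l) : IsCb k f :=
  ⟨hf.1.of_le (by exact_mod_cast h), fun j hj => hf.2 j (hj.trans h)⟩

theorem IsCb.sub {k : ℕ} {f g : Base n → V} (hf : IsCb k f) (hg : IsCb k g) :
    IsCb k fun x => f x - g x := by
  obtain ⟨C₁, -, h₁⟩ := hf.exists_bound
  obtain ⟨C₂, -, h₂⟩ := hg.exists_bound
  refine isCb_of_bound (hf.1.sub hg.1) fun j hj => ⟨C₁ + C₂, fun x => ?_⟩
  have hjk : (j : WithTop ℕ∞) ≤ k := by exact_mod_cast hj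
  have e := iteratedFDeriv_sub_apply (hf.1.of_le hjk).contDiffAt (hg.1.of_le hjk).contDiffAt
    (x := x)
  change ‖iteratedFDeriv ℝ j (f - g) x‖ ≤ _
  rw [e]
  exact (norm_sub_le _ _).trans (add_le_add (h₁ j hj x) (h₂ j hj x))

theorem IsCb.clm_comp {k : ℕ} {f : Base n → V} (L : V →L[ℝ] W) (hf : IsCb k f) :
    IsCb k fun x => L (f x) := by
  obtain ⟨C, -, h⟩ := hf.exists_bound
  refine isCb_of_bound (L.contDiff.comp hf.1) fun j hj => ⟨‖L‖ * C, fun x => ?_⟩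
  have hjk : (j : WithTop ℕ∞) ≤ k := by exact_mod_cast hj
  exact (L.norm_iteratedFDeriv_comp_left hf.1.contDiffAt hjk).trans (by gcongr; exact h j hj x)

theorem IsCb.bilinear {k : ℕ} {f : Base n → V} {g : Base n → W} (B : V →L[ℝ] W →L[ℝ] Z)
    (hf : IsCb k f) (hg : IsCb k g) : IsCb k fun x => B (f x) (g x) := by
  obtain ⟨C₁, h₁0, h₁⟩ := hf.exists_bound
  obtain ⟨C₂, h₂0, h₂⟩ := hg.exists_bound
  refine isCb_of_bound (B.isBoundedBilinearMap.contDiff.comp (hf.1.prodMk hg.1)) fun j hj =>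
    ⟨‖B‖ * ∑ i ∈ Finset.range (j + 1), (j.choose i : ℝ) * C₁ * C₂, fun x => ?_⟩
  have hjk : (j : WithTop ℕ∞) ≤ k := by exact_mod_cast hj
  refine (B.norm_iteratedFDeriv_le_of_bilinear hf.1 hg.1 x hjk).trans ?_
  gcongr with i hi
  · exact h₁ i ((Nat.lt_succ_iff.1 (Finset.mem_range.1 hi)).trans hj) x
  · exact h₂ _ ((Nat.sub_le _ _).trans hj) x

theorem IsCb.partialFst {k : ℕ} {f : Base n → V} (hf : IsCb (k + 1) f) (j : Fin n) :
    IsCb k (partialFst f j) := by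
  have h1 : IsCb k (fderiv ℝ f) := by
    obtain ⟨C, -, h⟩ := hf.exists_bound
    refine isCb_of_bound (hf.1.fderiv_right (by norm_cast)) fun i hi => ⟨C, fun x => ?_⟩
    rw [norm_iteratedFDeriv_fderiv]
    exact h _ (by omega) x
  exact h1.clm_comp (ContinuousLinearMap.apply ℝ V (basisVec j))

end BoundedDerivatives

/-! ### Fibered operators -/

section Fibered

variable {n : ℕ} {F : Type*} [NormedAddCommGroup F] [InnerProductSpace ℂ F]

theorem IsCb.mul {k : ℕ} {A B : Base n → F →L[ℂ] F} (hA : IsCb k A) (hB : IsCb k B) :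
    IsCb k fun x => A x * B x :=
  hA.bilinear ((ContinuousLinearMap.compL ℂ F F F).bilinearRestrictScalars ℝ) hB

theorem norm_fibered_le {A : Base n → F →L[ℂ] F} {c : ℝ} (hc : 0 ≤ c) (h : ∀ x, ‖A x‖ ≤ c) :
    ‖(fibered A : L2 n F →L[ℂ] L2 n F)‖ ≤ c := by
  by_cases hA : MemLp A ∞ (volume : Measure (Base n))
  · refine ContinuousLinearMap.opNorm_le_bound _ hc fun ψ => ?_
    refine Lp.norm_le_mul_norm_of_ae_le_mul ?_
    filter_upwards [fibered_apply hA ψ] with x hx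
    rw [hx]
    exact (A x).le_of_opNorm_le (h x) _
  · rw [fibered, dif_neg hA]
    refine ContinuousLinearMap.opNorm_le_bound _ hc fun ψ => ?_
    rw [zero_apply, norm_zero]
    positivity

theorem fibered_eq_of_ae {A : Base n → F →L[ℂ] F} (hA : MemLp A ∞ (volume : Measure (Base n)))
    {ψ φ : L2 n F} (h : ∀ᵐ x, (φ : Base n → F) x = A x ((ψ : Base n → F) x)) :
    fibered A ψ = φ := by
  apply Lp.ext
  filter_upwards [fibered_apply hA ψ, h] with x h1 h2
  rw [h1, h2]

theorem fibered_mul {A B C : Base n → F →L[ℂ] F} (hA : MemLp A ∞ (volume : Measure (Base n)))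
    (hB : MemLp B ∞ (volume : Measure (Base n))) (hC : MemLp C ∞ (volume : Measure (Base n)))
    (h : ∀ x, C x = A x * B x) : (fibered C : L2 n F →L[ℂ] L2 n F) = fibered A * fibered B := by
  ext1 ψ
  refine fibered_eq_of_ae hC ?_
  rw [mul_apply_eq_comp]
  filter_upwards [fibered_apply hA (fibered B ψ), fibered_apply hB ψ] with x h1 h2
  rw [h1, h2, h, mul_apply_eq_comp]

theorem fibered_sub_mul {A P : Base n → F →L[ℂ] F} (hA : MemLp A ∞ (volume : Measure (Base n)))
    (hP : MemLp P ∞ (volume : Measure (Base n))) {B : Base n → F →L[ℂ] F}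
    (hB : MemLp B ∞ (volume : Measure (Base n))) (h : ∀ x, B x = (1 - P x) * A x) :
    (fibered B : L2 n F →L[ℂ] L2 n F) = (1 - fibered P) * fibered A := by
  ext1 ψ
  refine fibered_eq_of_ae hB ?_
  rw [mul_apply_eq_comp, sub_apply, one_apply_eq_self]
  filter_upwards [Lp.coeFn_sub (fibered A ψ) (fibered P (fibered A ψ)),
    fibered_apply hP (fibered A ψ), fibered_apply hA ψ] with x h1 h2 h3
  rw [h1, Pi.sub_apply, h2, h3, h]
  rfl

theorem mem_graph_directIntegral {T : Base n → F →ₗ.[ℂ] F} {ψ φ : L2 n F} :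
    (ψ, φ) ∈ (directIntegral T).graph ↔
      ∀ᵐ x, ((ψ : Base n → F) x, (φ : Base n → F) x) ∈ (T x).graph := by
  rw [directIntegral_graph]
  rfl

variable [CompleteSpace F]

theorem isStarProjection_fibered {P : Base n → F →L[ℂ] F}
    (hP : MemLp P ∞ (volume : Measure (Base n))) (h : ∀ x, IsStarProjection (P x)) :
    IsStarProjection (fibered P : L2 n F →L[ℂ] L2 n F) := by
  refine ⟨?_, ?_⟩
  · exact (fibered_mul hP hP hP fun x => (h x).isIdempotentElem.eq.symm).symm
  · rw [ContinuousLinearMap.isSelfAdjoint_iff_isSymmetric]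
    intro ψ φ
    change ⟪fibered P ψ, φ⟫_ℂ = ⟪ψ, fibered P φ⟫_ℂ
    rw [L2.inner_def, L2.inner_def]
    refine integral_congr_ae ?_
    filter_upwards [fibered_apply hP ψ, fibered_apply hP φ] with x h1 h2
    rw [h1, h2]
    exact (ContinuousLinearMap.isSelfAdjoint_iff_isSymmetric.1 (h x).isSelfAdjoint) _ _

end Fibered

/-! ### The domain with the graph norm -/

section GraphDomain

variable {K : Type*} [NormedAddCommGroup K] [InnerProductSpace ℂ K]

/-- The bounded inclusion of the domain of `T`, with the graph norm, into the whole space. -/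
noncomputable def graphInclusion (T : K →ₗ.[ℂ] K) : GraphDomain T →L[ℂ] K :=
  LinearMap.mkContinuous (show GraphDomain T →ₗ[ℂ] K from T.domain.subtype) 1 fun ψ => by
    rw [one_mul]
    have h := graphDomain_norm T ψ
    change ‖((show T.domain from ψ) : K)‖ ≤ ‖ψ‖
    change ‖ψ‖ = _ at h
    rw [h]
    exact le_add_of_nonneg_left (norm_nonneg _)

theorem completeSpace_graphDomain [CompleteSpace K] {T : K →ₗ.[ℂ] K} (hT : T.IsClosed) :
    CompleteSpace (GraphDomain T) := by
  have hi : Isometry (graphEmbedding T) := AddMonoidHomClass.isometry_of_norm _ fun _ => rfl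
  have hr : Set.range (graphEmbedding T)
      = (fun v : WithLp 1 (K × K) => (v.snd, v.fst)) ⁻¹' (T.graph : Set (K × K)) := by
    ext v
    constructor
    · rintro ⟨ψ, rfl⟩
      exact T.mem_graph ψ
    · intro h
      obtain ⟨y, h1, h2⟩ := (LinearPMap.mem_graph_iff T).1 h
      refine ⟨y, ?_⟩
      apply (WithLp.equiv 1 (K × K)).injective
      exact Prod.ext h2 h1
  have hc : IsClosed (Set.range (graphEmbedding T)) := by
    rw [hr]
    refine IsClosed.preimage ?_ hT
    fun_prop
  exact (completeSpace_iff_isComplete_range hi.isUniformInducing).2 hc.isComplete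

end GraphDomain

/-! ### The regularized resolvent in the fibers -/

section Fibers

variable {n m : ℕ} {F : Type*} [NormedAddCommGroup F] [InnerProductSpace ℂ F] [CompleteSpace F]
  {D : Submodule ℂ F} {H₀ : Base n → D →ₗ[ℂ] F} {P : Base n → F →L[ℂ] F} {E : Base n → ℝ}

namespace FiberAssumption

theorem proj_mem_graph (hH : FiberAssumption m D H₀ P E) (x : Base n) (ψ : F) :
    (P x ψ, (E x : ℂ) • P x ψ) ∈ (fiberOp D H₀ x).graph := by
  obtain ⟨h1, h2⟩ := hH.eigen x ψ
  rw [← h2]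
  exact (fiberOp D H₀ x).mem_graph ⟨P x ψ, h1⟩

/-- The eigenprojection commutes with the fiber operator. -/
theorem proj_apply_of_mem_graph (hH : FiberAssumption m D H₀ P E) (x : Base n) {ψ φ : F}
    (h : (ψ, φ) ∈ (fiberOp D H₀ x).graph) : P x φ = (E x : ℂ) • P x ψ := by
  have hs : ∀ u v, ⟪P x u, v⟫_ℂ = ⟪u, P x v⟫_ℂ :=
    ContinuousLinearMap.isSelfAdjoint_iff_isSymmetric.1 (hH.proj x).isSelfAdjoint
  refine ext_inner_left ℂ fun χ => ?_
  have h1 := inner_graph (hH.selfAdjoint x) h (hH.proj_mem_graph x χ)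
  rw [← hs, ← h1, inner_smul_left, inner_smul_right, hs, Complex.conj_ofReal]

theorem differentiable_proj (hH : FiberAssumption m D H₀ P E) : Differentiable ℝ P :=
  hH.proj_regular.1.differentiable (by simp)

/-- The derivative of a projection is off-diagonal. -/
theorem one_sub_mul_partialFst (hH : FiberAssumption m D H₀ P E) (j : Fin n) (x : Base n) :
    (1 - P x) * partialFst P j x = partialFst P j x * P x := by
  have hd := (hH.differentiable_proj x).hasFDerivAt
  let B : (F →L[ℂ] F) →L[ℝ] (F →L[ℂ] F) →L[ℝ] (F →L[ℂ] F) :=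
    (ContinuousLinearMap.compL ℂ F F F).bilinearRestrictScalars ℝ
  have h1 := B.hasFDerivAt_of_bilinear hd hd
  have h2 : (fun y => B (P y) (P y)) = P := funext fun y => (hH.proj y).isIdempotentElem
  rw [h2] at h1
  have h3 := congrArg (fun L : Base n →L[ℝ] F →L[ℂ] F => L (basisVec j)) (hd.unique h1)
  change partialFst P j x = P x * partialFst P j x + partialFst P j x * P x at h3
  rw [sub_mul, one_mul, sub_eq_iff_eq_add']
  exact h3

theorem isCb_partialFst_mul (hH : FiberAssumption m D H₀ P E) (j : Fin n) :
    IsCb m fun x => partialFst P j x * P x :=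
  (hH.proj_regular.partialFst j).mul (hH.proj_regular.of_le (Nat.le_succ m))

theorem im_spectral_ne_zero (E : ℝ) {δ : ℝ} (hδ : 0 < δ) :
    ((E : ℂ) - Complex.I * (δ : ℂ)).im ≠ 0 := by
  simpa using hδ.ne'

/-- The commutator equation `[H₀(x), G(x)] = ∂_j P P - i δ G(x)` for `G = R ∂_j P P`, together with
`resolventDeriv_apply_of_mem_graph`. -/
theorem resolventDeriv_mem_graph (hH : FiberAssumption m D H₀ P E) {δ : ℝ} (hδ : 0 < δ)
    (j : Fin n) (x : Base n) (ψ : F) :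
    (resolventDeriv D H₀ P E δ j x ψ,
      (E x : ℂ) • resolventDeriv D H₀ P E δ j x ψ + (partialFst P j x * P x) ψ
        - (Complex.I * (δ : ℂ)) • resolventDeriv D H₀ P E δ j x ψ) ∈ (fiberOp D H₀ x).graph := by
  have h := resolvent_mem_graph (hH.selfAdjoint x) (im_spectral_ne_zero (E x) hδ)
    ((partialFst P j x * P x) ψ)
  have e : resolventDeriv D H₀ P E δ j x ψ
      = resolvent (fiberOp D H₀ x) ((E x : ℂ) - Complex.I * (δ : ℂ)) ((partialFst P j x * P x) ψ) :=
    rfl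
  rw [e]
  convert h using 2
  rw [sub_smul]
  abel

theorem resolventDeriv_apply_of_mem_graph (hH : FiberAssumption m D H₀ P E) (δ : ℝ)
    (j : Fin n) (x : Base n) {ψ φ : F} (h : (ψ, φ) ∈ (fiberOp D H₀ x).graph) :
    resolventDeriv D H₀ P E δ j x φ = (E x : ℂ) • resolventDeriv D H₀ P E δ j x ψ := by
  change (resolvent (fiberOp D H₀ x) _ * partialFst P j x) (P x φ)
    = (E x : ℂ) • (resolvent (fiberOp D H₀ x) _ * partialFst P j x) (P x ψ)
  rw [hH.proj_apply_of_mem_graph x h, map_smul]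

/-- The equation for `G = R ∂_j P P` in the form used to differentiate it: with the domain `𝒟` of
the fibers and the inclusion `ι : 𝒟 → F`, `G` factors through a `C^m` family `g` with values in
`L(F, 𝒟)` that solves `(f₀ + i δ ι) g = ∂_j P P`, where `f₀ = H₀ - E ι`. -/
theorem exists_smooth_solution (hH : FiberAssumption m D H₀ P E) (x₀ : Base n)
    {G : Base n → GraphDomain (fiberOp D H₀ x₀) →L[ℂ] F}
    (hG : ∀ x, ∀ ψ : D, G x (show GraphDomain (fiberOp D H₀ x₀) from ψ) = H₀ x ψ)
    (hGc : IsCb m G) {δ : ℝ} (hδ : 0 < δ) (j : Fin n) :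
    ∃ g : Base n → F →L[ℂ] GraphDomain (fiberOp D H₀ x₀), ContDiff ℝ m g ∧
      (∀ x, ((G x - E x • graphInclusion (fiberOp D H₀ x₀))
        + (Complex.I * δ) • graphInclusion (fiberOp D H₀ x₀)) ∘L g x = partialFst P j x * P x) ∧
      ∀ x, graphInclusion (fiberOp D H₀ x₀) ∘L g x = resolventDeriv D H₀ P E δ j x := by
  have : CompleteSpace (GraphDomain (fiberOp D H₀ x₀)) :=
    completeSpace_graphDomain (hH.selfAdjoint x₀).isClosed
  set ι := graphInclusion (fiberOp D H₀ x₀)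
  let T : Base n → GraphDomain (fiberOp D H₀ x₀) →L[ℂ] F := fun x =>
    (G x - E x • ι) + (Complex.I * δ) • ι
  have hTa : ∀ x, ∀ ψ : D, T x (show GraphDomain (fiberOp D H₀ x₀) from ψ)
      = H₀ x ψ - ((E x : ℂ) - Complex.I * δ) • (ψ : F) := by
    intro x ψ
    have : T x (show GraphDomain (fiberOp D H₀ x₀) from ψ)
      = (H₀ x ψ - E x • (ψ : F)) + (Complex.I * δ) • (ψ : F) := by rw [← hG x ψ]; rfl
    rw [this, sub_smul, Complex.coe_smul]
    abel
  have hz := fun x => im_spectral_ne_zero (E x) hδ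
  have hR := fun x => isResolventAt_resolvent (hH.selfAdjoint x) (hz x)
  have hinj : ∀ x, Function.Injective (T x) := by
    intro x
    rw [injective_iff_map_eq_zero]
    intro w hw
    have h1 := (hR x).2 (show D from w)
    have h2 : fiberOp D H₀ x (show D from w) - ((E x : ℂ) - Complex.I * δ) • ((show D from w) : F)
        = 0 := (hTa x (show D from w)).symm.trans hw
    rw [h2, map_zero] at h1
    exact Subtype.ext h1.symm
  have hsol : ∀ x φ, ∃ w : D, (w : F) = resolvent (fiberOp D H₀ x) ((E x : ℂ) - Complex.I * δ) φ ∧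
      T x (show GraphDomain (fiberOp D H₀ x₀) from w) = φ := by
    intro x φ
    obtain ⟨h1, h2⟩ := (hR x).1 φ
    exact ⟨⟨_, h1⟩, rfl, (hTa x ⟨_, h1⟩).trans h2⟩
  let e : ∀ x, GraphDomain (fiberOp D H₀ x₀) ≃L[ℂ] F := fun x =>
    ContinuousLinearEquiv.ofBijective (T x) (LinearMap.ker_eq_bot.2 (hinj x))
      (LinearMap.range_eq_top.2 fun φ => let ⟨w, _, hw⟩ := hsol x φ; ⟨w, hw⟩)
  have he : ∀ x, (e x : GraphDomain (fiberOp D H₀ x₀) →L[ℂ] F) = T x := fun x => rfl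
  have hTc : ContDiff ℝ m T :=
    (hGc.1.sub (hH.eigen_regular.1.smul contDiff_const)).add contDiff_const
  have hinv : ContDiff ℝ m fun x => (T x).inverse := by
    rw [contDiff_iff_contDiffAt]
    intro x
    have h1 : ContDiffAt ℂ m (ContinuousLinearMap.inverse (R := ℂ)) (T x) := by
      rw [← he]
      exact contDiffAt_map_inverse (e x)
    exact (h1.restrict_scalars ℝ).comp x hTc.contDiffAt
  let B : (F →L[ℂ] GraphDomain (fiberOp D H₀ x₀)) →L[ℝ] (F →L[ℂ] F) →L[ℝ]
      (F →L[ℂ] GraphDomain (fiberOp D H₀ x₀)) :=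
    (ContinuousLinearMap.compL ℂ F F (GraphDomain (fiberOp D H₀ x₀))).bilinearRestrictScalars ℝ
  have hinva : ∀ x φ, T x ((T x).inverse φ) = φ := by
    intro x φ
    rw [← he, ContinuousLinearMap.inverse_equiv]
    exact (e x).apply_symm_apply φ
  refine ⟨fun x => (T x).inverse ∘L (partialFst P j x * P x),
    B.isBoundedBilinearMap.contDiff.comp (hinv.prodMk (hH.isCb_partialFst_mul j).1),
    fun x => ?_, fun x => ?_⟩
  · ext ψ
    exact hinva x _
  · ext ψ
    obtain ⟨w, hw1, hw2⟩ := hsol x ((partialFst P j x * P x) ψ)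
    have h1 : (T x).inverse ((partialFst P j x * P x) ψ) = w :=
      hinj x ((hinva x _).trans hw2.symm)
    change ι ((T x).inverse ((partialFst P j x * P x) ψ)) = _
    rw [h1]
    exact hw1

theorem contDiff_resolventDeriv (hH : FiberAssumption m D H₀ P E) {δ : ℝ} (hδ : 0 < δ)
    (j : Fin n) : ContDiff ℝ m (resolventDeriv D H₀ P E δ j) := by
  obtain ⟨x₀, -, G, hG, hGc⟩ := hH.regular
  obtain ⟨g, hg, -, hgr⟩ := hH.exists_smooth_solution x₀ hG hGc hδ j
  let L : (F →L[ℂ] GraphDomain (fiberOp D H₀ x₀)) →L[ℝ] (F →L[ℂ] F) :=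
    ((ContinuousLinearMap.compL ℂ F (GraphDomain (fiberOp D H₀ x₀)) F).bilinearRestrictScalars ℝ)
      (graphInclusion (fiberOp D H₀ x₀))
  have h := L.contDiff.comp hg
  have e : L ∘ g = resolventDeriv D H₀ P E δ j := funext hgr
  rwa [e] at h

/-- Uniform bounds for `G = R ∂_j P P` and its derivatives in terms of a bound `a` for `G` and a
bound `a'` for its first derivative. -/
theorem exists_resolventDeriv_bounds (hH : FiberAssumption m D H₀ P E) (hm : 1 ≤ m) :
    ∃ C : ℝ, 0 ≤ C ∧ ∀ (j : Fin n) (δ a : ℝ), 0 < δ → δ ≤ 1 → 0 ≤ a →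
      (∀ x, ‖resolventDeriv D H₀ P E δ j x‖ ≤ a) →
      (∀ x, ‖iteratedFDeriv ℝ 1 (resolventDeriv D H₀ P E δ j) x‖ ≤ C * δ⁻¹ * (1 + a)) ∧
      ∀ a' : ℝ, (∀ x, ‖iteratedFDeriv ℝ 1 (resolventDeriv D H₀ P E δ j) x‖ ≤ a') →
        ∀ i ≤ m, ∀ x, ‖iteratedFDeriv ℝ i (resolventDeriv D H₀ P E δ j) x‖
          ≤ C * δ⁻¹ ^ (i - 1) * (1 + a + a') := by
  obtain ⟨x₀, ⟨C₁, C₂, hC₁, hC⟩, G, hG, hGc⟩ := hH.regular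
  set 𝒟 := GraphDomain (fiberOp D H₀ x₀)
  set ι : 𝒟 →L[ℂ] F := graphInclusion (fiberOp D H₀ x₀)
  have hιn : ‖ι‖ ≤ 1 := LinearMap.mkContinuous_norm_le _ zero_le_one _
  let S : ℝ →L[ℝ] (𝒟 →L[ℂ] F) := ContinuousLinearMap.toSpanSingleton ℝ ι
  have hf₀ : IsCb m fun x => G x - E x • ι := hGc.sub (hH.eigen_regular.clm_comp S)
  obtain ⟨κ, hκ0, hκ⟩ := hf₀.exists_bound
  obtain ⟨e, he0, he⟩ := hH.eigen_regular.exists_bound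
  have hE : ∀ x, |E x| ≤ e := fun x => by
    have := he 0 (Nat.zero_le m) x
    rwa [norm_iteratedFDeriv_zero, Real.norm_eq_abs] at this
  choose β hβ0 hβ using fun j => (hH.isCb_partialFst_mul j).exists_bound
  have hS0 : 0 ≤ ∑ j, β j := Finset.sum_nonneg fun j _ => hβ0 j
  have hgraph : ∀ x, ∀ w : 𝒟, ‖w‖ ≤ (C₁⁻¹ * (1 + e)) * (‖(G x - E x • ι) w‖ + ‖ι w‖) := by
    intro x w
    have h1 := (hC x (show D from w)).1
    have h2 : ‖w‖ = ‖H₀ x₀ (show D from w)‖ + ‖((show D from w) : F)‖ := graphDomain_norm _ _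
    rw [← h2, ← le_inv_mul_iff₀ hC₁] at h1
    refine h1.trans ?_
    rw [mul_assoc]
    refine mul_le_mul_of_nonneg_left ?_ (inv_nonneg.2 hC₁.le)
    have h3 : H₀ x (show D from w) = (G x - E x • ι) w + E x • ι w := by
      rw [← hG x]
      exact (sub_add_cancel (G x w) (E x • ι w)).symm
    have h4 : ‖H₀ x (show D from w)‖ ≤ ‖(G x - E x • ι) w‖ + e * ‖ι w‖ := by
      rw [h3]
      refine (norm_add_le _ _).trans ?_
      rw [norm_smul, Real.norm_eq_abs]
      gcongr
      exact hE x
    have h5 : ‖((show D from w) : F)‖ = ‖ι w‖ := rfl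
    rw [h5]
    have h6 := mul_nonneg he0 (norm_nonneg ((G x - E x • ι) w))
    linarith
  have hlow : ∀ δ : ℝ, 0 < δ → ∀ x, ∀ w : 𝒟,
      δ * ‖ι w‖ ≤ ‖(G x - E x • ι) w + (Complex.I * δ) • ι w‖ := by
    intro δ hδ x w
    have h1 := abs_im_mul_norm_le (hH.selfAdjoint x) ((E x : ℂ) - Complex.I * δ)
      ((fiberOp D H₀ x).mem_graph (show D from w))
    have h2 : |((E x : ℂ) - Complex.I * δ).im| = δ := by simp [abs_of_pos hδ]
    rw [h2] at h1
    refine h1.trans_eq ?_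
    congr 1
    change H₀ x (show D from w) - ((E x : ℂ) - Complex.I * δ) • ι w = (G x w - E x • ι w) + _
    rw [← hG x, sub_smul, Complex.coe_smul]
    abel
  obtain ⟨C, hC0, hCb⟩ := exists_solution_deriv_bounds hf₀.1 (fun i hi _ x => hκ i hi x) hκ0 hS0
    (by positivity : 0 ≤ C₁⁻¹ * (1 + e)) hgraph hlow hm
  refine ⟨C, hC0, fun j δ a hδ hδ1 ha hga => ?_⟩
  obtain ⟨g, hg, hgeq, hgr⟩ := hH.exists_smooth_solution x₀ hG hGc hδ j
  have hfun : (fun y => ι ∘L g y) = resolventDeriv D H₀ P E δ j := funext hgr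
  obtain ⟨h1, h2⟩ := hCb _ g δ a hδ hδ1 ha (fun i hi x => (hβ j i hi x).trans
    (Finset.single_le_sum (f := β) (fun j _ => hβ0 j) (Finset.mem_univ j))) hg hgeq
    (fun x => by rw [hgr]; exact hga x)
  rw [hfun] at h1 h2
  refine ⟨h1, fun a' ha' i hi x => ?_⟩
  have him : (i : WithTop ℕ∞) ≤ (m : WithTop ℕ∞) := by exact_mod_cast hi
  let L : (F →L[ℂ] 𝒟) →L[ℝ] (F →L[ℂ] F) :=
    ((ContinuousLinearMap.compL ℂ F 𝒟 F).bilinearRestrictScalars ℝ) ι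
  have hLn : ‖L‖ ≤ 1 := by
    refine ContinuousLinearMap.opNorm_le_bound _ zero_le_one fun u => ?_
    exact (ContinuousLinearMap.opNorm_comp_le ι u).trans (by gcongr)
  have h3 := L.norm_iteratedFDeriv_comp_left hg.contDiffAt him (x := x)
  have e : L ∘ g = resolventDeriv D H₀ P E δ j := funext hgr
  rw [e] at h3
  refine h3.trans ?_
  refine (mul_le_mul hLn (h2 a' ha' i hi x) (norm_nonneg _) zero_le_one).trans_eq ?_
  rw [one_mul]

end FiberAssumption

end Fibers

/-! ### Fibered operators and the direct integral -/

section DirectIntegral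

variable {n m : ℕ} {F : Type*} [NormedAddCommGroup F] [InnerProductSpace ℂ F]
  {D : Submodule ℂ F} {H₀ : Base n → D →ₗ[ℂ] F} {P : Base n → F →L[ℂ] F} {E : Base n → ℝ}
  {h : ℝ → L2 n F →ₗ.[ℂ] L2 n F}

theorem memLp_top_of_continuous {A : Base n → F →L[ℂ] F} (hA : Continuous A) {c : ℝ}
    (hc : ∀ x, ‖A x‖ ≤ c) : MemLp A ∞ (volume : Measure (Base n)) :=
  memLp_top_of_bound hA.aestronglyMeasurable c (.of_forall hc)

theorem continuous_smul_of_isCb {A : Base n → F →L[ℂ] F} (hE : IsCb m E) (hA : Continuous A) :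
    Continuous fun x => (E x : ℂ) • A x :=
  (Complex.continuous_ofReal.comp hE.1.continuous).smul hA

theorem IsCb.norm_le {V : Type*} [NormedAddCommGroup V] [NormedSpace ℝ V] {k : ℕ} {f : Base n → V}
    (hf : IsCb k f) : ∃ C : ℝ, 0 ≤ C ∧ ∀ x, ‖f x‖ ≤ C := by
  obtain ⟨C, hC0, hC⟩ := hf.exists_bound
  exact ⟨C, hC0, fun x => by simpa using hC 0 (Nat.zero_le k) x⟩

variable [CompleteSpace F]

namespace FiberAssumption

theorem isCb_proj (hH : FiberAssumption m D H₀ P E) : IsCb m P :=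
  hH.proj_regular.of_le (Nat.le_succ m)

theorem memLp_smul_proj (hH : FiberAssumption m D H₀ P E) :
    MemLp (fun x => (E x : ℂ) • P x) ∞ (volume : Measure (Base n)) := by
  obtain ⟨e, he0, he⟩ := hH.eigen_regular.norm_le
  refine memLp_top_of_continuous
    (continuous_smul_of_isCb hH.eigen_regular hH.isCb_proj.1.continuous) (c := e * 1) fun x => ?_
  rw [norm_smul, Complex.norm_real]
  exact mul_le_mul (he x) (hH.proj x).norm_le (norm_nonneg _) he0

theorem fibered_proj_mem_graph (hH : FiberAssumption m D H₀ P E) (ψ : L2 n F) :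
    (fibered P ψ, fibered (fun x => (E x : ℂ) • P x) ψ) ∈ (totalH₀ D H₀).graph := by
  rw [totalH₀, mem_graph_directIntegral]
  filter_upwards [fibered_apply hH.isCb_proj.memLp ψ, fibered_apply hH.memLp_smul_proj ψ]
    with x h1 h2
  rw [h1, h2]
  exact hH.proj_mem_graph x _

theorem fibered_proj_apply_of_mem_graph (hH : FiberAssumption m D H₀ P E) {ψ φ : L2 n F}
    (hψ : (ψ, φ) ∈ (totalH₀ D H₀).graph) :
    fibered P φ = fibered (fun x => (E x : ℂ) • P x) ψ := by
  rw [totalH₀, mem_graph_directIntegral] at hψ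
  refine fibered_eq_of_ae hH.isCb_proj.memLp ?_
  filter_upwards [hψ, fibered_apply hH.memLp_smul_proj ψ] with x h1 h2
  rw [h2, hH.proj_apply_of_mem_graph x h1]
  rfl

theorem memLp_resolventDeriv (hH : FiberAssumption m D H₀ P E) {δ a : ℝ} (hδ : 0 < δ) {j : Fin n}
    (ha : ∀ x, ‖resolventDeriv D H₀ P E δ j x‖ ≤ a) :
    MemLp (resolventDeriv D H₀ P E δ j) ∞ (volume : Measure (Base n)) :=
  memLp_top_of_continuous (hH.contDiff_resolventDeriv hδ j).continuous ha

theorem memLp_smul_resolventDeriv (hH : FiberAssumption m D H₀ P E) {δ a : ℝ} (hδ : 0 < δ)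
    {j : Fin n} (ha : ∀ x, ‖resolventDeriv D H₀ P E δ j x‖ ≤ a) :
    MemLp (fun x => (E x : ℂ) • resolventDeriv D H₀ P E δ j x) ∞
      (volume : Measure (Base n)) := by
  obtain ⟨e, he0, he⟩ := hH.eigen_regular.norm_le
  refine memLp_top_of_continuous (continuous_smul_of_isCb hH.eigen_regular
    (hH.contDiff_resolventDeriv hδ j).continuous) (c := e * a) fun x => ?_
  rw [norm_smul, Complex.norm_real]
  exact mul_le_mul (he x) (ha x) (norm_nonneg _) he0

theorem fibered_resolventDeriv_mem_graph (hH : FiberAssumption m D H₀ P E) {δ a : ℝ} (hδ : 0 < δ)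
    {j : Fin n} (ha : ∀ x, ‖resolventDeriv D H₀ P E δ j x‖ ≤ a) (ψ : L2 n F) :
    (fibered (resolventDeriv D H₀ P E δ j) ψ,
      fibered (fun x => (E x : ℂ) • resolventDeriv D H₀ P E δ j x) ψ
        + fibered (fun x => partialFst P j x * P x) ψ
        - (Complex.I * δ) • fibered (resolventDeriv D H₀ P E δ j) ψ) ∈ (totalH₀ D H₀).graph := by
  rw [totalH₀, mem_graph_directIntegral]
  filter_upwards [fibered_apply (hH.memLp_resolventDeriv hδ ha) ψ,
    fibered_apply (hH.memLp_smul_resolventDeriv hδ ha) ψ,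
    fibered_apply (hH.isCb_partialFst_mul j).memLp ψ,
    Lp.coeFn_sub (fibered (fun x => (E x : ℂ) • resolventDeriv D H₀ P E δ j x) ψ
        + fibered (fun x => partialFst P j x * P x) ψ)
        ((Complex.I * δ) • fibered (resolventDeriv D H₀ P E δ j) ψ),
    Lp.coeFn_add (fibered (fun x => (E x : ℂ) • resolventDeriv D H₀ P E δ j x) ψ)
      (fibered (fun x => partialFst P j x * P x) ψ),
    Lp.coeFn_smul (Complex.I * (δ : ℂ)) (fibered (resolventDeriv D H₀ P E δ j) ψ)]
    with x h1 h2 h3 h4 h5 h6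
  rw [h4, Pi.sub_apply, h5, Pi.add_apply, h6, Pi.smul_apply, h1, h2, h3]
  exact hH.resolventDeriv_mem_graph hδ j x _

theorem fibered_resolventDeriv_apply_of_mem_graph (hH : FiberAssumption m D H₀ P E) {δ a : ℝ}
    (hδ : 0 < δ) {j : Fin n} (ha : ∀ x, ‖resolventDeriv D H₀ P E δ j x‖ ≤ a) {ψ φ : L2 n F}
    (hψ : (ψ, φ) ∈ (totalH₀ D H₀).graph) :
    fibered (resolventDeriv D H₀ P E δ j) φ
      = fibered (fun x => (E x : ℂ) • resolventDeriv D H₀ P E δ j x) ψ := by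
  rw [totalH₀, mem_graph_directIntegral] at hψ
  refine fibered_eq_of_ae (hH.memLp_resolventDeriv hδ ha) ?_
  filter_upwards [hψ, fibered_apply (hH.memLp_smul_resolventDeriv hδ ha) ψ] with x h1 h2
  rw [h2, hH.resolventDeriv_apply_of_mem_graph δ j x h1]
  rfl

end FiberAssumption

end DirectIntegral

/-! ### The off-diagonal part of the perturbation -/

section Perturbation

variable {n m : ℕ} {F : Type*} [NormedAddCommGroup F] [InnerProductSpace ℂ F] [CompleteSpace F]
  {D : Submodule ℂ F} {H₀ : Base n → D →ₗ[ℂ] F} {P : Base n → F →L[ℂ] F} {E : Base n → ℝ}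
  {h : ℝ → L2 n F →ₗ.[ℂ] L2 n F}

/-- The commutator bounds for `h^ε` in terms of graphs, with one constant `c`. -/
theorem PerturbationAssumption.exists_uniform (hh : PerturbationAssumption m D H₀ h) :
    ∃ (Dh : ℝ → Fin n → L2 n F →L[ℂ] L2 n F) (c : ℝ), 0 ≤ c ∧
      ∀ ε ∈ Set.Ioc (0 : ℝ) 1, (∀ j, ‖Dh ε j‖ ≤ c) ∧
      (∀ A : Base n → F →L[ℂ] F, IsCb m A → ∀ ψ φ, (ψ, φ) ∈ (h ε).graph →
        ∃ φ', (fibered A ψ, φ') ∈ (h ε).graph ∧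
          ‖φ' - fibered A φ
            + ((Complex.I * (ε : ℂ)) • ∑ j, fibered (partialFst A j) * Dh ε j) ψ‖
            ≤ c * (∑ j ∈ Finset.Icc 2 m, ε ^ j * supPartial j A) * ‖ψ‖) ∧
      (∀ j ψ φ, (ψ, φ) ∈ (totalH₀ D H₀).graph → ∃ φ', (Dh ε j ψ, φ') ∈ (totalH₀ D H₀).graph ∧
        ‖Dh ε j φ - φ'‖ ≤ ε * c * (‖φ‖ + ‖ψ‖)) ∧
      (∀ j ψ φ, (ψ, φ) ∈ (h ε).graph → ∃ φ', (Dh ε j ψ, φ') ∈ (h ε).graph ∧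
        ‖Dh ε j φ - φ'‖ ≤ ε * c * ‖ψ‖) := by
  obtain ⟨Dh, -, ⟨C₁, h₁⟩, ⟨C₂, h₂⟩, ⟨C₃, h₃⟩, ⟨C₄, h₄⟩⟩ := hh.deriv
  have hcoord : ∀ (v : Fin n → L2 n F) j, ‖v j‖ ≤ √(∑ j, ‖v j‖ ^ 2) := fun v j => by
    refine Real.le_sqrt_of_sq_le ?_
    exact Finset.single_le_sum (f := fun j => ‖v j‖ ^ 2) (fun _ _ => sq_nonneg _)
      (Finset.mem_univ j)
  have a₁ := le_abs_self C₁
  have a₂ := le_abs_self C₂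
  have a₃ := le_abs_self C₃
  have a₄ := le_abs_self C₄
  have b₁ := abs_nonneg C₁
  have b₂ := abs_nonneg C₂
  have b₃ := abs_nonneg C₃
  have b₄ := abs_nonneg C₄
  refine ⟨Dh, |C₁| + |C₂| + |C₃| + |C₄|, by positivity, fun ε hε => ⟨fun j => ?_, ?_, ?_, ?_⟩⟩
  · refine ContinuousLinearMap.opNorm_le_bound _ (by positivity) fun ψ => ?_
    refine (hcoord (fun j => Dh ε j ψ) j).trans ((h₁ ε hε ψ).trans ?_)
    gcongr
    linarith
  · intro A hA ψ φ hψ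
    obtain ⟨y, rfl, rfl⟩ := (LinearPMap.mem_graph_iff _).1 hψ
    obtain ⟨hm, hle⟩ := h₂ A hA ε hε y
    refine ⟨_, (h ε).mem_graph ⟨_, hm⟩, ?_⟩
    simp only [smul_apply, sum_apply, mul_apply_eq_comp]
    have hs : 0 ≤ ∑ j ∈ Finset.Icc 2 m, ε ^ j * supPartial j A :=
      Finset.sum_nonneg fun j _ => mul_nonneg (pow_nonneg hε.1.le j)
        (Real.iSup_nonneg fun _ => norm_nonneg _)
    refine hle.trans ?_
    gcongr
    · linarith
    · exact le_rfl
  · intro j ψ φ hψ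
    obtain ⟨y, rfl, rfl⟩ := (LinearPMap.mem_graph_iff _).1 hψ
    obtain ⟨hm, hle⟩ := h₃ ε hε y
    refine ⟨_, (totalH₀ D H₀).mem_graph ⟨_, hm j⟩, ?_⟩
    refine (hcoord (fun j => Dh ε j (totalH₀ D H₀ y) - totalH₀ D H₀ ⟨Dh ε j y, hm j⟩) j).trans
      (hle.trans ?_)
    have := hε.1.le
    gcongr
    linarith
  · intro j ψ φ hψ
    obtain ⟨y, rfl, rfl⟩ := (LinearPMap.mem_graph_iff _).1 hψ
    obtain ⟨hm, hle⟩ := h₄ ε hε y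
    refine ⟨_, (h ε).mem_graph ⟨_, hm j⟩, ?_⟩
    refine (hcoord (fun j => Dh ε j (h ε y) - h ε ⟨Dh ε j y, hm j⟩) j).trans (hle.trans ?_)
    have := hε.1.le
    gcongr
    linarith

theorem norm_sum_mul_le {K : Type*} [NormedAddCommGroup K] [InnerProductSpace ℂ K]
    {A B : Fin n → K →L[ℂ] K} {a b : ℝ} (ha : 0 ≤ a) (hA : ∀ j, ‖A j‖ ≤ a) (hB : ∀ j, ‖B j‖ ≤ b) :
    ‖∑ j, A j * B j‖ ≤ n * (a * b) := by
  refine (norm_sum_le_of_le _ fun j _ => (norm_mul_le (A j) (B j)).trans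
    (mul_le_mul (hA j) (hB j) (norm_nonneg _) ha)).trans_eq ?_
  rw [Finset.sum_const, Finset.card_univ, Fintype.card_fin, nsmul_eq_mul]

/-- The off-diagonal part `A + A*` of `h^ε` is of order `ε`, and
`A = -i ε ∑ ∂_j P P · Dh_j P + O(ε²)`. -/
theorem exists_offDiagonal_family (hm : 2 ≤ m) (hH : FiberAssumption m D H₀ P E)
    (hh : PerturbationAssumption m D H₀ h) {Dh : ℝ → Fin n → L2 n F →L[ℂ] L2 n F} {c : ℝ}
    (hc : 0 ≤ c)
    (hDh : ∀ ε ∈ Set.Ioc (0 : ℝ) 1, (∀ j, ‖Dh ε j‖ ≤ c) ∧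
      (∀ A : Base n → F →L[ℂ] F, IsCb m A → ∀ ψ φ, (ψ, φ) ∈ (h ε).graph →
        ∃ φ', (fibered A ψ, φ') ∈ (h ε).graph ∧
          ‖φ' - fibered A φ
            + ((Complex.I * (ε : ℂ)) • ∑ j, fibered (partialFst A j) * Dh ε j) ψ‖
            ≤ c * (∑ j ∈ Finset.Icc 2 m, ε ^ j * supPartial j A) * ‖ψ‖)) :
    ∃ p : ℝ, 0 ≤ p ∧ ∀ ε ∈ Set.Ioc (0 : ℝ) 1,
      (∀ ψ φ, (ψ, φ) ∈ (h ε).graph → ∃ φ', (fibered P ψ, φ') ∈ (h ε).graph ∧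
        ‖φ' - fibered P φ‖ ≤ ε * p * ‖ψ‖) ∧
      ∃ A : L2 n F →L[ℂ] L2 n F, ‖A‖ ≤ ε * p ∧
        ‖A + (Complex.I * (ε : ℂ)) •
          ∑ j, fibered (fun x => partialFst P j x * P x) * Dh ε j * fibered P‖ ≤ p * ε ^ 2 ∧
        ∀ ψ φ, (ψ, φ) ∈ (totalH₀ D H₀ + sandwich (fibered P) (h ε)
            + sandwich (1 - fibered P) (h ε)).graph ↔
          (ψ, φ + (A + ContinuousLinearMap.adjoint A) ψ) ∈ (totalH₀ D H₀ + h ε).graph := by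
  obtain ⟨β, hβ0, hβ⟩ := hH.isCb_proj.exists_bound
  refine ⟨c * (m * β) + n * (β * c), by positivity, fun ε hε => ?_⟩
  obtain ⟨hDn, hcomm⟩ := hDh ε hε
  have hε0 := hε.1.le
  have hε2 : ε ^ 2 ≤ ε := by
    have := mul_le_mul_of_nonneg_left hε.2 hε0
    rwa [mul_one, ← sq] at this
  set Pf : L2 n F →L[ℂ] L2 n F := fibered P
  have hP : IsStarProjection Pf := isStarProjection_fibered hH.isCb_proj.memLp hH.proj
  set L : L2 n F →L[ℂ] L2 n F :=
    (Complex.I * (ε : ℂ)) • ∑ j, fibered (partialFst P j) * Dh ε j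
  have hsum : c * (∑ j ∈ Finset.Icc 2 m, ε ^ j * supPartial j P) ≤ c * (m * β) * ε ^ 2 := by
    rw [mul_assoc]
    refine mul_le_mul_of_nonneg_left ?_ hc
    have h1 : ∀ j ∈ Finset.Icc 2 m, ε ^ j * supPartial j P ≤ ε ^ 2 * β := fun j hj => by
      obtain ⟨h2, h3⟩ := Finset.mem_Icc.1 hj
      exact mul_le_mul (pow_le_pow_of_le_one hε0 hε.2 h2) (supPartial_le hβ0 (hβ j h3))
        (Real.iSup_nonneg fun _ => norm_nonneg _) (by positivity)
    refine (Finset.sum_le_sum h1).trans ?_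
    rw [Finset.sum_const, Nat.card_Icc, nsmul_eq_mul]
    have h2 : ((m + 1 - 2 : ℕ) : ℝ) ≤ m := by exact_mod_cast (by omega)
    have h3 := mul_le_mul_of_nonneg_right h2 (by positivity : 0 ≤ ε ^ 2 * β)
    linarith
  have hL : ‖L‖ ≤ ε * (n * (β * c)) := by
    rw [norm_smul, norm_mul, Complex.norm_I, one_mul, Complex.norm_real, Real.norm_eq_abs,
      abs_of_nonneg hε0]
    refine mul_le_mul_of_nonneg_left (norm_sum_mul_le hβ0 (fun j => ?_) hDn) hε0
    exact norm_fibered_le hβ0 fun x => (norm_partialFst_le P j x).trans (hβ 1 (by omega) x)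
  have hcommP : ∀ ψ φ, (ψ, φ) ∈ (h ε).graph → ∃ φ', (Pf ψ, φ') ∈ (h ε).graph ∧
      ‖φ' - Pf φ + L ψ‖ ≤ c * (m * β) * ε ^ 2 * ‖ψ‖ := fun ψ φ hψ => by
    obtain ⟨φ', h1, h2⟩ := hcomm P hH.isCb_proj ψ φ hψ
    exact ⟨φ', h1, h2.trans (by gcongr)⟩
  have hsmall : c * (m * β) * ε ^ 2 + ε * (n * (β * c)) ≤ ε * (c * (m * β) + n * (β * c)) := by
    have := mul_le_mul_of_nonneg_left hε2 (by positivity : 0 ≤ c * (m * β))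
    linarith
  refine ⟨fun ψ φ hψ => ?_, ?_⟩
  · obtain ⟨φ', h1, h2⟩ := hcommP ψ φ hψ
    refine ⟨φ', h1, ?_⟩
    have e : φ' - Pf φ = (φ' - Pf φ + L ψ) - L ψ := by abel
    rw [e]
    refine (norm_sub_le _ _).trans ((add_le_add h2 (L.le_of_opNorm_le hL ψ)).trans ?_)
    rw [← add_mul]
    gcongr
  · obtain ⟨A, hA, hV⟩ := exists_offDiagonal (hh.selfAdjoint ε hε) hP (by positivity) hcommP
    have hLP : (1 - Pf) * L * Pf = (Complex.I * (ε : ℂ)) •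
        ∑ j, fibered (fun x => partialFst P j x * P x) * Dh ε j * Pf := by
      rw [mul_smul_comm, smul_mul_assoc, Finset.mul_sum, Finset.sum_mul]
      congr 1
      refine Finset.sum_congr rfl fun j _ => ?_
      rw [← mul_assoc, fibered_sub_mul (hH.proj_regular.partialFst j).memLp hH.isCb_proj.memLp
        (hH.isCb_partialFst_mul j).memLp fun x => (hH.one_sub_mul_partialFst j x).symm]
    refine ⟨A, ?_, ?_, ?_⟩
    · have hn : ‖(1 - Pf) * L * Pf‖ ≤ ε * (n * (β * c)) := by
        calc ‖(1 - Pf) * L * Pf‖ ≤ ‖1 - Pf‖ * ‖L‖ * ‖Pf‖ :=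
              (norm_mul_le _ _).trans (by gcongr; exact norm_mul_le _ _)
          _ ≤ 1 * (ε * (n * (β * c))) * 1 := by
              gcongr
              · exact hP.one_sub.norm_le
              · exact hP.norm_le
          _ = _ := by ring
      have e : A = (A + (1 - Pf) * L * Pf) - (1 - Pf) * L * Pf := by abel
      rw [e]
      exact (norm_sub_le _ _).trans ((add_le_add hA hn).trans hsmall)
    · rw [← hLP]
      refine hA.trans ?_
      gcongr
      have : 0 ≤ n * (β * c) := by positivity
      linarith
    · refine mem_graph_blockDiagonal (fun ψ φ hψ => ?_) hV
      obtain ⟨φ', h1, -⟩ := hcommP ψ φ hψ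
      exact ⟨φ', h1⟩

end Perturbation

/-! ### The adiabatic estimate -/

section AdiabaticEstimate

variable {n m : ℕ} {F : Type*} [NormedAddCommGroup F] [InnerProductSpace ℂ F] [CompleteSpace F]
  {D : Submodule ℂ F} {H₀ : Base n → D →ₗ[ℂ] F} {P : Base n → F →L[ℂ] F} {E : Base n → ℝ}
  {h : ℝ → L2 n F →ₗ.[ℂ] L2 n F}

theorem isSelfAdjoint_diagH (hm : 2 ≤ m) (hH : FiberAssumption m D H₀ P E)
    (hh : PerturbationAssumption m D H₀ h) {ε : ℝ} (hε : ε ∈ Set.Ioc (0 : ℝ) 1) :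
    IsSelfAdjoint (diagH D H₀ P h ε) ∧ (diagH D H₀ P h ε).domain = (fullH D H₀ h ε).domain := by
  obtain ⟨Dh, c, hc, hDh⟩ := hh.exists_uniform
  obtain ⟨p, -, hp⟩ := exists_offDiagonal_family hm hH hh hc
    fun ε hε => ⟨(hDh ε hε).1, (hDh ε hε).2.1⟩
  obtain ⟨-, A, -, -, hA⟩ := hp ε hε
  have hT := hh.essSelfAdjoint ε hε
  have hS := mem_graph_closure_of_shear hT _ hA
  refine ⟨isSelfAdjoint_of_shear hT _ (fun ψ φ => ?_) hS, domain_eq_of_shear _ hS⟩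
  simp only [add_apply, inner_add_left, inner_add_right, ContinuousLinearMap.adjoint_inner_left,
    ContinuousLinearMap.adjoint_inner_right]
  exact add_comm _ _

/-- The basic estimate behind all three convergence statements. Here `a` and `a'` bound
`G = R ∂_j P P` and its first derivative at the regularization `δ`. Higher derivatives of `G`, up to
the order `m`, cost powers of `δ⁻¹` that are compensated by powers of `ε ≤ δ`. -/
theorem exists_adiabatic_estimate (hm : 2 ≤ m) (hH : FiberAssumption m D H₀ P E)
    (hh : PerturbationAssumption m D H₀ h) :
    ∃ C : ℝ, 0 ≤ C ∧ ∀ ε δ a a' : ℝ, 0 < ε → ε ≤ δ → δ ≤ 1 → 0 ≤ a → 0 ≤ a' →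
      (∀ j x, ‖resolventDeriv D H₀ P E δ j x‖ ≤ a) →
      (∀ j x, ‖iteratedFDeriv ℝ 1 (resolventDeriv D H₀ P E δ j) x‖ ≤ a') →
      ∀ t, ‖fullU D H₀ h ε t - diagU D H₀ P h ε t‖
        ≤ C * (δ * a + ε * (1 + a')) * (1 + |t|) := by
  obtain ⟨Dh, c, hc, hDh⟩ := hh.exists_uniform
  obtain ⟨p, hp0, hp⟩ := exists_offDiagonal_family hm hH hh hc
    fun ε hε => ⟨(hDh ε hε).1, (hDh ε hε).2.1⟩
  obtain ⟨C₁, hC₁0, hC₁⟩ := hH.exists_resolventDeriv_bounds (by omega)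
  obtain ⟨e, he0, he⟩ := hH.eigen_regular.norm_le
  set q := c * (m * C₁) + n * c
  have hq : 0 ≤ q := by positivity
  refine ⟨2 * p + 4 * n * c + 2 * n * (c + c * (e + 1) + c + c * p + c * q) + 4 * n * c * p,
    by positivity, fun ε δ a a' hε hεδ hδ1 ha ha' hGa hGa' t => ?_⟩
  have hδ : 0 < δ := hε.trans_le hεδ
  have hεI : ε ∈ Set.Ioc (0 : ℝ) 1 := ⟨hε, hεδ.trans hδ1⟩
  obtain ⟨hDn, hcomm, hDH, hDhh⟩ := hDh ε hεI
  obtain ⟨hhP, A, hAn, hAL, hS₀⟩ := hp ε hεI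
  have hEP : ‖(fibered (fun x => (E x : ℂ) • P x) : L2 n F →L[ℂ] L2 n F)‖ ≤ e :=
    norm_fibered_le he0 fun x => by
      rw [norm_smul, Complex.norm_real]
      exact (mul_le_mul (he x) (hH.proj x).norm_le (norm_nonneg _) he0).trans_eq (mul_one e)
  have hGn : ∀ j, ‖(fibered (resolventDeriv D H₀ P E δ j) : L2 n F →L[ℂ] L2 n F)‖ ≤ a :=
    fun j => norm_fibered_le ha (hGa j)
  have hPn : ‖(fibered P : L2 n F →L[ℂ] L2 n F)‖ ≤ 1 :=
    norm_fibered_le zero_le_one fun x => (hH.proj x).norm_le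
  have hGd : ∀ j, ∀ i ≤ m, ∀ x, ‖iteratedFDeriv ℝ i (resolventDeriv D H₀ P E δ j) x‖
      ≤ C₁ * δ⁻¹ ^ (i - 1) * (1 + a + a') :=
    fun j => (hC₁ j δ a hδ hδ1 ha (hGa j)).2 a' (hGa' j)
  have hGc : ∀ j, IsCb m (resolventDeriv D H₀ P E δ j) := fun j =>
    isCb_of_bound (hH.contDiff_resolventDeriv hδ j) fun i hi => ⟨_, hGd j i hi⟩
  have hhG : ∀ j ψ φ, (ψ, φ) ∈ (h ε).graph → ∃ φ',
      (fibered (resolventDeriv D H₀ P E δ j) ψ, φ') ∈ (h ε).graph ∧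
      ‖φ' - fibered (resolventDeriv D H₀ P E δ j) φ‖ ≤ ε * q * (1 + a + a') * ‖ψ‖ := by
    intro j ψ φ hψ
    obtain ⟨φ', h1, h2⟩ := hcomm _ (hGc j) ψ φ hψ
    refine ⟨φ', h1, ?_⟩
    set L : L2 n F →L[ℂ] L2 n F := (Complex.I * (ε : ℂ)) •
      ∑ k, fibered (partialFst (resolventDeriv D H₀ P E δ j) k) * Dh ε k
    have hL : ‖L‖ ≤ ε * (n * (a' * c)) := by
      rw [norm_smul, norm_mul, Complex.norm_I, one_mul, Complex.norm_real, Real.norm_eq_abs,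
        abs_of_pos hε]
      refine mul_le_mul_of_nonneg_left (norm_sum_mul_le ha' (fun k => ?_) hDn) hε.le
      exact norm_fibered_le ha' fun x => (norm_partialFst_le _ k x).trans (hGa' j x)
    -- `ε ^ i` times the loss `δ⁻¹ ^ (i - 1)` of the `i`-th derivative is at most `ε`, as `ε ≤ δ`.
    have hsum : ∑ i ∈ Finset.Icc 2 m, ε ^ i * supPartial i (resolventDeriv D H₀ P E δ j)
        ≤ m * (ε * (C₁ * (1 + a + a'))) := by
      have h3 : ∀ i ∈ Finset.Icc 2 m, ε ^ i * supPartial i (resolventDeriv D H₀ P E δ j)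
          ≤ ε * (C₁ * (1 + a + a')) := fun i hi => by
        obtain ⟨h4, h5⟩ := Finset.mem_Icc.1 hi
        have h6 : (ε * δ⁻¹) ^ (i - 1) ≤ 1 :=
          pow_le_one₀ (by positivity) (by rwa [← div_eq_mul_inv, div_le_one hδ])
        have h7 : ε ^ i = ε * ε ^ (i - 1) := by rw [← pow_succ']; congr 1; omega
        calc ε ^ i * supPartial i (resolventDeriv D H₀ P E δ j)
            ≤ ε ^ i * (C₁ * δ⁻¹ ^ (i - 1) * (1 + a + a')) :=
              mul_le_mul_of_nonneg_left (supPartial_le (by positivity) (hGd j i h5)) (by positivity)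
          _ = ε * (C₁ * (1 + a + a')) * (ε * δ⁻¹) ^ (i - 1) := by rw [h7, mul_pow]; ring
          _ ≤ ε * (C₁ * (1 + a + a')) := mul_le_of_le_one_right (by positivity) h6
      refine (Finset.sum_le_sum h3).trans ?_
      rw [Finset.sum_const, Nat.card_Icc, nsmul_eq_mul]
      have h8 : ((m + 1 - 2 : ℕ) : ℝ) ≤ m := by exact_mod_cast (by omega)
      gcongr
    have e1 : φ' - fibered (resolventDeriv D H₀ P E δ j) φ
        = (φ' - fibered (resolventDeriv D H₀ P E δ j) φ + L ψ) - L ψ := by abel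
    rw [e1]
    refine (norm_sub_le _ _).trans ((add_le_add (h2.trans (mul_le_mul_of_nonneg_right
      (mul_le_mul_of_nonneg_left hsum hc) (norm_nonneg ψ))) (L.le_of_opNorm_le hL ψ)).trans ?_)
    rw [← add_mul]
    refine mul_le_mul_of_nonneg_right ?_ (norm_nonneg ψ)
    have h9 : 0 ≤ ε * (n * c) * (1 + a) := by positivity
    simp only [q]
    linarith
  set K : L2 n F →L[ℂ] L2 n F :=
    ∑ j, fibered (resolventDeriv D H₀ P E δ j) * Dh ε j * fibered P
  set Q := δ * a * c + a * (ε * c * (e + 1)) + (ε * q * (1 + a + a')) * c + a * (ε * c)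
          + a * c * (ε * p)
  have hQ0 : 0 ≤ Q := by positivity
  have hKn : ‖K‖ ≤ n * (a * c) := by
    refine (norm_sum_mul_le (a := a * c) (b := 1) (by positivity) (fun j => ?_)
      (fun _ => hPn)).trans_eq (by rw [mul_one])
    exact (norm_mul_le _ _).trans (mul_le_mul (hGn j) (hDn j) (norm_nonneg _) ha)
  have hmain := norm_unitaryGroup_closure_sub_le (hh.essSelfAdjoint ε hεI) (B := K) hS₀ hε.le
    (r := p * ε ^ 2 + ε * (n * Q)) (by positivity) (fun ψ φ hψ => by
      obtain ⟨ξ, h1, h2⟩ := exists_commutator_approx hε.le hδ.le ha hc hc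
        (by positivity : 0 ≤ ε * q * (1 + a + a')) hPn hEP hDn hGn hH.fibered_proj_mem_graph
        (fun ψ φ => hH.fibered_proj_apply_of_mem_graph)
        (fun j => hH.fibered_resolventDeriv_mem_graph hδ (hGa j))
        (fun j ψ φ => hH.fibered_resolventDeriv_apply_of_mem_graph hδ (hGa j))
        hDH hDhh hhP hhG hψ
      refine ⟨ξ, h1, ?_⟩
      rw [Fintype.card_fin] at h2
      set S : L2 n F →L[ℂ] L2 n F :=
        ∑ j, fibered (fun x => partialFst P j x * P x) * Dh ε j * fibered P
      have e1 : A ψ + (Complex.I * (ε : ℂ)) • (ξ - K φ)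
          = (A + (Complex.I * (ε : ℂ)) • S) ψ
            + (Complex.I * (ε : ℂ)) • (ξ - K φ - S ψ) := by
        rw [add_apply, smul_apply, smul_sub _ (ξ - K φ)]
        abel
      rw [e1]
      refine (norm_add_le _ _).trans ?_
      rw [norm_smul, norm_mul, Complex.norm_I, one_mul, Complex.norm_real, Real.norm_eq_abs,
        abs_of_pos hε, add_mul, mul_assoc ε]
      exact add_le_add (ContinuousLinearMap.le_of_opNorm_le _ hAL ψ)
        (mul_le_mul_of_nonneg_left h2 hε.le)) (t / ε)
  refine hmain.trans ?_
  rw [abs_div, abs_of_pos hε]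
  have hεa : ε * a ≤ δ * a := mul_le_mul_of_nonneg_right hεδ ha
  have hQ : Q ≤ (c + c * (e + 1) + c + c * p + c * q) * (δ * a + ε * (1 + a')) := by
    have k1 := mul_le_mul_of_nonneg_left hεa (by positivity : 0 ≤ c * (e + 1) + c + c * p + c * q)
    have k2 : 0 ≤ (c + c * (e + 1) + c + c * p) * (ε * (1 + a')) := by positivity
    simp only [Q]
    linarith
  have h1 : 4 * ε * ‖K‖ ≤ 4 * n * c * (δ * a + ε * (1 + a')) := by
    have k1 := mul_le_mul_of_nonneg_left hKn (by positivity : 0 ≤ 4 * ε)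
    have k2 := mul_le_mul_of_nonneg_left hεa (by positivity : 0 ≤ 4 * n * c)
    have k3 : 0 ≤ 4 * n * c * (ε * (1 + a')) := by positivity
    linarith
  have h2 : 4 * ε * ‖K‖ * ‖A‖ ≤ ε * (4 * n * c * p * (δ * a + ε * (1 + a'))) := by
    have k1 := mul_le_mul h1 hAn (norm_nonneg A) (by positivity)
    linarith
  have h3 : |t| / ε * (2 * (p * ε ^ 2 + ε * (n * Q)) + 4 * ε * ‖K‖ * ‖A‖)
      ≤ |t| * ((2 * p + 2 * n * (c + c * (e + 1) + c + c * p + c * q) + 4 * n * c * p)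
        * (δ * a + ε * (1 + a'))) := by
    have k1 : 2 * (p * ε ^ 2 + ε * (n * Q)) + 4 * ε * ‖K‖ * ‖A‖
        ≤ ε * ((2 * p + 2 * n * (c + c * (e + 1) + c + c * p + c * q) + 4 * n * c * p)
        * (δ * a + ε * (1 + a'))) := by
      have k2 := mul_le_mul_of_nonneg_left hQ (by positivity : 0 ≤ 2 * ε * n)
      have k3 : 0 ≤ 2 * ε * p * (δ * a + ε * a') := by positivity
      linarith
    calc |t| / ε * (2 * (p * ε ^ 2 + ε * (n * Q)) + 4 * ε * ‖K‖ * ‖A‖)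
        ≤ |t| / ε * (ε * ((2 * p + 2 * n * (c + c * (e + 1) + c + c * p + c * q) + 4 * n * c * p)
          * (δ * a + ε * (1 + a')))) := by gcongr
      _ = _ := by field_simp
  -- The generators are run up to the time `t / ε`; the factor `ε` in `h3` pays for it.
  refine (add_le_add h1 h3).trans ?_
  have k4 : 0 ≤ |t| * (4 * n * c * (δ * a + ε * (1 + a'))) := by positivity
  have k5 : 0 ≤ (2 * p + 2 * n * (c + c * (e + 1) + c + c * p + c * q) + 4 * n * c * p)
    * (δ * a + ε * (1 + a')) := by positivity
  linarith

/-- An essential bound on a continuous function is a bound. -/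
theorem norm_le_of_essSup_le {V : Type*} [NormedAddCommGroup V] {f : Base n → V}
    (hf : Continuous f) {C : ℝ} (hC : 0 ≤ C)
    (h : essSup (fun x => ‖f x‖ₑ) (volume : Measure (Base n)) ≤ ENNReal.ofReal C) (x : Base n) :
    ‖f x‖ ≤ C := by
  have hae : ∀ᵐ y ∂(volume : Measure (Base n)), ‖f y‖ ≤ C := by
    filter_upwards [ENNReal.ae_le_essSup fun y => ‖f y‖ₑ] with y hy
    have := hy.trans h
    rwa [← ofReal_norm, ENNReal.ofReal_le_ofReal_iff hC] at this
  have hcl : IsClosed {y | ‖f y‖ ≤ C} := isClosed_le hf.norm continuous_const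
  have hd : Dense {y | ‖f y‖ ≤ C} := Measure.dense_of_ae hae
  have hx := hd x
  rwa [hcl.closure_eq] at hx

theorem FiberAssumption.resolventDeriv_le_of_conditionII (hH : FiberAssumption m D H₀ P E)
    {δ₀ : ℝ} {η : ℝ → ℝ} (hη : IsRate δ₀ η) (hII : ConditionII D H₀ P E δ₀ η) :
    ∃ C : ℝ, 0 ≤ C ∧ ∀ δ, 0 < δ → δ ≤ δ₀ → ∀ j x,
      ‖resolventDeriv D H₀ P E δ j x‖ ≤ C * δ⁻¹ * η δ := by
  obtain ⟨C, hC⟩ := hII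
  refine ⟨|C|, abs_nonneg C, fun δ hδ hδ0 j x => ?_⟩
  have hη0 : 0 ≤ η δ := (hη.mapsTo ⟨hδ.le, hδ0⟩).1
  refine norm_le_of_essSup_le (hH.contDiff_resolventDeriv hδ j).continuous (by positivity)
    ((hC δ ⟨hδ, hδ0⟩ j).trans (ENNReal.ofReal_le_ofReal ?_)) x
  gcongr
  exact le_abs_self C

theorem FiberAssumption.iteratedFDeriv_resolventDeriv_le_of_conditionIII (hm : 1 ≤ m)
    (hH : FiberAssumption m D H₀ P E) {δ₀ : ℝ} {η : ℝ → ℝ} (hη : IsRate δ₀ η)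
    (hIII : ConditionIII D H₀ P E δ₀ η) :
    ∃ C : ℝ, 0 ≤ C ∧ ∀ δ, 0 < δ → δ ≤ δ₀ → ∀ j x,
      ‖iteratedFDeriv ℝ 1 (resolventDeriv D H₀ P E δ j) x‖ ≤ C * δ⁻¹ * η δ := by
  obtain ⟨-, C, hC⟩ := hIII
  refine ⟨n * |C|, by positivity, fun δ hδ hδ0 j x => ?_⟩
  have hη0 : 0 ≤ η δ := (hη.mapsTo ⟨hδ.le, hδ0⟩).1
  have h1 : ∀ k, ‖partialFst (resolventDeriv D H₀ P E δ j) k x‖ ≤ |C| * δ⁻¹ * η δ := by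
    intro k
    have hcont : Continuous (partialFst (resolventDeriv D H₀ P E δ j) k) :=
      ((hH.contDiff_resolventDeriv hδ j).continuous_fderiv
        (by exact_mod_cast (by omega))).clm_apply continuous_const
    refine norm_le_of_essSup_le hcont (by positivity)
      ((hC δ ⟨hδ, hδ0⟩ k j).trans (ENNReal.ofReal_le_ofReal ?_)) x
    gcongr
    exact le_abs_self C
  refine (norm_iteratedFDeriv_one_le_of_partialFst _ x (by positivity) h1).trans_eq ?_
  ring

end AdiabaticEstimate

end SpaceAdiabatic

open SpaceAdiabatic in
theorem theorem1 {F : Type*} [NormedAddCommGroup F] [InnerProductSpace ℂ F] [CompleteSpace F]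
    [TopologicalSpace.SeparableSpace F] {n : ℕ} (m : ℕ) (hm : 2 ≤ m)
    (D : Submodule ℂ F) (H₀ : Base n → D →ₗ[ℂ] F) (P : Base n → F →L[ℂ] F) (E : Base n → ℝ)
    (h : ℝ → L2 n F →ₗ.[ℂ] L2 n F)
    (hH₀ : FiberAssumption m D H₀ P E) (hh : PerturbationAssumption m D H₀ h) :
    (∀ ε ∈ Set.Ioc (0 : ℝ) 1, IsSelfAdjoint (diagH D H₀ P h ε) ∧
      (diagH D H₀ P h ε).domain = (fullH D H₀ h ε).domain) ∧
    (ConditionI D H₀ P E → ∀ t : ℝ,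
      Tendsto (fun ε : ℝ => ‖fullU D H₀ h ε t - diagU D H₀ P h ε t‖) (𝓝[>] 0) (𝓝 0)) ∧
    (∀ (δ₀ : ℝ) (η : ℝ → ℝ), IsRate δ₀ η → ConditionII D H₀ P E δ₀ η →
      ∃ C : ℝ, ∀ ε : ℝ, 0 < ε → ε ≤ 1 → √ε ≤ δ₀ → ∀ t : ℝ,
        ‖fullU D H₀ h ε t - diagU D H₀ P h ε t‖ ≤ C * η (√ε) * (1 + |t|)) ∧
    (∀ (δ₀ : ℝ) (η : ℝ → ℝ), IsRate δ₀ η → ConditionIII D H₀ P E δ₀ η →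
      ∃ C : ℝ, ∀ ε : ℝ, 0 < ε → ε ≤ 1 → ε ≤ δ₀ → ∀ t : ℝ,
        ‖fullU D H₀ h ε t - diagU D H₀ P h ε t‖ ≤ C * η ε * (1 + |t|)) := by
  obtain ⟨C, hC0, hC⟩ := exists_adiabatic_estimate hm hH₀ hh
  obtain ⟨C₁, hC₁0, hC₁⟩ := hH₀.exists_resolventDeriv_bounds (by omega)
  -- The choice `δ = √ε`, with a bound `√ε a ≤ τ` for `G` and no information on its derivative.
  have hsqrt : ∀ ε τ : ℝ, 0 < ε → ε ≤ 1 → 0 ≤ τ →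
      (∀ j x, ‖resolventDeriv D H₀ P E (√ε) j x‖ ≤ (√ε)⁻¹ * τ) → ∀ t,
      ‖fullU D H₀ h ε t - diagU D H₀ P h ε t‖ ≤ C * (2 * C₁ + 2) * (τ + √ε) * (1 + |t|) := by
    intro ε τ hε hε1 hτ hb t
    have hs : 0 < √ε := Real.sqrt_pos.2 hε
    have hs1 : √ε ≤ 1 := Real.sqrt_le_one.2 hε1
    have hss : √ε * √ε = ε := Real.mul_self_sqrt hε.le
    have hεs : ε ≤ √ε := by
      have := mul_le_mul_of_nonneg_left hs1 hs.le
      rwa [hss, mul_one] at this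
    have ha : 0 ≤ (√ε)⁻¹ * τ := by positivity
    refine (hC ε (√ε) ((√ε)⁻¹ * τ) (C₁ * (√ε)⁻¹ * (1 + (√ε)⁻¹ * τ)) hε hεs hs1 ha (by positivity) hb
      (fun j x => (hC₁ j (√ε) _ hs hs1 ha (hb j)).1 x) t).trans ?_
    have e1 : √ε * ((√ε)⁻¹ * τ) = τ := mul_inv_cancel_left₀ hs.ne' τ
    have e2 : ε * (C₁ * (√ε)⁻¹ * (1 + (√ε)⁻¹ * τ)) = C₁ * (√ε + τ) := by
      nth_rw 1 [← hss]
      field_simp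
    rw [mul_add ε, e1, e2, mul_assoc C (2 * C₁ + 2)]
    refine mul_le_mul_of_nonneg_right (mul_le_mul_of_nonneg_left ?_ hC0) (by positivity)
    have h1 : 0 ≤ C₁ * (√ε + τ) := by positivity
    linarith
  refine ⟨fun ε hε => isSelfAdjoint_diagH hm hH₀ hh hε, fun hI t => ?_, fun δ₀ η hη hII => ?_,
    fun δ₀ η hη hIII => ?_⟩
  · rw [Metric.tendsto_nhds]
    intro ρ hρ
    set B := C * (2 * C₁ + 2) * (1 + |t|)
    have hB : 0 ≤ B := by positivity
    set τ := ρ / (2 * (B + 1))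
    have hτ : 0 < τ := by positivity
    have h0 : Tendsto (fun ε : ℝ => √ε) (𝓝[>] 0) (𝓝[>] 0) := by
      refine tendsto_nhdsWithin_iff.2 ⟨?_, ?_⟩
      · have := (Real.continuous_sqrt.tendsto 0).mono_left (nhdsWithin_le_nhds (s := Set.Ioi 0))
        rwa [Real.sqrt_zero] at this
      · filter_upwards [self_mem_nhdsWithin] with ε hε
        exact Real.sqrt_pos.2 hε
    have h1 : ∀ᶠ ε : ℝ in 𝓝[>] 0, ∀ j, essSup
        (fun x => ‖((√ε : ℝ) : ℂ) • resolventDeriv D H₀ P E (√ε) j x‖ₑ) volume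
          ≤ ENNReal.ofReal τ := by
      rw [eventually_all]
      intro j
      filter_upwards [((hI j).comp h0).eventually_lt_const (ENNReal.ofReal_pos.2 hτ)] with ε hε
      exact hε.le
    have h2 : ∀ᶠ ε : ℝ in 𝓝[>] 0, √ε < τ :=
      (tendsto_nhdsWithin_iff.1 h0).1.eventually_lt_const hτ
    filter_upwards [h1, h2, self_mem_nhdsWithin,
      (eventually_le_nhds (zero_lt_one (α := ℝ))).filter_mono nhdsWithin_le_nhds]
      with ε hε1 hε2 hε hε3
    have hs : 0 < √ε := Real.sqrt_pos.2 hε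
    have hb : ∀ j x, ‖resolventDeriv D H₀ P E (√ε) j x‖ ≤ (√ε)⁻¹ * τ := by
      intro j x
      have := norm_le_of_essSup_le ((hH₀.contDiff_resolventDeriv hs j).continuous.const_smul
        ((√ε : ℝ) : ℂ)) hτ.le (hε1 j) x
      rw [Pi.smul_apply, norm_smul, Complex.norm_real, Real.norm_eq_abs, abs_of_pos hs] at this
      rwa [le_inv_mul_iff₀ hs]
    have h3 := hsqrt ε τ hε hε3 hτ.le hb t
    rw [Real.dist_eq, sub_zero, abs_norm]
    refine h3.trans_lt ?_
    have h4 : B * (τ + √ε) ≤ B * (2 * τ) := mul_le_mul_of_nonneg_left (by linarith) hB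
    have h5 : 2 * τ * (B + 1) = ρ := by simp only [τ]; field_simp
    have h6 : C * (2 * C₁ + 2) * (τ + √ε) * (1 + |t|) = B * (τ + √ε) := by simp only [B]; ring
    linarith
  · obtain ⟨C₂, hC₂0, hC₂⟩ := hH₀.resolventDeriv_le_of_conditionII hη hII
    refine ⟨C * (2 * C₁ + 2) * (C₂ + 1), fun ε hε hε1 hεδ t => ?_⟩
    have hs : 0 < √ε := Real.sqrt_pos.2 hε
    have hη1 : √ε ≤ η (√ε) := hη.le _ ⟨hs.le, hεδ⟩
    have hη0 : 0 ≤ η (√ε) := hs.le.trans hη1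
    refine (hsqrt ε (C₂ * η (√ε)) hε hε1 (by positivity) (fun j x => ?_) t).trans ?_
    · refine (hC₂ _ hs hεδ j x).trans_eq ?_
      ring
    · rw [mul_assoc (C * (2 * C₁ + 2)) (C₂ + 1)]
      gcongr
      linarith
  · obtain ⟨C₂, hC₂0, hC₂⟩ := hH₀.resolventDeriv_le_of_conditionII hη hIII.1
    obtain ⟨C₃, hC₃0, hC₃⟩ :=
      hH₀.iteratedFDeriv_resolventDeriv_le_of_conditionIII (by omega) hη hIII
    refine ⟨C * (C₂ + 1 + C₃), fun ε hε hε1 hεδ t => ?_⟩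
    have hη1 : ε ≤ η ε := hη.le _ ⟨hε.le, hεδ⟩
    have hη0 : 0 ≤ η ε := hε.le.trans hη1
    refine (hC ε ε _ _ hε le_rfl hε1 (by positivity) (by positivity) (hC₂ ε hε hεδ)
      (hC₃ ε hε hεδ) t).trans ?_
    have e1 : ∀ c : ℝ, ε * (c * ε⁻¹ * η ε) = c * η ε := fun c => by field_simp
    rw [mul_add ε, e1, e1, mul_assoc C (C₂ + 1 + C₃)]
    refine mul_le_mul_of_nonneg_right (mul_le_mul_of_nonneg_left ?_ hC0) (by positivity)
    linarith
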